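/- Let $M$ be a smooth (finite-dimensional, Hausdorff, without boundary) Riemannian manifold with metric $\langle\cdot,\cdot\rangle$ and Levi-Civita connection $\nabla$. Write $\frac{D}{dt}$ for the covariant derivative along a curve, $\frac{D^{s+1}x}{dt^{s+1}}$ for the $s$-th covariant derivative along $x$ of the velocity $\frac{dx}{dt}$, and $R(X,Y)Z=\nabla_X\nabla_YZ-\nabla_Y\nabla_XZ-\nabla_{[X,Y]}Z$ for the curvature tensor. Let $T,\sigma>0$, let $(p_0,v_0),(p_T,v_T)\in TM$, let $O\subset M$ be a closed (possibly empty) obstacle set and let $V_q\colon M\setminus O\to\mathbb R$ be a smooth ($C^\infty$) function. Let $\Omega$ be the set of all $C^1$ piecewise smooth curves $x\colon[0,T]\to M\setminus O$ (that is, $x$ is $C^1$ on $[0,T]$ and there is a partition $0=t_0<t_1<\dots<t_l=T$ such that $x$ is $C^\infty$ on each $[t_{i-1},t_i]$) with $$x(0)=p_0,\quad x(T)=p_T,\quad \tfrac{dx}{dt}(0)=v_0,\quad \tfrac{dx}{dt}(T)=v_T,$$ and for $x\in\Omega$ put $$J(x)=\int_0^T\frac12\left(\Big\|\frac{D^2x}{dt^2}(t)\Big\|^2+\sigma\Big\|\frac{dx}{dt}(t)\Big\|^2+V_q(x(t))\right)dt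 .$$ (The integrand is defined except at the finitely many break points of $x$.) Suppose $x\in\Omega$ is a local minimizer of $J$: there is a $C^1$-neighbourhood of $x$ in $\Omega$ (a neighbourhood for the topology of uniform convergence on $[0,T]$ of the curves $t\mapsto(x(t),\frac{dx}{dt}(t))$ in $TM$) such that $J(x)\le J(\tilde x)$ for all $\tilde x$ in it. Then $x$ is $C^\infty$ on $[0,T]$, and for every $t\in[0,T]$ (with one-sided derivatives at the end points) $$\frac{D^4x}{dt^4}+R\left(\frac{D^2x}{dt^2},\frac{dx}{dt}\right)\frac{dx}{dt}-\sigma\frac{D^2x}{dt^2}+\frac12\,\mathrm{grad}\,V_q(x)=0 .$$ -/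

import Mathlib

open Set Bundle
open scoped Manifold ContDiff Topology

noncomputable section

namespace ObstacleAvoidance

variable {E : Type*} [NormedAddCommGroup E] [NormedSpace ℝ E]
  {M : Type*} [TopologicalSpace M] [ChartedSpace E M]

/-! ### The Levi-Civita connection and its curvature in a chart -/

section Chart

variable [IsManifold 𝓘(ℝ, E) ∞ M] [RiemannianBundle (fun p : M ↦ TangentSpace 𝓘(ℝ, E) p)]

/-- The coordinates, in the chart at `p`, of tangent vectors at a point `q` of the domain of that
chart: the differential of the chart at `q`. -/
def chartCoord (p q : M) : TangentSpace 𝓘(ℝ, E) q →L[ℝ] E :=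
  mfderiv 𝓘(ℝ, E) 𝓘(ℝ, E) (extChartAt 𝓘(ℝ, E) p) q

/-- The inner product of the Riemannian metric on the tangent space at `p`, as a bilinear form. -/
def metricAt (p : M) :
    TangentSpace 𝓘(ℝ, E) p →L[ℝ] TangentSpace 𝓘(ℝ, E) p →L[ℝ] ℝ :=
  innerSL ℝ

/-- The differential at `y` of the inverse of the chart at `p`. -/
def chartInv (p : M) (y : E) :
    E →L[ℝ] TangentSpace 𝓘(ℝ, E) ((extChartAt 𝓘(ℝ, E) p).symm y) :=
  mfderiv 𝓘(ℝ, E) 𝓘(ℝ, E) (extChartAt 𝓘(ℝ, E) p).symm y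

/-- The Riemannian metric of `M` read in the chart at `p`: for `y` in the target of the chart
`φ` at `p`, this is the bilinear form
`(u, v) ↦ ⟪d(φ⁻¹)_y u, d(φ⁻¹)_y v⟫`, i.e. the matrix `g_ij(y)`. -/
def chartMetric (p : M) (y : E) : E →L[ℝ] E →L[ℝ] ℝ :=
  ((chartInv p y).precomp ℝ) ∘L (metricAt ((extChartAt 𝓘(ℝ, E) p).symm y) ∘L chartInv p y)

/-- The Christoffel symbols `Γ(y)(u, v) = Γ^k_ij u^i v^j` of the Levi-Civita connection in the
chart at `p`. The vector `Γ(y)(u, v)` is the one determined by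
`g(Γ(u, v), w) = ½ (∂_u g(v, w) + ∂_v g(u, w) - ∂_w g(u, v))` for all `w`. -/
def christoffel (p : M) (y u v : E) : E :=
  (chartMetric p y).inverse ((1 / 2 : ℝ) •
    (fderiv ℝ (chartMetric p) y u v + fderiv ℝ (chartMetric p) y v u
      - ((fderiv ℝ (chartMetric p) y).flip u).flip v))

/-- The Levi-Civita covariant derivative `∇_X Y` of vector fields read in the chart at `p`. -/
def chartNabla (p : M) (X Y : E → E) (y : E) : E :=
  fderiv ℝ Y y (X y) + christoffel p y (X y) (Y y)

/-- The expression `∇_X ∇_Y Z - ∇_Y ∇_X Z - ∇_[X,Y] Z` for vector fields read in the chart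
at `p`. -/
def chartCurvature (p : M) (X Y Z : E → E) (y : E) : E :=
  chartNabla p X (chartNabla p Y Z) y - chartNabla p Y (chartNabla p X Z) y
    - chartNabla p (VectorField.lieBracket ℝ X Y) Z y

/-- The curvature tensor `R(u, v) w` at `p`, for tangent vectors `u`, `v`, `w` at `p`. It is
`∇_U ∇_V W - ∇_V ∇_U W - ∇_[U,V] W` evaluated at `p`, where `U`, `V`, `W` are the
extensions of `u`, `v`, `w` with constant components in the chart at `p` (the value does not depend
on the extensions, `R` being a tensor). -/
def curvature (p : M) (u v w : TangentSpace 𝓘(ℝ, E) p) : TangentSpace 𝓘(ℝ, E) p :=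
  (chartCoord p p).inverse
    (chartCurvature p (fun _ ↦ chartCoord p p u) (fun _ ↦ chartCoord p p v)
      (fun _ ↦ chartCoord p p w) (extChartAt 𝓘(ℝ, E) p p))

/-- The Riemannian gradient: `⟪grad V (p), w⟫ = dV_p(w)` for all `w`. -/
def grad (V : M → ℝ) (p : M) : TangentSpace 𝓘(ℝ, E) p :=
  (metricAt p).inverse (mfderiv 𝓘(ℝ, E) 𝓘(ℝ, ℝ) V p)

end Chart

/-! ### Calculus along a curve `x : [0, T] → M`

A curve on `[0, T]` is represented by a function on `ℝ` whose values outside `[0, T]` play no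
role; derivatives at the end points are one-sided. -/

/-- The velocity `dx/dt`. -/
def velocity (T : ℝ) (x : ℝ → M) (t : ℝ) : TangentSpace 𝓘(ℝ, E) (x t) :=
  mfderivWithin 𝓘(ℝ, ℝ) 𝓘(ℝ, E) x (Icc 0 T) t (1 : ℝ)

/-- The curve `t ↦ (x(t), dx/dt(t))` in the tangent bundle. -/
def velocityLift (T : ℝ) (x : ℝ → M) (t : ℝ) : TangentBundle 𝓘(ℝ, E) M :=
  ⟨x t, velocity T x t⟩

/-- `x` is `C¹` on `[0, T]`, and there is a partition `0 = t₀ < t₁ < ⋯ < t_l = T` such that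
`x` is smooth on each `[t_i, t_(i+1)]`. -/
def IsC1PiecewiseSmooth (T : ℝ) (x : ℝ → M) : Prop :=
  ContMDiffOn 𝓘(ℝ, ℝ) 𝓘(ℝ, E) 1 x (Icc 0 T) ∧
  ∃ (l : ℕ) (s : Fin (l + 1) → ℝ), StrictMono s ∧ s 0 = 0 ∧ s (Fin.last l) = T ∧
    ∀ i : Fin l, ContMDiffOn 𝓘(ℝ, ℝ) 𝓘(ℝ, E) ∞ x (Icc (s i.castSucc) (s i.succ))

/-- The admissible set `Ω`: the `C¹` piecewise smooth curves `x` on `[0, T]` with values off the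
obstacle set `O`, where the potential is defined, such that `(x(0), dx/dt(0)) = P₀` and
`(x(T), dx/dt(T)) = P₁`. For `O = ∅` these are all such curves in `M`. -/
structure AdmissibleCurve {T : ℝ} (hT : 0 < T) (P₀ P₁ : TangentBundle 𝓘(ℝ, E) M)
    (O : Set M) where
  /-- The underlying function. -/
  curve : ℝ → M
  regular : IsC1PiecewiseSmooth (E := E) T curve
  start : velocityLift T curve 0 = P₀
  finish : velocityLift T curve T = P₁
  avoids : ∀ t ∈ Icc 0 T, curve t ∉ O

section CovariantDerivative

variable [IsManifold 𝓘(ℝ, E) ∞ M] [RiemannianBundle (fun p : M ↦ TangentSpace 𝓘(ℝ, E) p)]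

/-- The covariant time derivative `DW/dt` of a vector field `W` along `x`. In the chart at
`x t` it is `dw/dt + Γ(dξ/dt, w)`, where `ξ` and `w` are the coordinate expressions of
`x` and `W`. -/
def covDeriv (T : ℝ) (x : ℝ → M) (W : ∀ t, TangentSpace 𝓘(ℝ, E) (x t)) (t : ℝ) :
    TangentSpace 𝓘(ℝ, E) (x t) :=
  let ξ : ℝ → E := fun r ↦ extChartAt 𝓘(ℝ, E) (x t) (x r)
  let w : ℝ → E := fun r ↦ chartCoord (x t) (x r) (W r)
  (chartCoord (x t) (x t)).inverse
    (derivWithin w (Icc 0 T) t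
      + christoffel (x t) (ξ t) (derivWithin ξ (Icc 0 T) t) (w t))

/-- `D^(k+1) x / dt^(k+1)`: the `k`-th covariant derivative along `x` of the velocity. -/
def curveDeriv (T : ℝ) (x : ℝ → M) : ℕ → ∀ t, TangentSpace 𝓘(ℝ, E) (x t)
  | 0 => velocity T x
  | k + 1 => covDeriv T x (curveDeriv T x k)

end CovariantDerivative

namespace AdmissibleCurve

variable [IsManifold 𝓘(ℝ, E) ∞ M] {T : ℝ} {hT : 0 < T}
  {P₀ P₁ : TangentBundle 𝓘(ℝ, E) M} {O : Set M}

theorem continuousOn_velocityLift (x : AdmissibleCurve hT P₀ P₁ O) :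
    ContinuousOn (velocityLift (E := E) T x.curve) (Icc 0 T) := by
  have h := x.regular.1.continuousOn_tangentMapWithin le_rfl
    (uniqueDiffOn_Icc hT).uniqueMDiffOn
  have h' : Continuous (fun t : ℝ ↦ (⟨t, (1 : ℝ)⟩ : TangentBundle 𝓘(ℝ, ℝ) ℝ)) :=
    (tangentBundleModelSpaceHomeomorph 𝓘(ℝ, ℝ)).symm.continuous.comp
      (continuous_id.prodMk continuous_const)
  exact h.comp h'.continuousOn fun t ht ↦ ht

/-- The curve `t ↦ (x(t), dx/dt(t))` as a continuous map `[0, T] → TM`. -/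
def lift (x : AdmissibleCurve hT P₀ P₁ O) : C(Icc (0 : ℝ) T, TangentBundle 𝓘(ℝ, E) M) :=
  ⟨fun t ↦ velocityLift T x.curve t, x.continuousOn_velocityLift.domRestrict⟩

/-- The `C¹` topology on `Ω`: uniform closeness on `[0, T]` of the curves and of their velocities,
i.e. the compact-open topology on the curves `(x, dx/dt)` in `TM`. -/
instance : TopologicalSpace (AdmissibleCurve hT P₀ P₁ O) :=
  TopologicalSpace.induced lift inferInstance

variable [RiemannianBundle (fun p : M ↦ TangentSpace 𝓘(ℝ, E) p)]

/-- The functional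
`J(x) = ∫₀ᵀ ½ (‖D²x/dt²‖² + σ ‖dx/dt‖² + V(x)) dt`. -/
def energy (σ : ℝ) (V : M → ℝ) (x : AdmissibleCurve hT P₀ P₁ O) : ℝ :=
  ∫ t in (0 : ℝ)..T, (1 / 2 : ℝ) *
    (‖curveDeriv (E := E) T x.curve 1 t‖ ^ 2 + σ * ‖velocity (E := E) T x.curve t‖ ^ 2
      + V (x.curve t))

end AdmissibleCurve

end ObstacleAvoidance

end

open ObstacleAvoidance

set_option linter.unusedSectionVars false

/-! ### Local Riemannian geometry: Christoffel symbols and curvature of a metric on an open set. -/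

noncomputable section

set_option maxSynthPendingDepth 3

namespace ObstacleAvoidance

/-! In a chart, J is the integral of L(y, u, a) = ½(|a + Γ(u, u)|² + σ|u|² + V(y)) along the 2-jet
of the curve. A smooth variation supported in a short time interval, during which the curve stays in
one chart and off O, is admissible and depends continuously on its parameter in the C¹ topology.
Hence the first variation vanishes: ∫ (L_y φ + L_u φ' + L_a φ'') = 0 for all test functions φ
(`integral_fderiv_lagrangian_eq_zero`).

The acceleration may jump at break points, so the equation cannot be read off piece by piece. The
second-order du Bois-Reymond lemma (`exists_eq_primitive_of_integral_test`) shows that the momentum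
L_a agrees, off the breaks, with an iterated primitive, hence extends continuously. Since L_a = g(a
+ Γ(u, u), ·) and g is nondegenerate, a is a smooth function of (y, u, L_a). The acceleration
therefore extends continuously too, and a bootstrap gives smoothness (`weak_extremal_regularity`).

The pointwise equation (L_a' - L_u)' = -L_y is then made covariant (`euler_lagrange`): metric
compatibility and symmetry of Γ turn it into g(D⁴x - σ D²x + ½ grad V, e) + g(D²x, R(e, x')x') = 0,
and the pair symmetry of the curvature moves e out of R (`curvature_swap`).

At times 0 and T no variation is available. Smoothness there is part of piecewise smoothness, and
the equation extends from the interior by continuity. `covDeriv` uses at each time the chart at the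
current point, while the argument fixes one chart; `chartCoord_covDeriv` reconciles the two through
the transformation law of the Christoffel symbols. -/

theorem two_le_infty : (2 : WithTop ℕ∞) ≤ ∞ :=
  WithTop.coe_le_coe.2 (le_top : (2 : ℕ∞) ≤ ⊤)

/-- Definiteness gives injectivity, and a finite-dimensional space and its dual have equal
dimension. This guarantees that `inverse` in `christoffel` and `grad` is a genuine inverse rather
than its default value. -/
theorem isInvertible_of_posDef {W : Type*} [NormedAddCommGroup W] [NormedSpace ℝ W]
    [FiniteDimensional ℝ W] (B : W →L[ℝ] W →L[ℝ] ℝ) (hB : ∀ u, u ≠ 0 → 0 < B u u) :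
    B.IsInvertible := by
  have hinj : Function.Injective (B : W →ₗ[ℝ] W →L[ℝ] ℝ) := by
    rw [← LinearMap.ker_eq_bot, LinearMap.ker_eq_bot']
    intro m hm
    by_contra h
    have h1 := hB m h
    have h2 : B m = 0 := hm
    rw [h2] at h1
    simp at h1
  have hdim : Module.finrank ℝ W = Module.finrank ℝ (W →L[ℝ] ℝ) := by
    rw [← (LinearMap.toContinuousLinearMap (𝕜 := ℝ) (E := W) (F' := ℝ)).finrank_eq]
    exact (Subspace.dual_finrank_eq (K := ℝ) (V := W)).symm
  have : FiniteDimensional ℝ (W →L[ℝ] ℝ) := inferInstance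
  exact ⟨(LinearEquiv.ofInjectiveOfFinrankEq _ hinj hdim).toContinuousLinearEquiv, by
    ext x y; rfl⟩

variable {E : Type*} [NormedAddCommGroup E] [NormedSpace ℝ E]

/-- A smooth Riemannian metric on an open subset of a vector space. -/
structure IsLocalMetric (g : E → E →L[ℝ] E →L[ℝ] ℝ) (U : Set E) : Prop where
  isOpen : IsOpen U
  contDiffOn : ContDiffOn ℝ ∞ g U
  symm : ∀ y ∈ U, ∀ u v, g y u v = g y v u
  pos : ∀ y ∈ U, ∀ u, u ≠ 0 → 0 < g y u u

/-- The Christoffel symbols of a metric on a vector space, as a bilinear map. -/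
def christoffelCLM (g : E → E →L[ℝ] E →L[ℝ] ℝ) (y : E) : E →L[ℝ] E →L[ℝ] E :=
  (ContinuousLinearMap.compL ℝ E (E →L[ℝ] ℝ) E (g y).inverse) ∘L ((1 / 2 : ℝ) •
    (fderiv ℝ g y + (fderiv ℝ g y).flip
      - (ContinuousLinearMap.flipₗᵢ ℝ E E ℝ : _ →L[ℝ] _) ∘L (fderiv ℝ g y).flip))

theorem christoffelCLM_apply (g : E → E →L[ℝ] E →L[ℝ] ℝ) (y u v : E) :
    christoffelCLM g y u v = (g y).inverse ((1 / 2 : ℝ) •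
    (fderiv ℝ g y u v + fderiv ℝ g y v u - ((fderiv ℝ g y).flip u).flip v)) := rfl

/-- The curvature tensor of a metric on a vector space. -/
def localCurvature (g : E → E →L[ℝ] E →L[ℝ] ℝ) (y u v w : E) : E :=
  fderiv ℝ (christoffelCLM g) y u v w - fderiv ℝ (christoffelCLM g) y v u w
    + christoffelCLM g y u (christoffelCLM g y v w)
    - christoffelCLM g y v (christoffelCLM g y u w)

namespace IsLocalMetric

variable [FiniteDimensional ℝ E] {g : E → E →L[ℝ] E →L[ℝ] ℝ} {U : Set E}

theorem isInvertible (hg : IsLocalMetric g U) {y : E} (hy : y ∈ U) : (g y).IsInvertible :=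
  isInvertible_of_posDef _ (hg.pos y hy)

theorem ext_left (hg : IsLocalMetric g U) {y : E} (hy : y ∈ U) {u v : E}
    (h : ∀ w, g y u w = g y v w) : u = v := by
  by_contra hne
  have := hg.pos y hy (u - v) (sub_ne_zero.2 hne)
  simp [h] at this

theorem apply_inverse (hg : IsLocalMetric g U) {y : E} (hy : y ∈ U) (θ : E →L[ℝ] ℝ) :
    g y ((g y).inverse θ) = θ :=
  (hg.isInvertible hy).self_apply_inverse θ

theorem inverse_apply (hg : IsLocalMetric g U) {y : E} (hy : y ∈ U) (u : E) :
    (g y).inverse (g y u) = u :=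
  (hg.isInvertible hy).inverse_apply_self u

theorem contDiffAt (hg : IsLocalMetric g U) {y : E} (hy : y ∈ U) : ContDiffAt ℝ ∞ g y :=
  hg.contDiffOn.contDiffAt (hg.isOpen.mem_nhds hy)

theorem differentiableAt (hg : IsLocalMetric g U) {y : E} (hy : y ∈ U) :
    DifferentiableAt ℝ g y := (hg.contDiffAt hy).differentiableAt (by simp)

theorem contDiffOn_inverse (hg : IsLocalMetric g U) :
    ContDiffOn ℝ ∞ (fun y ↦ (g y).inverse) U := by
  have := FiniteDimensional.complete ℝ E
  intro y hy
  obtain ⟨e, he⟩ := hg.isInvertible hy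
  have h := contDiffAt_map_inverse (𝕜 := ℝ) (n := ∞) e
  rw [he] at h
  exact (h.comp y (hg.contDiffAt hy)).contDiffWithinAt

theorem contDiffOn_fderiv (hg : IsLocalMetric g U) : ContDiffOn ℝ ∞ (fderiv ℝ g) U :=
  hg.contDiffOn.fderiv_of_isOpen hg.isOpen (by simp)

theorem contDiffOn_christoffel (hg : IsLocalMetric g U) :
    ContDiffOn ℝ ∞ (christoffelCLM g) U := by
  rw [contDiffOn_clm_apply]
  intro u
  rw [contDiffOn_clm_apply]
  intro v
  simp only [christoffelCLM_apply]
  refine hg.contDiffOn_inverse.clm_apply (ContDiffOn.const_smul _ ?_)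
  have h := hg.contDiffOn_fderiv
  refine ((((h.clm_apply contDiffOn_const).clm_apply contDiffOn_const)).add
    ((h.clm_apply contDiffOn_const).clm_apply contDiffOn_const)).sub ?_
  rw [contDiffOn_clm_apply]
  intro w
  exact ((h.clm_apply (contDiffOn_const (c := w))).clm_apply
    (contDiffOn_const (c := u))).clm_apply (contDiffOn_const (c := v))

theorem christoffel_differentiableAt (hg : IsLocalMetric g U) {y : E} (hy : y ∈ U) :
    DifferentiableAt ℝ (christoffelCLM g) y :=
  (hg.contDiffOn_christoffel.contDiffAt (hg.isOpen.mem_nhds hy)).differentiableAt (by simp)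

/-- Lowering the index removes `inverse`. With `ext_left`, identities for Christoffel symbols reduce
to linear algebra in the first derivatives of g. -/
theorem koszul (hg : IsLocalMetric g U) {y : E} (hy : y ∈ U) (u v w : E) :
    g y (christoffelCLM g y u v) w =
      1 / 2 * (fderiv ℝ g y u v w + fderiv ℝ g y v u w - fderiv ℝ g y w u v) := by
  rw [christoffelCLM_apply, hg.apply_inverse hy]
  rfl

theorem hasFDerivAt_apply₂ (hg : IsLocalMetric g U) {y : E} (hy : y ∈ U) (e u v : E) :
    fderiv ℝ (fun z ↦ g z u v) y e = fderiv ℝ g y e u v := by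
  have h := (((hg.differentiableAt hy).hasFDerivAt.clm_apply (hasFDerivAt_const u y)).clm_apply
    (hasFDerivAt_const v y)).fderiv
  rw [h]; simp

theorem fderiv_symm (hg : IsLocalMetric g U) {y : E} (hy : y ∈ U) (e u v : E) :
    fderiv ℝ g y e u v = fderiv ℝ g y e v u := by
  rw [← hg.hasFDerivAt_apply₂ hy, ← hg.hasFDerivAt_apply₂ hy]
  have : (fun z ↦ g z u v) =ᶠ[𝓝 y] (fun z ↦ g z v u) := by
    filter_upwards [hg.isOpen.mem_nhds hy] with z hz using hg.symm z hz u v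
  rw [this.fderiv_eq]

theorem christoffel_symm (hg : IsLocalMetric g U) {y : E} (hy : y ∈ U) (u v : E) :
    christoffelCLM g y u v = christoffelCLM g y v u := by
  refine hg.ext_left hy fun w ↦ ?_
  rw [hg.koszul hy, hg.koszul hy, hg.fderiv_symm hy w u v]
  ring

/-- This is ∇g = 0. It is used below to replace derivatives of g by Christoffel symbols. -/
theorem compatible (hg : IsLocalMetric g U) {y : E} (hy : y ∈ U) (e u v : E) :
    fderiv ℝ g y e u v = g y (christoffelCLM g y e u) v + g y u (christoffelCLM g y e v) := by
  rw [hg.symm y hy u, hg.koszul hy, hg.koszul hy, hg.fderiv_symm hy e v u,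
    hg.fderiv_symm hy u e v, hg.fderiv_symm hy v e u]
  ring

theorem fderiv_christoffel_symm (hg : IsLocalMetric g U) {y : E} (hy : y ∈ U) (e u v : E) :
    fderiv ℝ (christoffelCLM g) y e u v = fderiv ℝ (christoffelCLM g) y e v u := by
  have h : ∀ u v, fderiv ℝ (fun z ↦ christoffelCLM g z u v) y e
      = fderiv ℝ (christoffelCLM g) y e u v := by
    intro u v
    rw [(((hg.christoffel_differentiableAt hy).hasFDerivAt.clm_apply
      (hasFDerivAt_const u y)).clm_apply (hasFDerivAt_const v y)).fderiv]
    simp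
  rw [← h, ← h]
  have : (fun z ↦ christoffelCLM g z u v) =ᶠ[𝓝 y] (fun z ↦ christoffelCLM g z v u) := by
    filter_upwards [hg.isOpen.mem_nhds hy] with z hz using hg.christoffel_symm hz u v
  rw [this.fderiv_eq]

theorem curvature_antisymm (u v w y : E) :
    localCurvature g y u v w = - localCurvature g y v u w := by
  simp only [localCurvature]; abel

/-- The connection is torsion-free: by symmetry of Γ and of its derivative, the twelve terms cancel
in pairs. -/
theorem bianchi (hg : IsLocalMetric g U) {y : E} (hy : y ∈ U) (u v w : E) :
    localCurvature g y u v w + localCurvature g y v w u + localCurvature g y w u v = 0 := by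
  simp only [localCurvature]
  rw [hg.fderiv_christoffel_symm hy u w v, hg.fderiv_christoffel_symm hy v w u,
    hg.fderiv_christoffel_symm hy w v u, hg.christoffel_symm hy w u, hg.christoffel_symm hy w v,
    hg.christoffel_symm hy v u]
  abel

/-- Differentiating `compatible` once more expresses the second derivative of g through Γ. Its
symmetry in the two directions is the claim, since antisymmetrisation cancels the mixed terms g(Γ,
Γ). -/
theorem curvature_skew (hg : IsLocalMetric g U) {y : E} (hy : y ∈ U) (u v w z : E) :
    g y (localCurvature g y u v w) z + g y w (localCurvature g y u v z) = 0 := by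
  have key : ∀ u v, fderiv ℝ (fderiv ℝ g) y u v w z =
      g y (christoffelCLM g y u (christoffelCLM g y v w)) z
      + g y (christoffelCLM g y v w) (christoffelCLM g y u z)
      + g y (fderiv ℝ (christoffelCLM g) y u v w) z
      + g y (christoffelCLM g y u w) (christoffelCLM g y v z)
      + g y w (christoffelCLM g y u (christoffelCLM g y v z))
      + g y w (fderiv ℝ (christoffelCLM g) y u v z) := by
    intro u v
    have hd : DifferentiableAt ℝ (fderiv ℝ g) y :=
      (hg.contDiffOn_fderiv.contDiffAt (hg.isOpen.mem_nhds hy)).differentiableAt (by simp)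
    have h1 : fderiv ℝ (fun x ↦ fderiv ℝ g x v w z) y u = fderiv ℝ (fderiv ℝ g) y u v w z := by
      rw [(((hd.hasFDerivAt.clm_apply (hasFDerivAt_const v y)).clm_apply
        (hasFDerivAt_const w y)).clm_apply (hasFDerivAt_const z y)).fderiv]
      simp
    have h2 : (fun x ↦ fderiv ℝ g x v w z) =ᶠ[𝓝 y] fun x ↦
        g x (christoffelCLM g x v w) z + g x w (christoffelCLM g x v z) := by
      filter_upwards [hg.isOpen.mem_nhds hy] with x hx using hg.compatible hx v w z
    rw [← h1, h2.fderiv_eq]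
    have hG := (hg.differentiableAt hy).hasFDerivAt
    have hC := (hg.christoffel_differentiableAt hy).hasFDerivAt
    have hCv := fun a ↦ (hC.clm_apply (hasFDerivAt_const v y)).clm_apply (hasFDerivAt_const a y)
    rw [(((hG.clm_apply (hCv w)).clm_apply (hasFDerivAt_const z y)).fun_add
      ((hG.clm_apply (hasFDerivAt_const w y)).clm_apply (hCv z))).fderiv]
    simp [hg.compatible hy]
    ring
  have hs : fderiv ℝ (fderiv ℝ g) y u v = fderiv ℝ (fderiv ℝ g) y v u :=
    ((hg.contDiffAt hy).isSymmSndFDerivAt (by simpa using two_le_infty)).eq u v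
  have e1 := key u v
  rw [hs, key v u] at e1
  simp only [localCurvature, map_add, map_sub, add_apply,
    sub_apply]
  linarith

/-- The octahedron argument: the four Bianchi identities obtained by rotating (a, b, c, d) are
combined, and skewness in each pair cancels all but the two wanted terms. -/
theorem curvature_pair_symm (hg : IsLocalMetric g U) {y : E} (hy : y ∈ U) (a b c d : E) :
    g y (localCurvature g y a b c) d = g y (localCurvature g y c d a) b := by
  have hB : ∀ a b c d, g y (localCurvature g y a b c) d + g y (localCurvature g y b c a) d
      + g y (localCurvature g y c a b) d = 0 := by
    intro a b c d
    have := congrArg (fun x ↦ g y x d) (hg.bianchi hy a b c)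
    simpa using this
  have hA : ∀ a b c d, g y (localCurvature g y a b c) d
      = - g y (localCurvature g y b a c) d := by
    intro a b c d
    rw [curvature_antisymm]; simp
  have hS : ∀ a b c d, g y (localCurvature g y a b c) d
      = - g y (localCurvature g y a b d) c := by
    intro a b c d
    have := hg.curvature_skew hy a b c d
    rw [hg.symm y hy c] at this
    linarith
  have h1 := hB a b c d
  have h2 := hB b c d a
  have h3 := hB c d a b
  have h4 := hB d a b c
  linarith [hS a b c d, hS a b d c, hS b c a d, hS b c d a, hS c a b d, hS c a d b, hS c d b a,
    hS c d a b, hS d b c a, hS d b a c, hS d a c b, hS d a b c, hA c a b d, hA a c d b, hA b d c a,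
    hA d b a c, hA a c b d, hA b d a c, hS a c b d, hS b d a c]

/-- The Euler-Lagrange equation produces R(e, u)u paired with the acceleration a, where e is the
direction of variation. This isolates e, so that the equation becomes one between vectors. -/
theorem curvature_swap (hg : IsLocalMetric g U) {y : E} (hy : y ∈ U) (e u a : E) :
    g y a (localCurvature g y e u u) = g y (localCurvature g y a u u) e := by
  rw [hg.symm y hy, hg.curvature_pair_symm hy e u u a, curvature_antisymm]
  have := hg.curvature_skew hy a u e u
  rw [hg.symm y hy e] at this
  simp only [map_neg, neg_apply]
  linarith

/-- The transformation law of the Christoffel symbols under a change of coordinates. -/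
theorem christoffel_transform {g' : E → E →L[ℝ] E →L[ℝ] ℝ} {U' : Set E}
    (hg : IsLocalMetric g U) (hg' : IsLocalMetric g' U') {τ : E → E} {y : E} (hy : y ∈ U')
    (hτy : τ y ∈ U) (hτ : ContDiffAt ℝ ∞ τ y)
    (hpull : ∀ᶠ z in 𝓝 y, ∀ u v, g' z u v = g (τ z) (fderiv ℝ τ z u) (fderiv ℝ τ z v))
    (hsurj : Function.Surjective (fderiv ℝ τ y)) (u v : E) :
    fderiv ℝ τ y (christoffelCLM g' y u v) =
      christoffelCLM g (τ y) (fderiv ℝ τ y u) (fderiv ℝ τ y v) + fderiv ℝ (fderiv ℝ τ) y u v := by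
  -- Product rule on the pullback relation. In the Koszul combination, symmetry of the second
  -- derivative of τ leaves only the term containing D²τ(u, v).
  have hD : ∀ e u v, fderiv ℝ g' y e u v =
      fderiv ℝ g (τ y) (fderiv ℝ τ y e) (fderiv ℝ τ y u) (fderiv ℝ τ y v)
      + g (τ y) (fderiv ℝ (fderiv ℝ τ) y e u) (fderiv ℝ τ y v)
      + g (τ y) (fderiv ℝ τ y u) (fderiv ℝ (fderiv ℝ τ) y e v) := by
    intro e u v
    rw [← hg'.hasFDerivAt_apply₂ hy]
    have h2 : (fun z ↦ g' z u v) =ᶠ[𝓝 y]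
        fun z ↦ g (τ z) (fderiv ℝ τ z u) (fderiv ℝ τ z v) := by
      filter_upwards [hpull] with z hz using hz u v
    rw [h2.fderiv_eq]
    have hT := (hτ.differentiableAt (by simp)).hasFDerivAt
    have hG := (hg.differentiableAt hτy).hasFDerivAt.comp y hT
    have hDT := ((hτ.fderiv_right (m := ∞) (by simp)).differentiableAt (by simp)).hasFDerivAt
    have := ((hG.clm_apply (hDT.clm_apply (hasFDerivAt_const u y))).clm_apply
      (hDT.clm_apply (hasFDerivAt_const v y))).fderiv
    simp only [Function.comp_def] at this
    rw [this]
    simp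
    ring
  have hs : ∀ u v, fderiv ℝ (fderiv ℝ τ) y u v = fderiv ℝ (fderiv ℝ τ) y v u :=
    (hτ.isSymmSndFDerivAt (by simpa using two_le_infty)).eq
  refine hg.ext_left hτy fun w' ↦ ?_
  -- It suffices to test against vectors in the image of Dτ, on which the pullback relation
  -- exchanges g for g'.
  obtain ⟨w, rfl⟩ := hsurj w'
  rw [← hpull.self_of_nhds, hg'.koszul hy, hD, hD, hD]
  simp only [map_add, add_apply]
  rw [hg.koszul hτy, hs v u, hs w u, hs w v, hg.symm _ hτy (fderiv ℝ τ y u) (fderiv ℝ (fderiv ℝ τ) y v w),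
    hg.symm _ hτy (fderiv ℝ τ y v) (fderiv ℝ (fderiv ℝ τ) y u w)]
  ring

end IsLocalMetric

end ObstacleAvoidance
end

/-! ### The Lagrangian in a chart and its covariant Euler-Lagrange equation. -/

noncomputable section

set_option maxSynthPendingDepth 3

namespace ObstacleAvoidance
variable {E : Type*} [NormedAddCommGroup E] [NormedSpace ℝ E]

/-- The Lagrangian `½ (‖a + Γ(u, u)‖² + σ ‖u‖² + V(y))`, as a function of `(y, u, a)`. -/
def lagrangian (g : E → E →L[ℝ] E →L[ℝ] ℝ) (σ : ℝ) (V : E → ℝ) (z : E × E × E) : ℝ :=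
  1 / 2 * (g z.1 (z.2.2 + christoffelCLM g z.1 z.2.1 z.2.1)
      (z.2.2 + christoffelCLM g z.1 z.2.1 z.2.1)
    + σ * g z.1 z.2.1 z.2.1 + V z.1)

/-- The covariant derivative of a vector field `w` along a curve `ξ` in a vector space. -/
def covAlong (g : E → E →L[ℝ] E →L[ℝ] ℝ) (ξ w : ℝ → E) (t : ℝ) : E :=
  deriv w t + christoffelCLM g (ξ t) (deriv ξ t) (w t)

namespace IsLocalMetric

variable [FiniteDimensional ℝ E] {g : E → E →L[ℝ] E →L[ℝ] ℝ} {U : Set E}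

theorem contDiffOn_lagrangian (hg : IsLocalMetric g U) (σ : ℝ) {V : E → ℝ}
    (hV : ContDiffOn ℝ ∞ V U) :
    ContDiffOn ℝ ∞ (lagrangian g σ V) (U ×ˢ (univ : Set (E × E))) := by
  have h1 : MapsTo (Prod.fst : E × E × E → E) (U ×ˢ (univ : Set (E × E))) U := fun z hz ↦ hz.1
  have hG := hg.contDiffOn.comp (contDiff_fst (𝕜 := ℝ) (n := ∞)).contDiffOn h1
  have hC := hg.contDiffOn_christoffel.comp (contDiff_fst (𝕜 := ℝ) (n := ∞)).contDiffOn h1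
  have hV' := hV.comp (contDiff_fst (𝕜 := ℝ) (n := ∞)).contDiffOn h1
  have hu : ContDiffOn ℝ ∞ (fun z : E × E × E ↦ z.2.1) (U ×ˢ (univ : Set (E × E))) :=
    (contDiff_fst.comp contDiff_snd).contDiffOn
  have ha : ContDiffOn ℝ ∞ (fun z : E × E × E ↦ z.2.2) (U ×ˢ (univ : Set (E × E))) :=
    (contDiff_snd.comp contDiff_snd).contDiffOn
  have hα := ha.add ((hC.clm_apply hu).clm_apply hu)
  exact contDiffOn_const.mul ((((hG.clm_apply hα).clm_apply hα).add
    (contDiffOn_const.mul ((hG.clm_apply hu).clm_apply hu))).add hV')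

/-- Here α is the covariant acceleration. Metric compatibility absorbs the derivative of g into the
terms Γ(e, α) and Γ(e, u), and symmetry of g doubles each pairing, cancelling the factor ½. -/
theorem fderiv_lagrangian (hg : IsLocalMetric g U) (σ : ℝ) {V : E → ℝ} {y u a α : E} (hy : y ∈ U)
    (hV : DifferentiableAt ℝ V y) (hα : α = a + christoffelCLM g y u u) (e f h : E) :
    fderiv ℝ (lagrangian g σ V) (y, u, a) (e, f, h) =
      g y α (h + fderiv ℝ (christoffelCLM g) y e u u + (2 : ℝ) • christoffelCLM g y u f
        + christoffelCLM g y e α) + σ * g y u (f + christoffelCLM g y e u)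
      + 1 / 2 * fderiv ℝ V y e := by
  have h1 : HasFDerivAt (fun z : E × E × E ↦ z.1) (ContinuousLinearMap.fst ℝ E (E × E)) (y, u, a) :=
    hasFDerivAt_fst
  have hu : HasFDerivAt (fun z : E × E × E ↦ z.2.1)
      ((ContinuousLinearMap.fst ℝ E E) ∘L (ContinuousLinearMap.snd ℝ E (E × E))) (y, u, a) :=
    ((ContinuousLinearMap.fst ℝ E E) ∘L (ContinuousLinearMap.snd ℝ E (E × E))).hasFDerivAt
  have ha : HasFDerivAt (fun z : E × E × E ↦ z.2.2)
      ((ContinuousLinearMap.snd ℝ E E) ∘L (ContinuousLinearMap.snd ℝ E (E × E))) (y, u, a) :=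
    ((ContinuousLinearMap.snd ℝ E E) ∘L (ContinuousLinearMap.snd ℝ E (E × E))).hasFDerivAt
  have hG : HasFDerivAt (fun z : E × E × E ↦ g z.1) _ (y, u, a) :=
    (hg.differentiableAt hy).hasFDerivAt.comp (y, u, a) h1
  have hC : HasFDerivAt (fun z : E × E × E ↦ christoffelCLM g z.1)
      (fderiv ℝ (christoffelCLM g) y ∘L ContinuousLinearMap.fst ℝ E (E × E)) (y, u, a) :=
    HasFDerivAt.comp (g := christoffelCLM g) (f := fun z : E × E × E ↦ z.1) (y, u, a)
      (hg.christoffel_differentiableAt hy).hasFDerivAt h1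
  have hV' : HasFDerivAt (fun z : E × E × E ↦ V z.1) _ (y, u, a) :=
    hV.hasFDerivAt.comp (y, u, a) h1
  have hα' := ha.fun_add ((hC.clm_apply hu).clm_apply hu)
  have := (((((hG.clm_apply hα').clm_apply hα').fun_add
    (((hG.clm_apply hu).clm_apply hu).const_mul σ)).fun_add hV').const_mul (1 / 2 : ℝ)).fderiv
  unfold lagrangian
  rw [this]
  subst hα
  simp only [add_apply, ContinuousLinearMap.comp_apply, ContinuousLinearMap.flip_apply,
    smul_apply, ContinuousLinearMap.coe_fst', ContinuousLinearMap.coe_snd',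
    map_add, hg.compatible hy, smul_eq_mul, map_smul]
  -- Arguments of g and Γ are put in a common order, so that `ring` recognises equal terms.
  simp only [hg.symm y hy _ u, hg.symm y hy _ a, hg.christoffel_symm hy f u,
    hg.symm y hy _ (christoffelCLM g y u u)]
  ring

/-- Compatibility along a curve: d/dt g(X, Y) = g(DX, Y) + g(X, DY). -/
theorem hasDerivAt_apply (hg : IsLocalMetric g U) {ξ X Y : ℝ → E} {ξ' X' Y' : E} {t : ℝ}
    (ht : ξ t ∈ U) (hξ : HasDerivAt ξ ξ' t) (hX : HasDerivAt X X' t) (hY : HasDerivAt Y Y' t) :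
    HasDerivAt (fun r ↦ g (ξ r) (X r) (Y r))
      (g (ξ t) (X' + christoffelCLM g (ξ t) ξ' (X t)) (Y t)
        + g (ξ t) (X t) (Y' + christoffelCLM g (ξ t) ξ' (Y t))) t := by
  have hG : HasDerivAt (fun r ↦ g (ξ r)) (fderiv ℝ g (ξ t) ξ') t :=
    (hg.differentiableAt ht).hasFDerivAt.comp_hasDerivAt t hξ
  refine ((hG.clm_apply hX).clm_apply hY).congr_deriv ?_
  simp only [add_apply, hg.compatible ht, map_add]
  ring

/-- The Euler-Lagrange expression of the Lagrangian `lagrangian g σ V`. -/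
theorem euler_lagrange (hg : IsLocalMetric g U) {σ : ℝ} {V : E → ℝ} (hV : ContDiffOn ℝ ∞ V U)
    {ξ : ℝ → E} {I : Set ℝ} (hI : IsOpen I) (hξ : ContDiffOn ℝ ∞ ξ I) (hmaps : MapsTo ξ I U)
    {z : ℝ → E × E × E} (hz : z = fun t ↦ (ξ t, deriv ξ t, deriv (deriv ξ) t))
    {t : ℝ} (ht : t ∈ I)
    (hEL : ∀ e, HasDerivAt (fun r ↦ deriv (fun s ↦ fderiv ℝ (lagrangian g σ V) (z s) (0, 0, e)) r
      - fderiv ℝ (lagrangian g σ V) (z r) (0, e, 0))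
      (-(fderiv ℝ (lagrangian g σ V) (z t) (e, 0, 0))) t) :
    covAlong g ξ (covAlong g ξ (covAlong g ξ (deriv ξ))) t
      + localCurvature g (ξ t) (covAlong g ξ (deriv ξ) t) (deriv ξ t) (deriv ξ t)
      - σ • covAlong g ξ (deriv ξ) t
      + (1 / 2 : ℝ) • (g (ξ t)).inverse (fderiv ℝ V (ξ t)) = 0 := by
  have hC : ContDiffOn ℝ ∞ (fun r ↦ christoffelCLM g (ξ r)) I :=
    hg.contDiffOn_christoffel.comp hξ hmaps
  have hderiv : ∀ {w : ℝ → E}, ContDiffOn ℝ ∞ w I → ContDiffOn ℝ ∞ (deriv w) I := fun hw ↦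
    hw.deriv_of_isOpen hI (by simp)
  have hcov : ∀ {w : ℝ → E}, ContDiffOn ℝ ∞ w I → ContDiffOn ℝ ∞ (covAlong g ξ w) I := fun hw ↦
    (hderiv hw).add ((hC.clm_apply (hderiv hξ)).clm_apply hw)
  have hda : ∀ {w : ℝ → E}, ContDiffOn ℝ ∞ w I → ∀ r ∈ I, HasDerivAt w (deriv w r) r :=
    fun hw r hr ↦ ((hw.contDiffAt (hI.mem_nhds hr)).differentiableAt (by simp)).hasDerivAt
  have hu := hderiv hξ
  set u := deriv ξ with hu_def
  have ha := hcov hu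
  set a := covAlong g ξ u with ha_def
  have ha2 := hcov ha
  set a2 := covAlong g ξ a with ha2_def
  have hVd : ∀ r ∈ I, DifferentiableAt ℝ V (ξ r) := fun r hr ↦
    (hV.contDiffAt (hg.isOpen.mem_nhds (hmaps hr))).differentiableAt (by simp)
  have hL : ∀ r ∈ I, ∀ e f h, fderiv ℝ (lagrangian g σ V) (z r) (e, f, h) =
      g (ξ r) (a r) (h + fderiv ℝ (christoffelCLM g) (ξ r) e (u r) (u r)
        + (2 : ℝ) • christoffelCLM g (ξ r) (u r) f
        + christoffelCLM g (ξ r) e (a r)) + σ * g (ξ r) (u r) (f + christoffelCLM g (ξ r) e (u r))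
      + 1 / 2 * fderiv ℝ V (ξ r) e := by
    intro r hr e f h
    rw [hz]
    exact hg.fderiv_lagrangian σ (hmaps hr) (hVd r hr) rfl e f h
  refine hg.ext_left (hmaps ht) fun e ↦ ?_
  -- The momentum is g(a, e). The constant coordinate vector e is not parallel, whence the term Γ(u,
  -- e).
  have hc : ∀ r ∈ I, deriv (fun s ↦ fderiv ℝ (lagrangian g σ V) (z s) (0, 0, e)) r =
      g (ξ r) (a2 r) e + g (ξ r) (a r) (christoffelCLM g (ξ r) (u r) e) := by
    intro r hr
    have hev : (fun s ↦ fderiv ℝ (lagrangian g σ V) (z s) (0, 0, e)) =ᶠ[𝓝 r]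
        fun s ↦ g (ξ s) (a s) e := by
      filter_upwards [hI.mem_nhds hr] with s hs
      rw [hL s hs]; simp
    rw [hev.deriv_eq, (hg.hasDerivAt_apply (hmaps hr) (hda hξ r hr) (hda ha r hr)
      (hasDerivAt_const r e)).deriv]
    simp [ha2_def, covAlong, hu_def]
  -- L_u contributes -2 g(a, Γ(u, e)), which reverses the sign of the term found in `hc`.
  have hcb : (fun r ↦ deriv (fun s ↦ fderiv ℝ (lagrangian g σ V) (z s) (0, 0, e)) r
      - fderiv ℝ (lagrangian g σ V) (z r) (0, e, 0)) =ᶠ[𝓝 t]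
      fun r ↦ g (ξ r) (a2 r) e - g (ξ r) (a r) (christoffelCLM g (ξ r) (u r) e)
        - σ * g (ξ r) (u r) e := by
    filter_upwards [hI.mem_nhds ht] with r hr
    rw [hc r hr, hL r hr]
    simp only [map_zero, zero_apply, zero_add, add_zero, map_smul, smul_eq_mul, mul_zero]
    ring
  have hCt : HasDerivAt (fun r ↦ christoffelCLM g (ξ r)) (fderiv ℝ (christoffelCLM g) (ξ t) (u t)) t :=
    (hg.christoffel_differentiableAt (hmaps ht)).hasFDerivAt.comp_hasDerivAt t (hda hξ t ht)
  have hCe := (hCt.clm_apply (hda hu t ht)).clm_apply (hasDerivAt_const t e)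
  have h1 := ((hg.hasDerivAt_apply (hmaps ht) (hda hξ t ht) (hda ha2 t ht)
    (hasDerivAt_const t e)).fun_sub (hg.hasDerivAt_apply (hmaps ht) (hda hξ t ht) (hda ha t ht)
    hCe)).fun_sub ((hg.hasDerivAt_apply (hmaps ht) (hda hξ t ht) (hda hu t ht)
    (hasDerivAt_const t e)).const_mul σ)
  have h2 := ((hEL e).congr_of_eventuallyEq hcb.symm).unique h1
  have hR := hg.curvature_swap (hmaps ht) e (u t) (a t)
  have hE1 : covAlong g ξ a2 t = deriv a2 t + christoffelCLM g (ξ t) (u t) (a2 t) := rfl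
  have hE2 : a2 t = deriv a t + christoffelCLM g (ξ t) (u t) (a t) := rfl
  have hE3 : a t = deriv u t + christoffelCLM g (ξ t) (u t) (u t) := rfl
  rw [← hE1, ← hE2, ← hE3, hL t ht] at h2
  simp only [map_zero, zero_apply, map_add, map_sub, map_smul, add_apply,
    sub_apply, smul_apply, smul_eq_mul, hg.apply_inverse (hmaps ht)]
  rw [← hR, localCurvature]
  -- The coordinate acceleration is eliminated in favour of the covariant one. The remaining Γ and
  -- DΓ terms assemble into R(e, u)u.
  have hE4 : deriv u t = a t - christoffelCLM g (ξ t) (u t) (u t) := by rw [hE3]; abel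
  rw [hE4] at h2
  simp only [map_zero, zero_add, add_zero, map_add, map_sub, add_apply, sub_apply, smul_zero]
    at h2 ⊢
  rw [hg.christoffel_symm (hmaps ht) e (a t), hg.christoffel_symm (hmaps ht) e (u t),
    hg.christoffel_symm (hmaps ht) (christoffelCLM g (ξ t) (u t) (u t)) e,
    hg.fderiv_christoffel_symm (hmaps ht) (u t) (u t) e] at h2
  rw [hg.christoffel_symm (hmaps ht) e (u t)]
  linarith

end IsLocalMetric

end ObstacleAvoidance
end

/-! ### Test functions and the du Bois-Reymond lemmas. -/

noncomputable section

set_option maxSynthPendingDepth 3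

namespace ObstacleAvoidance

open MeasureTheory

/-- Smooth functions with compact support in the interval `(a, b)`. -/
structure IsTestFunction (a b : ℝ) (h : ℝ → ℝ) : Prop where
  contDiff : ContDiff ℝ ∞ h
  hasCompactSupport : HasCompactSupport h
  tsupport_subset : tsupport h ⊆ Ioo a b

namespace IsTestFunction

variable {a b : ℝ} {h k : ℝ → ℝ}

theorem eq_zero (hh : IsTestFunction a b h) {t : ℝ} (ht : t ∉ Ioo a b) : h t = 0 :=
  image_eq_zero_of_notMem_tsupport fun h' ↦ ht (hh.tsupport_subset h')

theorem continuous (hh : IsTestFunction a b h) : Continuous h := hh.contDiff.continuous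

theorem hasDerivAt (hh : IsTestFunction a b h) (t : ℝ) : HasDerivAt h (deriv h t) t :=
  (hh.contDiff.differentiable (by simp)).differentiableAt.hasDerivAt

theorem derivative (hh : IsTestFunction a b h) : IsTestFunction a b (deriv h) where
  contDiff := (contDiff_infty_iff_deriv.1 hh.contDiff).2
  hasCompactSupport := hh.hasCompactSupport.deriv
  tsupport_subset := (tsupport_deriv_subset).trans hh.tsupport_subset

theorem sub_const_mul (hh : IsTestFunction a b h) (hk : IsTestFunction a b k) (c : ℝ) :
    IsTestFunction a b (fun t ↦ h t - c * k t) where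
  contDiff := hh.contDiff.sub (contDiff_const.mul hk.contDiff)
  hasCompactSupport := hh.hasCompactSupport.sub (hk.hasCompactSupport.mul_left (f := fun _ ↦ c))
  tsupport_subset := (tsupport_sub h (fun t ↦ c * k t)).trans
    (union_subset hh.tsupport_subset ((tsupport_mul_subset_right (f := fun _ ↦ c)).trans
      hk.tsupport_subset))

theorem exists_integral_eq_one (hab : a < b) :
    ∃ ρ, IsTestFunction a b ρ ∧ ∫ t in a..b, ρ t = 1 := by
  -- Centred at the midpoint with outer radius a quarter of the length, the bump has its closed
  -- support inside (a, b).
  let f : ContDiffBump ((a + b) / 2) := ⟨(b - a) / 8, (b - a) / 4, by linarith, by linarith⟩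
  have hts : tsupport (f.normed volume) ⊆ Ioo a b := by
    rw [f.tsupport_normed_eq, Real.closedBall_eq_Icc]
    intro t ht
    have : f.rOut = (b - a) / 4 := rfl
    rw [this] at ht
    exact ⟨by linarith [ht.1], by linarith [ht.2]⟩
  refine ⟨f.normed volume, ⟨f.contDiff_normed, f.hasCompactSupport_normed, hts⟩, ?_⟩
  rw [intervalIntegral.integral_of_le hab.le, setIntegral_eq_integral_of_forall_compl_eq_zero,
    f.integral_normed]
  intro t ht
  exact image_eq_zero_of_notMem_tsupport fun h' ↦ ht (Ioo_subset_Ioc_self (hts h'))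

end IsTestFunction

theorem exists_Icc_of_isCompact {a b : ℝ} (hab : a < b) {K : Set ℝ} (hK : IsCompact K)
    (h : K ⊆ Ioo a b) : ∃ c d, a < c ∧ c < d ∧ d < b ∧ K ⊆ Icc c d := by
  rcases K.eq_empty_or_nonempty with rfl | hne
  · exact ⟨(2 * a + b) / 3, (a + 2 * b) / 3, by linarith, by linarith, by linarith,
      empty_subset _⟩
  · obtain ⟨c, hc, hc'⟩ := hK.exists_isLeast hne
    obtain ⟨d, hd, hd'⟩ := hK.exists_isGreatest hne
    have h1 := h hc
    have h2 := h hd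
    have h3 : c ≤ d := hc' hd
    exact ⟨(a + c) / 2, (d + b) / 2, by linarith [h1.1], by linarith [h1.1, h2.2],
      by linarith [h2.2], fun t ht ↦ ⟨by linarith [hc' ht, h1.1], by linarith [hd' ht, h2.2]⟩⟩

theorem IsTestFunction.exists_primitive {a b : ℝ} (hab : a < b) {φ : ℝ → ℝ}
    (hφ : IsTestFunction a b φ) (h0 : ∫ t in a..b, φ t = 0) :
    ∃ h, IsTestFunction a b h ∧ deriv h = φ := by
  obtain ⟨c, d, hac, hcd, hdb, hK⟩ :=
    exists_Icc_of_isCompact hab hφ.hasCompactSupport hφ.tsupport_subset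
  have hz : ∀ t, t ∉ Icc c d → φ t = 0 := fun t ht ↦
    image_eq_zero_of_notMem_tsupport fun h' ↦ ht (hK h')
  have hi : ∀ p q, IntervalIntegrable φ volume p q := fun p q ↦ hφ.continuous.intervalIntegrable p q
  have hd : ∀ t, HasDerivAt (fun t ↦ ∫ s in a..t, φ s) (φ t) t := fun t ↦
    intervalIntegral.integral_hasDerivAt_right (hi _ _)
      hφ.continuous.aestronglyMeasurable.stronglyMeasurableAtFilter hφ.continuous.continuousAt
  have hder : deriv (fun t ↦ ∫ s in a..t, φ s) = φ := funext fun t ↦ (hd t).deriv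
  have hsupp : Function.support (fun t ↦ ∫ s in a..t, φ s) ⊆ Icc c d := by
    intro t ht
    by_contra hcon
    apply ht
    simp only [mem_Icc, not_and_or, not_le] at hcon
    rcases hcon with hlt | hlt
    · have : EqOn φ 0 (uIcc a t) := by
        intro s hs
        apply hz
        rintro ⟨h1, h2⟩
        have := hs.2
        rcases le_max_iff.1 this with h3 | h3 <;> linarith
      show ∫ s in a..t, φ s = 0
      rw [intervalIntegral.integral_congr this]; simp
    -- To the right of the support the primitive equals the total integral of φ. This is where `h0`
    -- is needed for compact support.
    · have : EqOn φ 0 (uIcc t b) := by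
        intro s hs
        apply hz
        rintro ⟨h1, h2⟩
        have := hs.1
        rcases min_le_iff.1 this with h3 | h3 <;> linarith
      have h4 := intervalIntegral.integral_add_adjacent_intervals (hi a t) (hi t b)
      rw [intervalIntegral.integral_congr this, h0] at h4
      simpa using h4
  have hts : tsupport (fun t ↦ ∫ s in a..t, φ s) ⊆ Icc c d :=
    closure_minimal hsupp isClosed_Icc
  refine ⟨_, ⟨contDiff_infty_iff_deriv.2 ⟨fun t ↦ (hd t).differentiableAt, ?_⟩,
    HasCompactSupport.of_support_subset_isCompact isCompact_Icc hsupp,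
    hts.trans (Icc_subset_Ioo hac hdb)⟩, hder⟩
  rw [hder]; exact hφ.contDiff

variable {G : Type*} [NormedAddCommGroup G] [NormedSpace ℝ G] [CompleteSpace G]

theorem intervalIntegrable_smul {a b : ℝ} {h : ℝ → ℝ} (hh : Continuous h) {F : ℝ → G}
    (hF : IntervalIntegrable F volume a b) :
    IntervalIntegrable (fun t ↦ h t • F t) volume a b :=
  hF.continuousOn_smul hh.continuousOn

theorem intervalIntegrable_const_smul {a b : ℝ} (c : ℝ) {F : ℝ → G}
    (hF : IntervalIntegrable F volume a b) :
    IntervalIntegrable (fun t ↦ c • F t) volume a b := hF.smul c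

/-- Integration by parts without boundary terms. The primitive is differentiable only off S, so the
fundamental theorem of calculus with a countable exceptional set is used. -/
theorem IsTestFunction.integral_smul_primitive {a b : ℝ} (hab : a < b) {h : ℝ → ℝ}
    (hh : IsTestFunction a b h) {f : ℝ → G} {S : Set ℝ} (hS : S.Finite)
    (hf : IntervalIntegrable f volume a b) (hc : ContinuousOn f (Ioo a b \ S)) (c : G) :
    ∫ t in a..b, deriv h t • (c + ∫ s in a..t, f s) = - ∫ t in a..b, h t • f t := by
  have hF : ContinuousOn (fun t ↦ c + ∫ s in a..t, f s) (Icc a b) := by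
    refine continuousOn_const.add ?_
    have := intervalIntegral.continuousOn_primitive_interval' hf left_mem_uIcc
    rwa [uIcc_of_le hab.le] at this
  have hO : IsOpen (Ioo a b \ S) := isOpen_Ioo.sdiff hS.isClosed
  have hd : ∀ t ∈ Ioo a b \ S, HasDerivAt (fun t ↦ c + ∫ s in a..t, f s) (f t) t := by
    intro t ht
    refine (intervalIntegral.integral_hasDerivAt_right ?_ ?_ ?_).const_add c
    · exact hf.mono_set (uIcc_subset_uIcc left_mem_uIcc
        (by rw [uIcc_of_le hab.le]; exact Ioo_subset_Icc_self ht.1))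
    · exact hc.stronglyMeasurableAtFilter hO t ht
    · exact hc.continuousAt (hO.mem_nhds ht)
  have hi1 : IntervalIntegrable (fun t ↦ h t • f t) volume a b :=
    intervalIntegrable_smul hh.continuous hf
  have hi2 : IntervalIntegrable (fun t ↦ deriv h t • (c + ∫ s in a..t, f s)) volume a b :=
    intervalIntegrable_smul hh.derivative.continuous
      (by apply ContinuousOn.intervalIntegrable; rwa [uIcc_of_le hab.le])
  have key := integral_eq_of_hasDerivAt_off_countable
    (fun t ↦ h t • (c + ∫ s in a..t, f s))
    (fun t ↦ h t • f t + deriv h t • (c + ∫ s in a..t, f s)) (a := a) (b := b) hS.countable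
    (by rw [uIcc_of_le hab.le]; exact hh.continuous.continuousOn.smul hF)
    (by
      rw [min_eq_left hab.le, max_eq_right hab.le]
      intro t ht
      exact (hh.hasDerivAt t).smul (hd t ht))
    (hi1.add hi2)
  rw [intervalIntegral.integral_add hi1 hi2] at key
  rw [hh.eq_zero (by simp), hh.eq_zero (by simp)] at key
  simp only [zero_smul, sub_zero] at key
  exact eq_neg_of_add_eq_zero_right key

theorem ae_eq_zero_of_integral_test {a b : ℝ} (hab : a < b) {f : ℝ → G}
    (hf : IntervalIntegrable f volume a b)
    (h : ∀ φ, IsTestFunction a b φ → ∫ t in a..b, φ t • f t = 0) :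
    ∀ᵐ t, t ∈ Ioo a b → f t = 0 := by
  refine isOpen_Ioo.ae_eq_zero_of_integral_contDiff_smul_eq_zero ?_ fun φ h1 h2 h3 ↦ ?_
  · have : IntegrableOn f (Ioo a b) volume :=
      ((intervalIntegrable_iff_integrableOn_Ioc_of_le hab.le).1 hf).mono_set Ioo_subset_Ioc_self
    exact this.locallyIntegrableOn
  · rw [← h φ ⟨h1, h2, h3⟩, intervalIntegral.integral_of_le hab.le,
      setIntegral_eq_integral_of_forall_compl_eq_zero]
    intro t ht
    rw [image_eq_zero_of_notMem_tsupport fun h' ↦ ht (Ioo_subset_Ioc_self (h3 h')), zero_smul]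

/-- For ρ of integral one, φ - (∫ φ)ρ has mean zero and is thus the derivative of a test function.
The hypothesis then says ∫ φ (F - c) = 0 with c = ∫ ρ F. -/
theorem exists_const_of_integral_deriv_smul {a b : ℝ} (hab : a < b) {F : ℝ → G}
    (hF : IntervalIntegrable F volume a b)
    (h : ∀ φ, IsTestFunction a b φ → ∫ t in a..b, deriv φ t • F t = 0) :
    ∃ c, ∀ᵐ t, t ∈ Ioo a b → F t = c := by
  obtain ⟨ρ, hρ, hρ1⟩ := IsTestFunction.exists_integral_eq_one hab
  refine ⟨∫ t in a..b, ρ t • F t, ?_⟩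
  set c := ∫ t in a..b, ρ t • F t with hc
  have := ae_eq_zero_of_integral_test hab (f := fun t ↦ F t - c)
    (hF.sub intervalIntegrable_const) ?_
  · filter_upwards [this] with t ht ht' using sub_eq_zero.1 (ht ht')
  intro φ hφ
  obtain ⟨k, hk, hk'⟩ := (hφ.sub_const_mul hρ (∫ t in a..b, φ t)).exists_primitive hab (by
    rw [intervalIntegral.integral_sub (hφ.continuous.intervalIntegrable _ _)
      ((hρ.continuous.intervalIntegrable _ _).const_mul _), intervalIntegral.integral_const_mul,
      hρ1]; simp)
  have h1 := h k hk
  rw [hk'] at h1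
  simp only [sub_smul, mul_smul] at h1
  rw [intervalIntegral.integral_sub (intervalIntegrable_smul hφ.continuous hF)
    (intervalIntegrable_const_smul _ (intervalIntegrable_smul hρ.continuous hF)), intervalIntegral.integral_smul, ← hc] at h1
  simp only [smul_sub]
  rw [intervalIntegral.integral_sub (intervalIntegrable_smul hφ.continuous hF)
    (intervalIntegrable_smul hφ.continuous intervalIntegrable_const),
    intervalIntegral.integral_smul_const]
  exact h1

/-- The fundamental lemma of the calculus of variations for second order problems. -/
theorem exists_eq_primitive_of_integral_test {a b : ℝ} (hab : a < b) {S : Set ℝ} (hS : S.Finite)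
    {A B C : ℝ → G} (hA : IntervalIntegrable A volume a b) (hB : IntervalIntegrable B volume a b)
    (hC : IntervalIntegrable C volume a b) (hA' : ContinuousOn A (Ioo a b \ S))
    (hB' : ContinuousOn B (Ioo a b \ S)) (hC' : ContinuousOn C (Ioo a b \ S))
    (h : ∀ φ, IsTestFunction a b φ →
      ∫ t in a..b, (φ t • A t + deriv φ t • B t + deriv (deriv φ) t • C t) = 0) :
    ∃ c c' : G, ∀ t ∈ Ioo a b \ S,
      C t = c' + ∫ s in a..t, (B s - (c + ∫ r in a..s, A r)) := by
  obtain ⟨ρ, hρ, hρ1⟩ := IsTestFunction.exists_integral_eq_one hab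
  have hpc : ∀ {f : ℝ → G}, IntervalIntegrable f volume a b →
      ContinuousOn (fun t ↦ ∫ s in a..t, f s) (Icc a b) := by
    intro f hf
    have := intervalIntegral.continuousOn_primitive_interval' hf left_mem_uIcc
    rwa [uIcc_of_le hab.le] at this
  set A1 : ℝ → G := fun t ↦ ∫ r in a..t, A r with hA1
  have hA1c : ContinuousOn A1 (Icc a b) := hpc hA
  have hA1i : IntervalIntegrable A1 volume a b := by
    apply ContinuousOn.intervalIntegrable; rwa [uIcc_of_le hab.le]
  have hBA : IntervalIntegrable (fun t ↦ B t - A1 t) volume a b := hB.sub hA1i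
  -- A first integration by parts moves A onto φ', leaving a condition in φ' and φ'' only.
  have h1 : ∀ φ, IsTestFunction a b φ →
      ∫ t in a..b, (deriv φ t • (B t - A1 t) + deriv (deriv φ) t • C t) = 0 := by
    intro φ hφ
    have e1 := hφ.integral_smul_primitive hab hS hA hA' 0
    simp only [zero_add] at e1
    rw [← h φ hφ, intervalIntegral.integral_add (intervalIntegrable_smul hφ.derivative.continuous hBA)
      (intervalIntegrable_smul hφ.derivative.derivative.continuous hC), intervalIntegral.integral_add
      ((intervalIntegrable_smul hφ.continuous hA).add
        (intervalIntegrable_smul hφ.derivative.continuous hB))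
      (intervalIntegrable_smul hφ.derivative.derivative.continuous hC), intervalIntegral.integral_add
      (intervalIntegrable_smul hφ.continuous hA) (intervalIntegrable_smul hφ.derivative.continuous hB)]
    simp only [smul_sub]
    rw [intervalIntegral.integral_sub (intervalIntegrable_smul hφ.derivative.continuous hB)
      (intervalIntegrable_smul hφ.derivative.continuous hA1i), e1]
    abel
  -- The constant of the first integration: the functional of `h1` evaluated with ρ in place of φ'.
  set c := ∫ t in a..b, (ρ t • (B t - A1 t) + deriv ρ t • C t) with hc
  set f : ℝ → G := fun t ↦ B t - (c + A1 t) with hf_def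
  have hf : IntervalIntegrable f volume a b := hB.sub (intervalIntegrable_const.add hA1i)
  have hfc : ContinuousOn f (Ioo a b \ S) :=
    hB'.sub (continuousOn_const.add (hA1c.mono (sdiff_subset.trans Ioo_subset_Icc_self)))
  have hFi : IntervalIntegrable (fun t ↦ ∫ s in a..t, f s) volume a b := by
    apply ContinuousOn.intervalIntegrable; rw [uIcc_of_le hab.le]; exact hpc hf
  -- Testing `h1` with a primitive of φ - (∫ φ)ρ, then integrating f by parts, puts C minus the
  -- primitive of f under the first-order lemma.
  have h2 : ∀ φ, IsTestFunction a b φ →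
      ∫ t in a..b, deriv φ t • (C t - ∫ s in a..t, f s) = 0 := by
    intro φ hφ
    obtain ⟨k, hk, hk'⟩ := (hφ.sub_const_mul hρ (∫ t in a..b, φ t)).exists_primitive hab (by
      rw [intervalIntegral.integral_sub (hφ.continuous.intervalIntegrable _ _)
        ((hρ.continuous.intervalIntegrable _ _).const_mul _), intervalIntegral.integral_const_mul,
        hρ1]; simp)
    have e1 := h1 k hk
    have hk'' : deriv (deriv k) = fun t ↦ deriv φ t - (∫ t in a..b, φ t) * deriv ρ t := by
      rw [hk']
      exact funext fun t ↦ ((hφ.hasDerivAt t).sub ((hρ.hasDerivAt t).const_mul _)).deriv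
    rw [hk'', hk'] at e1
    have e2 : ∀ t, (φ t - (∫ t in a..b, φ t) * ρ t) • (B t - A1 t)
        + (deriv φ t - (∫ t in a..b, φ t) * deriv ρ t) • C t
        = (φ t • (B t - A1 t) + deriv φ t • C t)
          - (∫ t in a..b, φ t) • (ρ t • (B t - A1 t) + deriv ρ t • C t) := fun t ↦ by module
    simp only [e2] at e1
    have i1 := intervalIntegrable_smul hφ.continuous hBA
    have i2 := intervalIntegrable_smul hφ.derivative.continuous hC
    rw [intervalIntegral.integral_sub (i1.add i2)
      (intervalIntegrable_const_smul _ ((intervalIntegrable_smul hρ.continuous hBA).add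
        (intervalIntegrable_smul hρ.derivative.continuous hC))), intervalIntegral.integral_smul,
      ← hc, intervalIntegral.integral_add i1 i2] at e1
    have e3 := hφ.integral_smul_primitive hab hS hf hfc 0
    simp only [zero_add] at e3
    simp only [smul_sub]
    rw [intervalIntegral.integral_sub i2 (intervalIntegrable_smul hφ.derivative.continuous hFi), e3]
    have e4 : ∫ t in a..b, φ t • f t =
        (∫ t in a..b, φ t • (B t - A1 t)) - (∫ t in a..b, φ t) • c := by
      rw [← intervalIntegral.integral_smul_const, ← intervalIntegral.integral_sub i1
        (intervalIntegrable_smul hφ.continuous intervalIntegrable_const)]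
      congr 1; funext t; simp only [hf_def]; module
    rw [e4, ← e1]; abel
  obtain ⟨c', hc'⟩ := exists_const_of_integral_deriv_smul hab (hC.sub hFi) h2
  refine ⟨c, c', ?_⟩
  have hO : IsOpen (Ioo a b \ S) := isOpen_Ioo.sdiff hS.isClosed
  -- Both sides are continuous on the open set Ioo a b \ S, so almost everywhere equality holds
  -- everywhere on it.
  refine Measure.eqOn_open_of_ae_eq (μ := volume) ?_ hO hC' ?_
  · rw [Filter.EventuallyEq, ae_restrict_iff' hO.measurableSet]
    filter_upwards [hc'] with t ht ht'
    exact (sub_eq_iff_eq_add.1 (ht ht'.1))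
  · exact continuousOn_const.add ((hpc hf).mono (sdiff_subset.trans Ioo_subset_Icc_self))

end ObstacleAvoidance
end

/-! ### Regularity of weak extremals of second-order Lagrangians. -/

noncomputable section

set_option maxSynthPendingDepth 3

namespace ObstacleAvoidance

open MeasureTheory

theorem intervalIntegrable_of_continuousOn_of_bound {G : Type*} [NormedAddCommGroup G]
    {a b : ℝ} (hab : a < b) {S : Set ℝ} (hS : S.Finite) {f : ℝ → G} {M : ℝ}
    (hf : ContinuousOn f (Ioo a b \ S)) (hM : ∀ t ∈ Ioo a b \ S, ‖f t‖ ≤ M) :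
    IntervalIntegrable f volume a b := by
  have hO : IsOpen (Ioo a b \ S) := isOpen_Ioo.sdiff hS.isClosed
  rw [intervalIntegrable_iff_integrableOn_Ioo_of_le hab.le]
  have h1 : IntegrableOn f (Ioo a b \ S) volume := by
    refine IntegrableOn.of_bound ?_ (hf.aestronglyMeasurable hO.measurableSet) M ?_
    · exact (measure_mono sdiff_subset).trans_lt measure_Ioo_lt_top
    · exact (ae_restrict_iff' hO.measurableSet).2 (Filter.Eventually.of_forall hM)
  refine h1.congr_set_ae ?_
  exact (sdiff_null_ae_eq_self (hS.measure_zero volume)).symm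

theorem contDiffOn_succ_of_hasDerivAt {G : Type*} [NormedAddCommGroup G] [NormedSpace ℝ G]
    {I : Set ℝ} (hI : IsOpen I) {F f : ℝ → G} {n : ℕ} (hF : ∀ t ∈ I, HasDerivAt F (f t) t)
    (hf : ContDiffOn ℝ n f I) : ContDiffOn ℝ (n + 1 : ℕ) F I := by
  push_cast
  rw [contDiffOn_succ_iff_deriv_of_isOpen hI]
  refine ⟨fun t ht ↦ (hF t ht).differentiableAt.differentiableWithinAt, by simp, ?_⟩
  exact hf.congr fun t ht ↦ (hF t ht).deriv

variable {E : Type*} [NormedAddCommGroup E] [NormedSpace ℝ E] [FiniteDimensional ℝ E]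

/-- Regularity of weak extremals of a second order Lagrangian satisfying the Legendre condition in
the form that the highest derivative can be recovered from its conjugate momentum. -/
theorem weak_extremal_regularity {U : Set E} (hU : IsOpen U) {L : E × E × E → ℝ}
    (hL : ContDiffOn ℝ ∞ L (U ×ˢ univ)) {K : E × E × (E →L[ℝ] ℝ) → E}
    (hK : ContDiffOn ℝ ∞ K (U ×ˢ univ))
    (hKL : ∀ y ∈ U, ∀ u a, K (y, u, fderiv ℝ L (y, u, a) ∘L
      (ContinuousLinearMap.inr ℝ E (E × E) ∘L ContinuousLinearMap.inr ℝ E E)) = a)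
    {a b : ℝ} (hab : a < b) {S : Set ℝ} (hS : S.Finite) {ξ u α : ℝ → E}
    (hξ : ∀ t ∈ Ioo a b, HasDerivAt ξ (u t) t) (hu : ContinuousOn u (Ioo a b))
    (hu' : ∀ t ∈ Ioo a b \ S, HasDerivAt u (α t) t) (hα : ContinuousOn α (Ioo a b \ S))
    (hmaps : MapsTo ξ (Ioo a b) U)
    {Q : Set (E × E × E)} (hQ : IsCompact Q) (hQU : Q ⊆ U ×ˢ univ)
    (hzQ : ∀ t ∈ Ioo a b \ S, (ξ t, u t, α t) ∈ Q)
    (hweak : ∀ φ, IsTestFunction a b φ → ∀ e : E,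
      ∫ t in a..b, fderiv ℝ L (ξ t, u t, α t)
        (φ t • e, deriv φ t • e, deriv (deriv φ) t • e) = 0) :
    ContDiffOn ℝ ∞ ξ (Ioo a b) ∧ ∀ t ∈ Ioo a b, ∀ e, HasDerivAt
      (fun r ↦ deriv (fun s ↦ fderiv ℝ L (ξ s, deriv ξ s, deriv (deriv ξ) s) (0, 0, e)) r
        - fderiv ℝ L (ξ r, deriv ξ r, deriv (deriv ξ) r) (0, e, 0))
      (-(fderiv ℝ L (ξ t, deriv ξ t, deriv (deriv ξ) t) (e, 0, 0))) t := by
  set I := Ioo a b with hI_def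
  have hI : IsOpen I := isOpen_Ioo
  have hIS : IsOpen (I \ S) := hI.sdiff hS.isClosed
  have hW : IsOpen (U ×ˢ (univ : Set (E × E))) := hU.prod isOpen_univ
  have hDL : ContDiffOn ℝ ∞ (fderiv ℝ L) (U ×ˢ univ) := hL.fderiv_of_isOpen hW (by simp)
  have hξc : ContinuousOn ξ I := fun t ht ↦ (hξ t ht).continuousAt.continuousWithinAt
  set z : ℝ → E × E × E := fun t ↦ (ξ t, u t, α t) with hz
  have hzc : ContinuousOn z (I \ S) :=
    (hξc.mono sdiff_subset).prodMk ((hu.mono sdiff_subset).prodMk hα)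
  set iA : E →L[ℝ] E × E × E := ContinuousLinearMap.inl ℝ E (E × E) with hiA
  set iB : E →L[ℝ] E × E × E :=
    ContinuousLinearMap.inr ℝ E (E × E) ∘L ContinuousLinearMap.inl ℝ E E with hiB
  set iC : E →L[ℝ] E × E × E :=
    ContinuousLinearMap.inr ℝ E (E × E) ∘L ContinuousLinearMap.inr ℝ E E with hiC
  -- The jets stay in the compact set Q, so the differential of L is bounded along them and its
  -- components are integrable despite possible jumps.
  obtain ⟨M, hM⟩ := hQ.exists_bound_of_continuousOn (hDL.continuousOn.mono hQU)
  have hDz : ContinuousOn (fun t ↦ fderiv ℝ L (z t)) (I \ S) :=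
    hDL.continuousOn.comp hzc fun t ht ↦ hQU (hzQ t ht)
  have hcont : ∀ i : E →L[ℝ] E × E × E,
      ContinuousOn (fun t ↦ fderiv ℝ L (z t) ∘L i) (I \ S) := fun i ↦
    hDz.clm_comp continuousOn_const
  have hint : ∀ i : E →L[ℝ] E × E × E,
      IntervalIntegrable (fun t ↦ fderiv ℝ L (z t) ∘L i) volume a b := fun i ↦
    intervalIntegrable_of_continuousOn_of_bound hab hS (hcont i) (M := M * ‖i‖) fun t ht ↦
      (ContinuousLinearMap.opNorm_comp_le _ _).trans
        (mul_le_mul_of_nonneg_right (hM _ (hzQ t ht)) (norm_nonneg _))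
  obtain ⟨c, c', hc⟩ := exists_eq_primitive_of_integral_test hab hS (hint iA) (hint iB) (hint iC)
    (hcont iA) (hcont iB) (hcont iC) (by
      intro φ hφ
      ext e
      rw [ContinuousLinearMap.intervalIntegral_apply
        (((intervalIntegrable_smul hφ.continuous (hint iA)).add
          (intervalIntegrable_smul hφ.derivative.continuous (hint iB))).add
          (intervalIntegrable_smul hφ.derivative.derivative.continuous (hint iC)))]
      rw [zero_apply, ← hweak φ hφ e]
      congr 1
      funext t
      simp only [add_apply, smul_apply, ContinuousLinearMap.comp_apply, ← map_smul, ← map_add]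
      congr 1
      simp [hiA, hiB, hiC])
  -- the momentum, the acceleration and the force as continuous functions
  set C2 : ℝ → E →L[ℝ] ℝ := fun t ↦ c' + ∫ s in a..t,
    (fderiv ℝ L (z s) ∘L iB - (c + ∫ r in a..s, fderiv ℝ L (z r) ∘L iA)) with hC2
  have hpc : ∀ {f : ℝ → E →L[ℝ] ℝ}, IntervalIntegrable f volume a b →
      ContinuousOn (fun t ↦ ∫ s in a..t, f s) (Icc a b) := by
    intro f hf
    have := intervalIntegral.continuousOn_primitive_interval' hf left_mem_uIcc
    rwa [uIcc_of_le hab.le] at this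
  have hA1i : IntervalIntegrable (fun s ↦ c + ∫ r in a..s, fderiv ℝ L (z r) ∘L iA) volume a b := by
    apply ContinuousOn.intervalIntegrable
    rw [uIcc_of_le hab.le]
    exact continuousOn_const.add (hpc (hint iA))
  have hfi := (hint iB).sub hA1i
  have hC2c : ContinuousOn C2 I := (continuousOn_const.add (hpc hfi)).mono Ioo_subset_Icc_self
  -- Inverting the Legendre transform at the continuous momentum C2 gives a continuous acceleration
  -- on all of I, equal to α off S.
  set α2 : ℝ → E := fun t ↦ K (ξ t, u t, C2 t) with hα2
  have hα2c : ContinuousOn α2 I :=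
    hK.continuousOn.comp (hξc.prodMk (hu.prodMk hC2c)) fun t ht ↦ ⟨hmaps ht, mem_univ _⟩
  have hαα2 : ∀ t ∈ I \ S, α t = α2 t := by
    intro t ht
    have h := hKL _ (hmaps ht.1) (u t) (α t)
    rw [hc t ht] at h
    exact h.symm
  have hae : ∀ᵐ t, t ∉ S := measure_eq_zero_iff_ae_notMem.1 (hS.measure_zero volume)
  -- a primitive of a function with a continuous representative
  have hprim : ∀ {H : Type _} [NormedAddCommGroup H] [NormedSpace ℝ H] [CompleteSpace H]
      {f f2 : ℝ → H}, IntervalIntegrable f volume a b → ContinuousOn f2 I →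
      (∀ t ∈ I \ S, f t = f2 t) → ∀ t ∈ I, HasDerivAt (fun t ↦ ∫ s in a..t, f s) (f2 t) t := by
    intro H _ _ _ f f2 hf hf2 heq t ht
    have hev : (fun t ↦ ∫ s in a..t, f s) =ᶠ[𝓝 t] fun t ↦ ∫ s in a..t, f2 s := by
      filter_upwards [hI.mem_nhds ht] with r hr
      refine intervalIntegral.integral_congr_ae ?_
      filter_upwards [hae] with s hs hs'
      rw [uIoc_of_le hr.1.le] at hs'
      exact heq s ⟨⟨hs'.1, hs'.2.trans_lt hr.2⟩, hs⟩
    refine HasDerivAt.congr_of_eventuallyEq ?_ hev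
    refine intervalIntegral.integral_hasDerivAt_right ?_
      (hf2.stronglyMeasurableAtFilter hI t ht) (hf2.continuousAt (hI.mem_nhds ht))
    have h1 : IntervalIntegrable f volume a t := hf.mono_set (uIcc_subset_uIcc left_mem_uIcc
        (by rw [uIcc_of_le hab.le]; exact Ioo_subset_Icc_self ht))
    refine h1.congr_ae ?_
    rw [Filter.EventuallyEq, ae_restrict_iff' measurableSet_uIoc]
    filter_upwards [hae] with s hs hs'
    rw [uIoc_of_le ht.1.le] at hs'
    exact heq s ⟨⟨hs'.1, hs'.2.trans_lt ht.2⟩, hs⟩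
  -- Since u is continuous and has derivative α2 off a finite set, it is an integral of the
  -- continuous α2, hence differentiable at the points of S as well.
  have hu2 : ∀ t ∈ I, HasDerivAt u (α2 t) t := by
    intro t ht
    obtain ⟨p, hp, hpt⟩ := exists_between ht.1
    have hpI : p ∈ I := ⟨hp, hpt.trans ht.2⟩
    have hev : u =ᶠ[𝓝 t] fun r ↦ u p + ∫ s in p..r, α2 s := by
      filter_upwards [hI.mem_nhds ht] with r hr
      have hsub : uIcc p r ⊆ I := by
        rw [uIcc_eq_union]
        exact union_subset (fun s hs ↦ ⟨hp.trans_le hs.1, hs.2.trans_lt hr.2⟩)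
          (fun s hs ↦ ⟨hr.1.trans_le hs.1, hs.2.trans_lt hpI.2⟩)
      rw [integral_eq_of_hasDerivAt_off_countable u α2 hS.countable (hu.mono hsub) ?_
        (hα2c.mono hsub).intervalIntegrable]
      · abel
      · intro s hs
        have hsI : s ∈ I := hsub (Ioo_subset_Icc_self hs.1)
        rw [← hαα2 s ⟨hsI, hs.2⟩]
        exact hu' s ⟨hsI, hs.2⟩
    refine HasDerivAt.congr_of_eventuallyEq ?_ hev
    refine (intervalIntegral.integral_hasDerivAt_right ?_
      (hα2c.stronglyMeasurableAtFilter hI t ht) (hα2c.continuousAt (hI.mem_nhds ht))).const_add _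
    refine (hα2c.mono ?_).intervalIntegrable
    rw [uIcc_of_le hpt.le]
    exact fun s hs ↦ ⟨hp.trans_le hs.1, hs.2.trans_lt ht.2⟩
  set z2 : ℝ → E × E × E := fun t ↦ (ξ t, u t, α2 t) with hz2
  have hz2c : ContinuousOn z2 I := hξc.prodMk (hu.prodMk hα2c)
  have hz2U : MapsTo z2 I (U ×ˢ univ) := fun t ht ↦ ⟨hmaps ht, mem_univ _⟩
  have hzz2 : ∀ i : E →L[ℝ] E × E × E, ∀ t ∈ I \ S,
      fderiv ℝ L (z t) ∘L i = fderiv ℝ L (z2 t) ∘L i := by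
    intro i t ht
    simp only [hz, hz2, hαα2 t ht]
  have hsm : ∀ {n : WithTop ℕ∞} (i : E →L[ℝ] E × E × E), n ≤ ∞ → ContDiffOn ℝ n z2 I →
      ContDiffOn ℝ n (fun t ↦ fderiv ℝ L (z2 t) ∘L i) I := fun i hn h ↦
    ((hDL.of_le hn).comp h hz2U).clm_comp contDiffOn_const
  have hcz2 : ∀ i : E →L[ℝ] E × E × E, ContinuousOn (fun t ↦ fderiv ℝ L (z2 t) ∘L i) I := fun i ↦
    (hDL.continuousOn.comp hz2c hz2U).clm_comp continuousOn_const
  set A1 : ℝ → E →L[ℝ] ℝ := fun s ↦ c + ∫ r in a..s, fderiv ℝ L (z r) ∘L iA with hA1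
  have hA1d : ∀ t ∈ I, HasDerivAt A1 (fderiv ℝ L (z2 t) ∘L iA) t := fun t ht ↦
    (hprim (hint iA) (hcz2 iA) (hzz2 iA) t ht).const_add c
  have hA1c : ContinuousOn A1 I := fun t ht ↦ (hA1d t ht).continuousAt.continuousWithinAt
  have hC2d : ∀ t ∈ I, HasDerivAt C2 (fderiv ℝ L (z2 t) ∘L iB - A1 t) t := fun t ht ↦
    (hprim hfi ((hcz2 iB).sub hA1c) (fun s hs ↦ by
      show _ - _ = _
      rw [hzz2 iB s hs]; rfl) t ht).const_add c'
  -- If α2 is Cⁿ, then u, ξ and A1 are Cⁿ⁺¹, and so is C2, whose derivative is built from A1 and the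
  -- Cⁿ jets. Then α2 = K(ξ, u, C2) is Cⁿ⁺¹.
  have hboot : ∀ n : ℕ, ContDiffOn ℝ n α2 I := by
    intro n
    induction n with
    | zero => exact contDiffOn_zero.2 hα2c
    | succ n ih =>
      have hle : ∀ m : ℕ, (m : WithTop ℕ∞) ≤ ∞ := fun m ↦
        WithTop.coe_le_coe.2 (le_top : (m : ℕ∞) ≤ ⊤)
      have hmono : ((n : ℕ) : WithTop ℕ∞) ≤ ((n + 1 : ℕ) : WithTop ℕ∞) := by
        exact_mod_cast n.le_succ
      have h1 := contDiffOn_succ_of_hasDerivAt hI hu2 ih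
      have h2 := contDiffOn_succ_of_hasDerivAt hI hξ (h1.of_le hmono)
      have h3 : ContDiffOn ℝ n z2 I := (h2.of_le hmono).prodMk ((h1.of_le hmono).prodMk ih)
      have h4 := contDiffOn_succ_of_hasDerivAt hI hA1d (hsm iA (hle n) h3)
      have h5 := contDiffOn_succ_of_hasDerivAt hI hC2d
        ((hsm iB (hle n) h3).sub (h4.of_le hmono))
      exact (hK.of_le (hle _)).comp (h2.prodMk (h1.prodMk h5)) fun t ht ↦ ⟨hmaps ht, mem_univ _⟩
  have hdξ : ∀ t ∈ I, deriv ξ t = u t := fun t ht ↦ (hξ t ht).deriv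
  have hdu : ∀ t ∈ I, deriv (deriv ξ) t = α2 t := by
    intro t ht
    have : deriv ξ =ᶠ[𝓝 t] u := by filter_upwards [hI.mem_nhds ht] with r hr using hdξ r hr
    rw [this.deriv_eq, (hu2 t ht).deriv]
  refine ⟨?_, ?_⟩
  · rw [contDiffOn_infty]
    intro n
    have hmono : ∀ n : ℕ, ((n : ℕ) : WithTop ℕ∞) ≤ ((n + 1 : ℕ) : WithTop ℕ∞) := by
      intro n; exact_mod_cast n.le_succ
    exact (contDiffOn_succ_of_hasDerivAt hI hξ
      ((contDiffOn_succ_of_hasDerivAt hI hu2 (hboot n)).of_le (hmono n))).of_le (hmono n)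
  · intro t ht e
    have hzeq : ∀ s ∈ I, (ξ s, deriv ξ s, deriv (deriv ξ) s) = z2 s := fun s hs ↦ by
      rw [hdξ s hs, hdu s hs]
    -- The identification of C2 with the momentum extends across S, as both sides are now continuous
    -- on I.
    have hCz : ∀ s ∈ I, C2 s = fderiv ℝ L (z2 s) ∘L iC := by
      have h1 : EqOn C2 (fun s ↦ fderiv ℝ L (z2 s) ∘L iC) (I \ S) := fun s hs ↦
        (hc s hs).symm.trans (hzz2 iC s hs)
      refine Measure.eqOn_open_of_ae_eq (μ := volume) ?_ hI hC2c (hcz2 iC)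
      rw [Filter.EventuallyEq, ae_restrict_iff' hI.measurableSet]
      filter_upwards [hae] with s hs hs' using h1 ⟨hs', hs⟩
    have happly : ∀ s ∈ I, fderiv ℝ L (ξ s, deriv ξ s, deriv (deriv ξ) s) (0, 0, e) = C2 s e := by
      intro s hs
      rw [hzeq s hs, hCz s hs]; simp [hiC]
    have hev : (fun r ↦ deriv (fun s ↦ fderiv ℝ L (ξ s, deriv ξ s, deriv (deriv ξ) s) (0, 0, e)) r
        - fderiv ℝ L (ξ r, deriv ξ r, deriv (deriv ξ) r) (0, e, 0)) =ᶠ[𝓝 t]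
        fun r ↦ - A1 r e := by
      filter_upwards [hI.mem_nhds ht] with r hr
      have : (fun s ↦ fderiv ℝ L (ξ s, deriv ξ s, deriv (deriv ξ) s) (0, 0, e)) =ᶠ[𝓝 r]
          fun s ↦ C2 s e := by
        filter_upwards [hI.mem_nhds hr] with s hs using happly s hs
      rw [this.deriv_eq, ((hC2d r hr).clm_apply (hasDerivAt_const r e)).deriv, hzeq r hr]
      simp [hiB]
    refine HasDerivAt.congr_of_eventuallyEq ?_ hev
    rw [hzeq t ht]
    refine (((hA1d t ht).clm_apply (hasDerivAt_const t e)).neg).congr_deriv ?_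
    simp only [add_zero, map_zero, ContinuousLinearMap.comp_apply, hiA,
      ContinuousLinearMap.inl_apply]
    rfl

end ObstacleAvoidance
end

/-! ### The metric, the curvature, the gradient and D/dt of the manifold, read in charts. -/

noncomputable section

set_option maxSynthPendingDepth 3

namespace ObstacleAvoidance

variable {E : Type*} [NormedAddCommGroup E] [NormedSpace ℝ E]
  {M : Type*} [TopologicalSpace M] [ChartedSpace E M] [IsManifold 𝓘(ℝ, E) ∞ M]

theorem isManifold_one : IsManifold 𝓘(ℝ, E) 1 M := IsManifold.of_le (n := ∞) (by simp)

attribute [local instance] isManifold_one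

theorem isOpen_target (p : M) : IsOpen (extChartAt 𝓘(ℝ, E) p).target := isOpen_extChartAt_target p

theorem isOpen_source (p : M) : IsOpen (extChartAt 𝓘(ℝ, E) p).source := isOpen_extChartAt_source p

theorem contMDiffAt_symm {p : M} {y : E} (hy : y ∈ (extChartAt 𝓘(ℝ, E) p).target) :
    ContMDiffAt 𝓘(ℝ, E) 𝓘(ℝ, E) ∞ (extChartAt 𝓘(ℝ, E) p).symm y :=
  (contMDiffOn_extChartAt_symm p).contMDiffAt ((isOpen_target p).mem_nhds hy)

theorem contMDiffAt_chart {p q : M} (hq : q ∈ (extChartAt 𝓘(ℝ, E) p).source) :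
    ContMDiffAt 𝓘(ℝ, E) 𝓘(ℝ, E) ∞ (extChartAt 𝓘(ℝ, E) p) q :=
  contMDiffAt_extChartAt' (by rwa [extChartAt_source] at hq)

theorem mdifferentiableAt_symm {p : M} {y : E} (hy : y ∈ (extChartAt 𝓘(ℝ, E) p).target) :
    MDifferentiableAt 𝓘(ℝ, E) 𝓘(ℝ, E) (extChartAt 𝓘(ℝ, E) p).symm y :=
  (contMDiffAt_symm hy).mdifferentiableAt (by simp)

theorem mdifferentiableAt_chart {p q : M} (hq : q ∈ (extChartAt 𝓘(ℝ, E) p).source) :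
    MDifferentiableAt 𝓘(ℝ, E) 𝓘(ℝ, E) (extChartAt 𝓘(ℝ, E) p) q :=
  (contMDiffAt_chart hq).mdifferentiableAt (by simp)

theorem chartCoord_chartInv {p : M} {y : E} (hy : y ∈ (extChartAt 𝓘(ℝ, E) p).target) (v : E) :
    chartCoord p ((extChartAt 𝓘(ℝ, E) p).symm y) (chartInv p y v) = v := by
  have h := mfderiv_extChartAt_comp_mfderivWithin_extChartAt_symm (I := 𝓘(ℝ, E)) hy
  rw [ModelWithCorners.range_eq_univ, mfderivWithin_univ] at h
  exact DFunLike.congr_fun h v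

theorem chartInv_chartCoord {p : M} {y : E} (hy : y ∈ (extChartAt 𝓘(ℝ, E) p).target)
    (v : TangentSpace 𝓘(ℝ, E) ((extChartAt 𝓘(ℝ, E) p).symm y)) :
    chartInv p y (chartCoord p ((extChartAt 𝓘(ℝ, E) p).symm y) v) = v := by
  have h := mfderivWithin_extChartAt_symm_comp_mfderiv_extChartAt (I := 𝓘(ℝ, E)) hy
  rw [ModelWithCorners.range_eq_univ, mfderivWithin_univ] at h
  exact DFunLike.congr_fun h v

theorem isInvertible_chartCoord {p q : M} (hq : q ∈ (extChartAt 𝓘(ℝ, E) p).source) :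
    (chartCoord (E := E) p q).IsInvertible := isInvertible_mfderiv_extChartAt hq

theorem chartCoord_inverse (p : M) (v : E) :
    chartCoord p p ((chartCoord p p).inverse v) = v :=
  (isInvertible_chartCoord (mem_extChartAt_source p)).self_apply_inverse v

section Metric

variable [RiemannianBundle (fun p : M ↦ TangentSpace 𝓘(ℝ, E) p)]

theorem metricAt_apply (q : M) (v w : TangentSpace 𝓘(ℝ, E) q) : metricAt q v w = inner ℝ v w := rfl

theorem chartMetric_apply (p : M) (y u v : E) :
    chartMetric p y u v = inner ℝ (chartInv p y u) (chartInv p y v) := rfl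

theorem chartMetric_chartCoord {p q : M} (hq : q ∈ (extChartAt 𝓘(ℝ, E) p).source)
    (v w : TangentSpace 𝓘(ℝ, E) q) :
    chartMetric p (extChartAt 𝓘(ℝ, E) p q) (chartCoord p q v) (chartCoord p q w)
      = inner ℝ v w := by
  obtain ⟨y, hy, rfl⟩ : ∃ y ∈ (extChartAt 𝓘(ℝ, E) p).target, (extChartAt 𝓘(ℝ, E) p).symm y = q :=
    ⟨_, (extChartAt 𝓘(ℝ, E) p).map_source hq, (extChartAt 𝓘(ℝ, E) p).left_inv hq⟩
  rw [(extChartAt 𝓘(ℝ, E) p).right_inv hy, chartMetric_apply, chartInv_chartCoord hy,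
    chartInv_chartCoord hy]

theorem norm_sq_eq {p q : M} (hq : q ∈ (extChartAt 𝓘(ℝ, E) p).source)
    (v : TangentSpace 𝓘(ℝ, E) q) :
    ‖v‖ ^ 2 = chartMetric p (extChartAt 𝓘(ℝ, E) p q) (chartCoord p q v) (chartCoord p q v) := by
  rw [chartMetric_chartCoord hq, real_inner_self_eq_norm_sq]

variable [FiniteDimensional ℝ E]
  [IsContMDiffRiemannianBundle 𝓘(ℝ, E) ∞ E (fun p : M ↦ TangentSpace 𝓘(ℝ, E) p)]

/-- The coordinate field is the tangent map of the inverse chart applied to a constant field, hence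
smooth. Smoothness of the matrix g_ij follows from that of the bundle metric. -/
theorem contMDiffAt_chartInv {p : M} {y : E} (hy : y ∈ (extChartAt 𝓘(ℝ, E) p).target) (u : E) :
    ContMDiffAt 𝓘(ℝ, E) (𝓘(ℝ, E).prod 𝓘(ℝ, E)) ∞
      (fun z ↦ (⟨(extChartAt 𝓘(ℝ, E) p).symm z, chartInv p z u⟩ : TangentBundle 𝓘(ℝ, E) M)) y := by
  have h1 : ContMDiffOn (𝓘(ℝ, E).prod 𝓘(ℝ, E)) (𝓘(ℝ, E).prod 𝓘(ℝ, E)) ∞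
      (tangentMapWithin 𝓘(ℝ, E) 𝓘(ℝ, E) (extChartAt 𝓘(ℝ, E) p).symm
        (extChartAt 𝓘(ℝ, E) p).target) _ :=
    (contMDiffOn_extChartAt_symm (n := ∞) p).contMDiffOn_tangentMapWithin (by simp)
      (isOpen_target p).uniqueMDiffOn
  have h2 : ContMDiff 𝓘(ℝ, E) (𝓘(ℝ, E).prod 𝓘(ℝ, E)) ∞
      (fun z : E ↦ (⟨z, u⟩ : TangentBundle 𝓘(ℝ, E) E)) := by
    exact contMDiff_vectorSpace_iff_contDiff (V := fun _ ↦ u).2 contDiff_const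
  have h3 := h1.comp (h2.contMDiffOn (s := (extChartAt 𝓘(ℝ, E) p).target)) (fun z hz ↦ hz)
  refine (h3.contMDiffAt ((isOpen_target p).mem_nhds hy)).congr_of_eventuallyEq ?_
  filter_upwards [(isOpen_target p).mem_nhds hy] with z hz
  simp only [Function.comp_def, tangentMapWithin, chartInv]
  rw [mfderivWithin_of_isOpen (isOpen_target p) hz]
  rfl

theorem isLocalMetric_chartMetric (p : M) :
    IsLocalMetric (chartMetric p) (extChartAt 𝓘(ℝ, E) p).target where
  isOpen := isOpen_target p
  contDiffOn := by
    rw [contDiffOn_clm_apply]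
    intro u
    rw [contDiffOn_clm_apply]
    intro v y hy
    have := ContMDiffAt.inner_bundle (IB := 𝓘(ℝ, E)) (F := E)
      (E := fun q : M ↦ TangentSpace 𝓘(ℝ, E) q) (contMDiffAt_chartInv hy u)
      (contMDiffAt_chartInv hy v)
    exact (contMDiffAt_iff_contDiffAt.1 this).contDiffWithinAt
  symm y hy u v := by
    rw [chartMetric_apply, chartMetric_apply]; exact real_inner_comm _ _
  pos y hy u hu := by
    rw [chartMetric_apply, real_inner_self_eq_norm_sq]
    have : chartInv p y u ≠ 0 := fun h ↦ hu (by rw [← chartCoord_chartInv hy u, h, map_zero])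
    positivity

theorem christoffel_eq (p : M) (y u v : E) :
    christoffel p y u v = christoffelCLM (chartMetric p) y u v := rfl

/-- Constant fields commute and ∇_b c = Γ(b, c), so only derivatives and products of Γ survive. -/
theorem chartCurvature_const {p : M} {y : E} (hy : y ∈ (extChartAt 𝓘(ℝ, E) p).target) (a b c : E) :
    chartCurvature p (fun _ ↦ a) (fun _ ↦ b) (fun _ ↦ c) y
      = localCurvature (chartMetric p) y a b c := by
  have hd := (isLocalMetric_chartMetric p).christoffel_differentiableAt hy
  have h : ∀ a b c : E, fderiv ℝ (chartNabla p (fun _ ↦ b) (fun _ ↦ c)) y a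
      = fderiv ℝ (christoffelCLM (chartMetric p)) y a b c := by
    intro a b c
    have : chartNabla p (fun _ ↦ b) (fun _ ↦ c) =
        fun y ↦ christoffelCLM (chartMetric p) y b c := by
      funext y
      simp [chartNabla, christoffel_eq]
    rw [this, ((hd.hasFDerivAt.clm_apply (hasFDerivAt_const b _)).clm_apply
      (hasFDerivAt_const c _)).fderiv]
    simp
  have h0 : ∀ a b : E, VectorField.lieBracket ℝ (fun _ : E ↦ a) (fun _ ↦ b) = fun _ ↦ 0 := by
    intro a b; funext y; simp [VectorField.lieBracket]
  have h1 : ∀ X Y Z : E → E, chartNabla p X (chartNabla p Y Z) y =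
      fderiv ℝ (chartNabla p Y Z) y (X y)
        + christoffelCLM (chartMetric p) y (X y) (chartNabla p Y Z y) := fun _ _ _ ↦ rfl
  rw [chartCurvature, h0, h1, h1, h, h, localCurvature]
  simp only [chartNabla, christoffel_eq, fderiv_fun_const, Pi.zero_apply, zero_apply, zero_add,
    map_zero, sub_zero]
  abel

theorem curvature_eq (p : M) (u v w : TangentSpace 𝓘(ℝ, E) p) :
    chartCoord p p (curvature p u v w) = localCurvature (chartMetric p) (extChartAt 𝓘(ℝ, E) p p)
      (chartCoord p p u) (chartCoord p p v) (chartCoord p p w) := by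
  rw [curvature, chartCoord_inverse]
  exact chartCurvature_const (mem_extChartAt_target (I := 𝓘(ℝ, E)) p) _ _ _

theorem inner_grad (V : M → ℝ) (q : M) (w : TangentSpace 𝓘(ℝ, E) q) :
    inner ℝ (grad V q) w = mfderiv 𝓘(ℝ, E) 𝓘(ℝ, ℝ) V q w := by
  have : FiniteDimensional ℝ (TangentSpace 𝓘(ℝ, E) q) := inferInstanceAs (FiniteDimensional ℝ E)
  have h : (metricAt (E := E) q).IsInvertible :=
    isInvertible_of_posDef (metricAt (E := E) q) fun u hu ↦ by
      rw [metricAt_apply, real_inner_self_eq_norm_sq]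
      positivity
  have h1 := h.self_apply_inverse (mfderiv 𝓘(ℝ, E) 𝓘(ℝ, ℝ) V q)
  exact DFunLike.congr_fun h1 w

theorem chartCoord_grad {V : M → ℝ} {p q : M} (hq : q ∈ (extChartAt 𝓘(ℝ, E) p).source)
    (hV : MDifferentiableAt 𝓘(ℝ, E) 𝓘(ℝ, ℝ) V q) :
    chartCoord p q (grad V q) = (chartMetric p (extChartAt 𝓘(ℝ, E) p q)).inverse
      (fderiv ℝ (V ∘ (extChartAt 𝓘(ℝ, E) p).symm) (extChartAt 𝓘(ℝ, E) p q)) := by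
  have hq' := hq
  obtain ⟨y, hy, rfl⟩ : ∃ y ∈ (extChartAt 𝓘(ℝ, E) p).target, (extChartAt 𝓘(ℝ, E) p).symm y = q :=
    ⟨_, (extChartAt 𝓘(ℝ, E) p).map_source hq, (extChartAt 𝓘(ℝ, E) p).left_inv hq⟩
  have hg := isLocalMetric_chartMetric (E := E) p
  refine hg.ext_left ((extChartAt 𝓘(ℝ, E) p).map_source hq) fun w ↦ ?_
  rw [hg.apply_inverse ((extChartAt 𝓘(ℝ, E) p).map_source hq)]
  have h1 := chartMetric_chartCoord hq (grad V _) (chartInv p y w)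
  rw [chartCoord_chartInv hy, inner_grad] at h1
  rw [h1, (extChartAt 𝓘(ℝ, E) p).right_inv hy, ← mfderiv_eq_fderiv,
    mfderiv_comp y hV (mdifferentiableAt_symm hy)]
  rfl

/-- The change of coordinates between two charts. -/
def chartChange (p' p : M) (y : E) : E := extChartAt 𝓘(ℝ, E) p ((extChartAt 𝓘(ℝ, E) p').symm y)

theorem contDiffAt_chartChange {p p' q : M} (hq : q ∈ (extChartAt 𝓘(ℝ, E) p).source)
    (hq' : q ∈ (extChartAt 𝓘(ℝ, E) p').source) :
    ContDiffAt ℝ ∞ (chartChange p' p) (extChartAt 𝓘(ℝ, E) p' q) := by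
  have hy := (extChartAt 𝓘(ℝ, E) p').map_source hq'
  refine contMDiffAt_iff_contDiffAt.1 (ContMDiffAt.comp (I' := 𝓘(ℝ, E)) _ ?_ (contMDiffAt_symm hy))
  rw [(extChartAt 𝓘(ℝ, E) p').left_inv hq']
  exact contMDiffAt_chart hq

theorem fderiv_chartChange {p p' q : M} (hq : q ∈ (extChartAt 𝓘(ℝ, E) p).source)
    (hq' : q ∈ (extChartAt 𝓘(ℝ, E) p').source) (v : TangentSpace 𝓘(ℝ, E) q) :
    fderiv ℝ (chartChange p' p) (extChartAt 𝓘(ℝ, E) p' q) (chartCoord p' q v)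
      = chartCoord p q v := by
  have hev : (fun r ↦ chartChange p' p (extChartAt 𝓘(ℝ, E) p' r)) =ᶠ[𝓝 q]
      extChartAt 𝓘(ℝ, E) p := by
    filter_upwards [(isOpen_source p').mem_nhds hq'] with r hr
    rw [chartChange, (extChartAt 𝓘(ℝ, E) p').left_inv hr]
  have hd := ((contDiffAt_chartChange hq hq').differentiableAt (by simp)).mdifferentiableAt
  have h1 := mfderiv_comp q hd (mdifferentiableAt_chart hq')
  have h2 := hev.mfderiv_eq (I := 𝓘(ℝ, E)) (I' := 𝓘(ℝ, E))
  rw [mfderiv_eq_fderiv] at h1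
  have h3 := DFunLike.congr_fun h1 v
  have h4 := DFunLike.congr_fun h2 v
  exact h3.symm.trans h4

/-- A change of charts is an isometry of the local metrics, because both compute the same inner
product on M. This is the pullback hypothesis of `christoffel_transform`. -/
theorem chartMetric_chartChange {p p' q : M} (hq : q ∈ (extChartAt 𝓘(ℝ, E) p).source)
    (hq' : q ∈ (extChartAt 𝓘(ℝ, E) p').source) :
    ∀ᶠ z in 𝓝 (extChartAt 𝓘(ℝ, E) p' q), ∀ u v, chartMetric p' z u v =
      chartMetric p (chartChange p' p z) (fderiv ℝ (chartChange p' p) z u)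
        (fderiv ℝ (chartChange p' p) z v) := by
  have hy := (extChartAt 𝓘(ℝ, E) p').map_source hq'
  have hc : ContinuousAt (extChartAt 𝓘(ℝ, E) p').symm (extChartAt 𝓘(ℝ, E) p' q) :=
    (contMDiffAt_symm hy).continuousAt
  have hs : (extChartAt 𝓘(ℝ, E) p).source ∈
      𝓝 ((extChartAt 𝓘(ℝ, E) p').symm (extChartAt 𝓘(ℝ, E) p' q)) := by
    rw [(extChartAt 𝓘(ℝ, E) p').left_inv hq']
    exact (isOpen_source p).mem_nhds hq
  filter_upwards [(isOpen_target p').mem_nhds hy, hc.preimage_mem_nhds hs] with z hz hz' u v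
  have hz'' := (extChartAt 𝓘(ℝ, E) p').map_target hz
  have h1 := chartMetric_chartCoord hz'' (chartInv p' z u) (chartInv p' z v)
  have h2 := chartMetric_chartCoord hz' (chartInv p' z u) (chartInv p' z v)
  rw [← fderiv_chartChange hz' hz'', ← fderiv_chartChange hz' hz''] at h2
  rw [chartCoord_chartInv hz, chartCoord_chartInv hz] at h1 h2
  rw [(extChartAt 𝓘(ℝ, E) p').right_inv hz] at h1 h2
  rw [h1, ← h2]
  rfl

theorem christoffel_chartChange {p p' q : M} (hq : q ∈ (extChartAt 𝓘(ℝ, E) p).source)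
    (hq' : q ∈ (extChartAt 𝓘(ℝ, E) p').source) (u v : E) :
    fderiv ℝ (chartChange p' p) (extChartAt 𝓘(ℝ, E) p' q)
        (christoffelCLM (chartMetric p') (extChartAt 𝓘(ℝ, E) p' q) u v) =
      christoffelCLM (chartMetric p) (extChartAt 𝓘(ℝ, E) p q)
        (fderiv ℝ (chartChange p' p) (extChartAt 𝓘(ℝ, E) p' q) u)
        (fderiv ℝ (chartChange p' p) (extChartAt 𝓘(ℝ, E) p' q) v)
      + fderiv ℝ (fderiv ℝ (chartChange p' p)) (extChartAt 𝓘(ℝ, E) p' q) u v := by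
  have hy := (extChartAt 𝓘(ℝ, E) p').map_source hq'
  have hτ : chartChange p' p (extChartAt 𝓘(ℝ, E) p' q) = extChartAt 𝓘(ℝ, E) p q := by
    rw [chartChange, (extChartAt 𝓘(ℝ, E) p').left_inv hq']
  have := (isLocalMetric_chartMetric p).christoffel_transform (isLocalMetric_chartMetric p') hy
    (by rw [hτ]; exact (extChartAt 𝓘(ℝ, E) p).map_source hq) (contDiffAt_chartChange hq hq')
    (chartMetric_chartChange hq hq') ?_ u v
  · rw [this, hτ]
  · intro w
    obtain ⟨e, he⟩ := isInvertible_chartCoord (E := E) hq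
    refine ⟨chartCoord p' q (e.symm w), ?_⟩
    rw [fderiv_chartChange hq hq', ← he]
    exact e.apply_symm_apply w

section Curve

variable {T : ℝ} {x : ℝ → M} {t : ℝ} {p : M}

theorem mdifferentiableWithinAt_chart_comp {s : Set ℝ}
    (hx : MDifferentiableWithinAt 𝓘(ℝ, ℝ) 𝓘(ℝ, E) x s t)
    (hp : x t ∈ (extChartAt 𝓘(ℝ, E) p).source) :
    DifferentiableWithinAt ℝ (fun r ↦ extChartAt 𝓘(ℝ, E) p (x r)) s t :=
  ((mdifferentiableAt_chart hp).comp_mdifferentiableWithinAt t hx).differentiableWithinAt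

theorem chartCoord_velocity (hT : 0 < T) (ht : t ∈ Icc 0 T)
    (hx : MDifferentiableWithinAt 𝓘(ℝ, ℝ) 𝓘(ℝ, E) x (Icc 0 T) t)
    (hp : x t ∈ (extChartAt 𝓘(ℝ, E) p).source) :
    chartCoord p (x t) (velocity T x t)
      = derivWithin (fun r ↦ extChartAt 𝓘(ℝ, E) p (x r)) (Icc 0 T) t := by
  have hu : UniqueMDiffWithinAt 𝓘(ℝ, ℝ) (Icc 0 T) t :=
    ((uniqueDiffOn_Icc hT) t ht).uniqueMDiffWithinAt
  have h := mfderiv_comp_mfderivWithin t (mdifferentiableAt_chart hp) hx hu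
  rw [mfderivWithin_eq_fderivWithin] at h
  exact (DFunLike.congr_fun h (1 : ℝ)).symm

/-- The coordinates of a vector field along a curve in the chart at `p`. -/
def coordField (p : M) (x : ℝ → M) (W : ∀ r, TangentSpace 𝓘(ℝ, E) (x r)) (r : ℝ) : E :=
  chartCoord p (x r) (W r)

theorem coordField_apply (p : M) (x : ℝ → M) (W : ∀ r, TangentSpace 𝓘(ℝ, E) (x r)) (r : ℝ) :
    coordField p x W r = chartCoord p (x r) (W r) := rfl

theorem hasDerivWithinAt_clm_comp_apply {F : E → E →L[ℝ] E} {ξ w : ℝ → E} {ξ' w' : E} {s : Set ℝ}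
    (hF : DifferentiableAt ℝ F (ξ t)) (hξ : HasDerivWithinAt ξ ξ' s t)
    (hw : HasDerivWithinAt w w' s t) :
    HasDerivWithinAt (fun r ↦ F (ξ r) (w r)) (fderiv ℝ F (ξ t) ξ' (w t) + F (ξ t) w') s t :=
  HasDerivWithinAt.clm_apply (c := fun r ↦ F (ξ r)) (hF.hasFDerivAt.comp_hasDerivWithinAt t hξ) hw

/-- The covariant derivative along a curve can be computed in any chart. -/
theorem chartCoord_covDeriv (hT : 0 < T) (ht : t ∈ Icc 0 T)
    (hx : MDifferentiableWithinAt 𝓘(ℝ, ℝ) 𝓘(ℝ, E) x (Icc 0 T) t)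
    (hp : x t ∈ (extChartAt 𝓘(ℝ, E) p).source) {W : ∀ r, TangentSpace 𝓘(ℝ, E) (x r)}
    (hW : DifferentiableWithinAt ℝ (coordField p x W) (Icc 0 T) t) :
    chartCoord p (x t) (covDeriv T x W t) =
      derivWithin (coordField p x W) (Icc 0 T) t
        + christoffelCLM (chartMetric p) (extChartAt 𝓘(ℝ, E) p (x t))
          (derivWithin (fun r ↦ extChartAt 𝓘(ℝ, E) p (x r)) (Icc 0 T) t)
          (coordField p x W t) := by
  have hu : UniqueDiffWithinAt ℝ (Icc 0 T) t := uniqueDiffOn_Icc hT t ht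
  -- The centre of the chart in which `covDeriv` is defined at time t, to be compared with the
  -- arbitrary chart at p.
  set p' := x t with hp'
  have hq' : x t ∈ (extChartAt 𝓘(ℝ, E) p').source := mem_extChartAt_source (x t)
  have hnear : ∀ᶠ r in 𝓝[Icc 0 T] t, x r ∈ (extChartAt 𝓘(ℝ, E) p).source ∧
      x r ∈ (extChartAt 𝓘(ℝ, E) p').source :=
    hx.continuousWithinAt.preimage_mem_nhdsWithin
      (((isOpen_source p).inter (isOpen_source p')).mem_nhds ⟨hp, hq'⟩)
  have hξ' := (mdifferentiableWithinAt_chart_comp hx hq').hasDerivWithinAt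
  have hξ := (mdifferentiableWithinAt_chart_comp hx hp).hasDerivWithinAt
  have hw' : DifferentiableWithinAt ℝ (coordField p' x W) (Icc 0 T) t := by
    have h1 : (coordField p' x W) =ᶠ[𝓝[Icc 0 T] t] fun r ↦
        fderiv ℝ (chartChange p p') (extChartAt 𝓘(ℝ, E) p (x r)) (coordField p x W r) := by
      filter_upwards [hnear] with r hr using (fderiv_chartChange hr.2 hr.1 (W r)).symm
    refine DifferentiableWithinAt.congr_of_eventuallyEq ?_ h1
      (fderiv_chartChange hq' hp (W t)).symm
    have h2 : DifferentiableAt ℝ (fderiv ℝ (chartChange p p')) (extChartAt 𝓘(ℝ, E) p (x t)) :=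
      ((contDiffAt_chartChange hq' hp).fderiv_right (m := ∞) (by simp)).differentiableAt (by simp)
    exact (hasDerivWithinAt_clm_comp_apply h2 hξ hW.hasDerivWithinAt).differentiableWithinAt
  have hw'' := hw'.hasDerivWithinAt
  -- The second derivative of the chart change that appears here is exactly the inhomogeneous term
  -- in the transformation law of Γ.
  have hD : HasDerivWithinAt (coordField p x W)
      (fderiv ℝ (fderiv ℝ (chartChange p' p)) (extChartAt 𝓘(ℝ, E) p' (x t))
        (derivWithin (fun r ↦ extChartAt 𝓘(ℝ, E) p' (x r)) (Icc 0 T) t) (coordField p' x W t)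
      + fderiv ℝ (chartChange p' p) (extChartAt 𝓘(ℝ, E) p' (x t))
        (derivWithin (coordField p' x W) (Icc 0 T) t)) (Icc 0 T) t := by
    have h1 : (coordField p x W) =ᶠ[𝓝[Icc 0 T] t] fun r ↦
        fderiv ℝ (chartChange p' p) (extChartAt 𝓘(ℝ, E) p' (x r)) (coordField p' x W r) := by
      filter_upwards [hnear] with r hr using (fderiv_chartChange hr.1 hr.2 (W r)).symm
    refine HasDerivWithinAt.congr_of_eventuallyEq ?_ h1
      (fderiv_chartChange hp hq' (W t)).symm
    have h2 : DifferentiableAt ℝ (fderiv ℝ (chartChange p' p)) (extChartAt 𝓘(ℝ, E) p' (x t)) :=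
      ((contDiffAt_chartChange hp hq').fderiv_right (m := ∞) (by simp)).differentiableAt (by simp)
    exact hasDerivWithinAt_clm_comp_apply h2 hξ' hw''
  have hDξ : derivWithin (fun r ↦ extChartAt 𝓘(ℝ, E) p (x r)) (Icc 0 T) t =
      fderiv ℝ (chartChange p' p) (extChartAt 𝓘(ℝ, E) p' (x t))
        (derivWithin (fun r ↦ extChartAt 𝓘(ℝ, E) p' (x r)) (Icc 0 T) t) := by
    rw [← chartCoord_velocity hT ht hx hp, ← chartCoord_velocity hT ht hx hq',
      fderiv_chartChange hp hq']
  have hcov : chartCoord p' (x t) (covDeriv T x W t) =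
      derivWithin (coordField p' x W) (Icc 0 T) t
        + christoffelCLM (chartMetric p') (extChartAt 𝓘(ℝ, E) p' (x t))
          (derivWithin (fun r ↦ extChartAt 𝓘(ℝ, E) p' (x r)) (Icc 0 T) t)
          (coordField p' x W t) :=
    chartCoord_inverse _ _
  rw [← fderiv_chartChange hp hq', hcov, map_add, christoffel_chartChange hp hq',
    hD.derivWithin hu, hDξ, coordField_apply p' x W t, fderiv_chartChange hp hq' (W t),
    ← coordField_apply p x W t]
  abel

end Curve

end Metric

end ObstacleAvoidance
end

/-! ### Piecewise smooth curves and their covariant derivatives in a fixed chart. -/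

noncomputable section

set_option maxSynthPendingDepth 3

namespace ObstacleAvoidance

attribute [local instance] isManifold_one

/-- A derivative within J depends only on germs, so restriction to an open N is harmless. The same
`derivWithin` can then be iterated, one-sided at end points of J. -/
theorem contDiffOn_derivWithin_inter {G : Type*} [NormedAddCommGroup G] [NormedSpace ℝ G]
    {J N : Set ℝ} (hJ : UniqueDiffOn ℝ J) (hN : IsOpen N) {w : ℝ → G}
    (hw : ContDiffOn ℝ ∞ w (J ∩ N)) : ContDiffOn ℝ ∞ (derivWithin w J) (J ∩ N) := by
  refine (hw.derivWithin (hJ.inter hN) (m := ∞) (by simp)).congr fun t ht ↦ ?_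
  exact (derivWithin_inter (hN.mem_nhds ht.2)).symm

theorem exists_mem_Ioo_of_notMem_range {l : ℕ} {s : Fin (l + 1) → ℝ} {T t : ℝ} (h0 : s 0 = 0)
    (hT : s (Fin.last l) = T) (ht : t ∈ Icc 0 T) (hs : t ∉ range s) :
    ∃ i : Fin l, t ∈ Ioo (s i.castSucc) (s i.succ) := by
  by_contra! hcon
  have h : ∀ i, s i < t := by
    intro i
    induction i using Fin.induction with
    | zero => exact (h0 ▸ ht.1).lt_of_ne fun h ↦ hs ⟨0, h⟩
    | succ i ih =>
      refine (not_lt.1 fun h ↦ hcon i ⟨ih, h⟩).lt_of_ne fun h ↦ hs ⟨_, h⟩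
  exact absurd (h (Fin.last l)) (by rw [hT]; exact not_lt.2 ht.2)

variable {E : Type*} [NormedAddCommGroup E] [NormedSpace ℝ E]
  {M : Type*} [TopologicalSpace M] [ChartedSpace E M] [IsManifold 𝓘(ℝ, E) ∞ M]

section Regular

variable {T : ℝ} {x : ℝ → M}

theorem contDiffOn_chart_comp {s : Set ℝ} {p : M} {n : WithTop ℕ∞} (hn : n ≤ ∞)
    (hx : ContMDiffOn 𝓘(ℝ, ℝ) 𝓘(ℝ, E) n x s)
    (hp : MapsTo x s (extChartAt 𝓘(ℝ, E) p).source) :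
    ContDiffOn ℝ n (fun r ↦ extChartAt 𝓘(ℝ, E) p (x r)) s := fun t ht ↦
  contMDiffWithinAt_iff_contDiffWithinAt.1
    (((contMDiffAt_chart (hp ht)).of_le hn).comp_contMDiffWithinAt t (hx t ht))

/-- An open set `N` whose trace on `[0, T]` consists of the times at which `x` lies in the chart. -/
theorem exists_isOpen_mapsTo {s : Set ℝ} (hx : ContinuousOn x s) {U : Set M} (hU : IsOpen U) {t : ℝ}
    (ht : t ∈ s) (hp : x t ∈ U) : ∃ N, IsOpen N ∧ t ∈ N ∧ MapsTo x (s ∩ N) U := by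
  have h := (hx t ht).preimage_mem_nhdsWithin (hU.mem_nhds hp)
  obtain ⟨N, hN, htN, hsub⟩ := mem_nhdsWithin.1 h
  exact ⟨N, hN, htN, fun r hr ↦ hsub ⟨hr.2, hr.1⟩⟩

/-- On a closed smooth piece the one-sided second derivative is continuous up to the ends, hence
bounded near t₀ even if t₀ is a break point. Away from the piece the bound is vacuous. -/
theorem deriv_deriv_bounded_piece {a b t₀ : ℝ} (hab : a < b) {p : M}
    (hx : ContMDiffOn 𝓘(ℝ, ℝ) 𝓘(ℝ, E) ∞ x (Icc a b)) (hp : x t₀ ∈ (extChartAt 𝓘(ℝ, E) p).source) :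
    ∃ C, ∀ᶠ t in 𝓝 t₀, t ∈ Ioo a b →
      ‖deriv (deriv fun r ↦ extChartAt 𝓘(ℝ, E) p (x r)) t‖ ≤ C := by
  by_cases ht₀ : t₀ ∈ Icc a b
  · obtain ⟨N, hN, htN, hmaps⟩ := exists_isOpen_mapsTo hx.continuousOn (isOpen_source p) ht₀ hp
    have hJ := uniqueDiffOn_Icc hab
    set ξ := fun r ↦ extChartAt 𝓘(ℝ, E) p (x r) with hξ
    have h0 : ContDiffOn ℝ ∞ ξ (Icc a b ∩ N) :=
      contDiffOn_chart_comp le_rfl (hx.mono inter_subset_left) hmaps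
    have h2 := contDiffOn_derivWithin_inter hJ hN (contDiffOn_derivWithin_inter hJ hN h0)
    have hc := (h2.continuousOn t₀ ⟨ht₀, htN⟩).norm
    refine ⟨‖derivWithin (derivWithin ξ (Icc a b)) (Icc a b) t₀‖ + 1, ?_⟩
    have hev := hc.eventually (Iio_mem_nhds (lt_add_one _))
    rw [nhdsWithin_inter_of_mem' (mem_nhdsWithin_of_mem_nhds (hN.mem_nhds htN)),
      eventually_nhdsWithin_iff] at hev
    filter_upwards [hev] with t ht htI
    have hnear : ∀ r ∈ Ioo a b, Icc a b ∈ 𝓝 r := fun r hr ↦ Icc_mem_nhds hr.1 hr.2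
    have e1 : deriv ξ =ᶠ[𝓝 t] derivWithin ξ (Icc a b) := by
      filter_upwards [isOpen_Ioo.mem_nhds htI] with r hr
      exact (derivWithin_of_mem_nhds (hnear r hr)).symm
    rw [e1.deriv_eq, ← derivWithin_of_mem_nhds (hnear t htI)]
    exact (ht (Ioo_subset_Icc_self htI)).le
  · refine ⟨0, ?_⟩
    filter_upwards [isClosed_Icc.isOpen_compl.mem_nhds ht₀] with t ht ht'
    exact absurd (Ioo_subset_Icc_self ht') ht

/-- The consequences of piecewise smoothness that are used: off a finite set of times the curve is
smooth, and its second derivative in charts is locally bounded. -/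
structure IsSmoothOffFinite (T : ℝ) (x : ℝ → M) (S : Set ℝ) : Prop where
  finite : S.Finite
  mem_Ioo : ∀ t ∈ Icc 0 T \ S, t ∈ Ioo 0 T
  contMDiffOn_one : ContMDiffOn 𝓘(ℝ, ℝ) 𝓘(ℝ, E) 1 x (Icc 0 T)
  contMDiffAt : ∀ t ∈ Icc 0 T \ S, ContMDiffAt 𝓘(ℝ, ℝ) 𝓘(ℝ, E) ∞ x t
  bounded : ∀ p : M, ∀ t₀, x t₀ ∈ (extChartAt 𝓘(ℝ, E) p).source →
    ∃ C, ∀ᶠ t in 𝓝 t₀, t ∈ Icc 0 T \ S →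
      ‖deriv (deriv fun r ↦ extChartAt 𝓘(ℝ, E) p (x r)) t‖ ≤ C

theorem isSmoothOffFinite_range {l : ℕ} {s : Fin (l + 1) → ℝ} (hs : StrictMono s) (h0 : s 0 = 0)
    (hT : s (Fin.last l) = T) (h1 : ContMDiffOn 𝓘(ℝ, ℝ) 𝓘(ℝ, E) 1 x (Icc 0 T))
    (hx : ∀ i : Fin l, ContMDiffOn 𝓘(ℝ, ℝ) 𝓘(ℝ, E) ∞ x (Icc (s i.castSucc) (s i.succ))) :
    IsSmoothOffFinite (E := E) T x (range s) where
  finite := finite_range s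
  mem_Ioo t ht := ⟨ht.1.1.lt_of_ne fun h ↦ ht.2 ⟨0, h0.trans h⟩,
    ht.1.2.lt_of_ne fun h ↦ ht.2 ⟨_, hT.trans h.symm⟩⟩
  contMDiffOn_one := h1
  contMDiffAt t ht := by
    obtain ⟨i, hi⟩ := exists_mem_Ioo_of_notMem_range h0 hT ht.1 ht.2
    exact (hx i).contMDiffAt (Icc_mem_nhds hi.1 hi.2)
  bounded p t₀ hp := by
    choose C hC using fun i : Fin l ↦
      deriv_deriv_bounded_piece (hs i.castSucc_lt_succ) (hx i) hp
    refine ⟨∑ i, |C i|, ?_⟩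
    filter_upwards [Filter.eventually_all.2 hC] with t ht htS
    obtain ⟨i, hi⟩ := exists_mem_Ioo_of_notMem_range h0 hT htS.1 htS.2
    exact (ht i hi).trans ((le_abs_self _).trans
      (Finset.single_le_sum (f := fun i ↦ |C i|) (fun _ _ ↦ abs_nonneg _) (Finset.mem_univ i)))

/-- Near 0 and near T the interval [0, T] coincides with the first and the last piece. Interior
variations say nothing about smoothness at these two times. -/
theorem IsC1PiecewiseSmooth.contMDiffWithinAt_endpoints (hT : 0 < T)
    (hx : IsC1PiecewiseSmooth (E := E) T x) :
    ContMDiffWithinAt 𝓘(ℝ, ℝ) 𝓘(ℝ, E) ∞ x (Icc 0 T) 0 ∧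
      ContMDiffWithinAt 𝓘(ℝ, ℝ) 𝓘(ℝ, E) ∞ x (Icc 0 T) T := by
  obtain ⟨-, l, s, hs, h0, hl, hsm⟩ := hx
  obtain ⟨l, rfl⟩ : ∃ k, l = k + 1 := by
    refine Nat.exists_eq_succ_of_ne_zero ?_
    rintro rfl
    have : s (Fin.last 0) = s 0 := rfl
    linarith
  constructor
  · have hlt : 0 < s (Fin.succ 0) := by
      rw [← h0]; exact hs (Fin.castSucc_lt_succ (i := (0 : Fin (l + 1))))
    have h := hsm 0
    rw [Fin.castSucc_zero, h0] at h
    refine (h 0 ⟨le_rfl, hlt.le⟩).mono_of_mem_nhdsWithin ?_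
    filter_upwards [self_mem_nhdsWithin, mem_nhdsWithin_of_mem_nhds (Iio_mem_nhds hlt)] with t h1 h2
    exact ⟨h1.1, le_of_lt h2⟩
  · have hlt : s (Fin.castSucc (Fin.last l)) < T := by
      rw [← hl]; exact hs (Fin.castSucc_lt_succ (i := Fin.last l))
    have h := hsm (Fin.last l)
    rw [Fin.succ_last, hl] at h
    refine (h T ⟨hlt.le, le_rfl⟩).mono_of_mem_nhdsWithin ?_
    filter_upwards [self_mem_nhdsWithin, mem_nhdsWithin_of_mem_nhds (Ioi_mem_nhds hlt)] with t h1 h2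
    exact ⟨le_of_lt h2, h1.2⟩

end Regular

variable [FiniteDimensional ℝ E] [RiemannianBundle (fun p : M ↦ TangentSpace 𝓘(ℝ, E) p)]
  [IsContMDiffRiemannianBundle 𝓘(ℝ, E) ∞ E (fun p : M ↦ TangentSpace 𝓘(ℝ, E) p)]
  {T : ℝ} {x : ℝ → M}

/-- Smoothness and the formula go together by induction: smoothness of the k-th field allows
`chartCoord_covDeriv`, whose formula shows the next field to be smooth. End points of [0, T] are
included. -/
theorem coordField_curveDeriv (hT : 0 < T) {N : Set ℝ} (hN : IsOpen N)
    (hx : ContMDiffOn 𝓘(ℝ, ℝ) 𝓘(ℝ, E) ∞ x (Icc 0 T ∩ N)) {p : M}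
    (hp : MapsTo x (Icc 0 T ∩ N) (extChartAt 𝓘(ℝ, E) p).source) (k : ℕ) :
    ContDiffOn ℝ ∞ (coordField (E := E) p x (curveDeriv T x k)) (Icc 0 T ∩ N) ∧
    ∀ t ∈ Icc 0 T ∩ N, coordField (E := E) p x (curveDeriv T x (k + 1)) t =
      derivWithin (coordField (E := E) p x (curveDeriv T x k)) (Icc 0 T) t
        + christoffelCLM (chartMetric p) (extChartAt 𝓘(ℝ, E) p (x t))
          (derivWithin (fun r ↦ extChartAt 𝓘(ℝ, E) p (x r)) (Icc 0 T) t)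
          (coordField (E := E) p x (curveDeriv T x k) t) := by
  have hJ := uniqueDiffOn_Icc hT
  have hξ : ContDiffOn ℝ ∞ (fun r ↦ extChartAt 𝓘(ℝ, E) p (x r)) (Icc 0 T ∩ N) :=
    contDiffOn_chart_comp le_rfl hx hp
  have hξ' := contDiffOn_derivWithin_inter hJ hN hξ
  have hmd : ∀ t ∈ Icc 0 T ∩ N, MDifferentiableWithinAt 𝓘(ℝ, ℝ) 𝓘(ℝ, E) x (Icc 0 T) t := by
    intro t ht
    refine ((hx t ht).mdifferentiableWithinAt (by simp)).mono_of_mem_nhdsWithin ?_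
    exact Filter.inter_mem self_mem_nhdsWithin (mem_nhdsWithin_of_mem_nhds (hN.mem_nhds ht.2))
  have hΓ : ContDiffOn ℝ ∞
      (fun r ↦ christoffelCLM (chartMetric p) (extChartAt 𝓘(ℝ, E) p (x r))) (Icc 0 T ∩ N) :=
    (isLocalMetric_chartMetric p).contDiffOn_christoffel.comp hξ fun t ht ↦
      (extChartAt 𝓘(ℝ, E) p).map_source (hp ht)
  have step : ∀ k, ContDiffOn ℝ ∞ (coordField (E := E) p x (curveDeriv T x k)) (Icc 0 T ∩ N) →
      ∀ t ∈ Icc 0 T ∩ N, coordField (E := E) p x (curveDeriv T x (k + 1)) t =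
      derivWithin (coordField (E := E) p x (curveDeriv T x k)) (Icc 0 T) t
        + christoffelCLM (chartMetric p) (extChartAt 𝓘(ℝ, E) p (x t))
          (derivWithin (fun r ↦ extChartAt 𝓘(ℝ, E) p (x r)) (Icc 0 T) t)
          (coordField (E := E) p x (curveDeriv T x k) t) := by
    intro k hk t ht
    refine chartCoord_covDeriv hT ht.1 (hmd t ht) (hp ht) ?_
    refine ((hk t ht).differentiableWithinAt (by simp)).mono_of_mem_nhdsWithin ?_
    exact Filter.inter_mem self_mem_nhdsWithin (mem_nhdsWithin_of_mem_nhds (hN.mem_nhds ht.2))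
  have main : ∀ k, ContDiffOn ℝ ∞ (coordField (E := E) p x (curveDeriv T x k)) (Icc 0 T ∩ N) := by
    intro k
    induction k with
    | zero => exact hξ'.congr fun t ht ↦ chartCoord_velocity hT ht.1 (hmd t ht) (hp ht)
    | succ k ih =>
      refine ContDiffOn.congr ?_ (step k ih)
      exact (contDiffOn_derivWithin_inter hJ hN ih).add ((hΓ.clm_apply hξ').clm_apply ih)
  exact ⟨main k, step k (main k)⟩

/-- On an open set of interior times, the coordinates of the covariant derivatives of the velocity
are iterated covariant derivatives in the chart. -/
theorem coordField_curveDeriv_of_isOpen (hT : 0 < T) {N : Set ℝ} (hN : IsOpen N)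
    (hNT : N ⊆ Ioo 0 T) (hx : ContMDiffOn 𝓘(ℝ, ℝ) 𝓘(ℝ, E) ∞ x N) {p : M}
    (hp : MapsTo x N (extChartAt 𝓘(ℝ, E) p).source) {ξ : ℝ → E}
    (hξ : ξ = fun r ↦ extChartAt 𝓘(ℝ, E) p (x r)) :
    (∀ t ∈ N, coordField (E := E) p x (velocity T x) t = deriv ξ t) ∧
    ∀ k, ∀ t ∈ N, coordField (E := E) p x (curveDeriv T x (k + 1)) t =
      covAlong (chartMetric p) ξ (coordField (E := E) p x (curveDeriv T x k)) t := by
  have hsub : Icc 0 T ∩ N = N := inter_eq_right.2 (hNT.trans Ioo_subset_Icc_self)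
  have hnear : ∀ t ∈ N, Icc 0 T ∈ 𝓝 t := fun t ht ↦ Icc_mem_nhds (hNT ht).1 (hNT ht).2
  constructor
  · intro t ht
    rw [coordField_apply, chartCoord_velocity hT (Ioo_subset_Icc_self (hNT ht)) _ (hp ht),
      derivWithin_of_mem_nhds (hnear t ht), hξ]
    exact ((hx.contMDiffAt (hN.mem_nhds ht)).mdifferentiableAt
      (by simp)).mdifferentiableWithinAt
  · intro k t ht
    have h := (coordField_curveDeriv hT hN (by rwa [hsub]) (p := p) (by rwa [hsub]) k).2 t
      ⟨Ioo_subset_Icc_self (hNT ht), ht⟩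
    rw [derivWithin_of_mem_nhds (hnear t ht), derivWithin_of_mem_nhds (hnear t ht)] at h
    rw [h, covAlong, hξ]

theorem covAlong_congr {g : E → E →L[ℝ] E →L[ℝ] ℝ} {ξ w w' : ℝ → E} {t : ℝ} (h : w =ᶠ[𝓝 t] w') :
    covAlong g ξ w t = covAlong g ξ w' t := by
  rw [covAlong, covAlong, h.deriv_eq, h.self_of_nhds]

/-- The integrand of the functional `J`. -/
def energyDensity (T σ : ℝ) (V : M → ℝ) (x : ℝ → M) (t : ℝ) : ℝ :=
  (1 / 2 : ℝ) * (‖curveDeriv (E := E) T x 1 t‖ ^ 2 + σ * ‖velocity (E := E) T x t‖ ^ 2 + V (x t))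

/-- The passage from J to the variational problem on a vector space. -/
theorem energyDensity_eq (hT : 0 < T) (σ : ℝ) (V : M → ℝ) {N : Set ℝ} (hN : IsOpen N)
    (hNT : N ⊆ Ioo 0 T) (hx : ContMDiffOn 𝓘(ℝ, ℝ) 𝓘(ℝ, E) ∞ x N) {p : M}
    (hp : MapsTo x N (extChartAt 𝓘(ℝ, E) p).source) {ξ : ℝ → E}
    (hξ : ξ = fun r ↦ extChartAt 𝓘(ℝ, E) p (x r)) {t : ℝ} (ht : t ∈ N) :
    energyDensity (E := E) T σ V x t = lagrangian (chartMetric p) σ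
      (V ∘ (extChartAt 𝓘(ℝ, E) p).symm) (ξ t, deriv ξ t, deriv (deriv ξ) t) := by
  obtain ⟨h0, h1⟩ := coordField_curveDeriv_of_isOpen hT hN hNT hx hp hξ
  have hv := h0 t ht
  have ha := h1 0 t ht
  have hev : coordField (E := E) p x (curveDeriv T x 0) =ᶠ[𝓝 t] deriv ξ := by
    filter_upwards [hN.mem_nhds ht] with r hr using h0 r hr
  rw [covAlong_congr hev] at ha
  rw [coordField_apply] at hv ha
  rw [energyDensity, norm_sq_eq (hp ht), norm_sq_eq (hp ht), hv, ha, lagrangian, covAlong]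
  simp only [hξ, Function.comp_apply, (extChartAt 𝓘(ℝ, E) p).left_inv (hp ht)]

end ObstacleAvoidance
end

/-! ### Differentiation under the integral, and integrability of the energy density. -/

noncomputable section

set_option maxSynthPendingDepth 3

namespace ObstacleAvoidance

attribute [local instance] isManifold_one

open MeasureTheory

/-- Differentiation under the integral sign along a linear variation. -/
theorem hasDerivAt_integral_variation {F : Type*} [NormedAddCommGroup F] [NormedSpace ℝ F]
    [FiniteDimensional ℝ F] {W : Set F} (hW : IsOpen W) {L : F → ℝ} (hL : ContDiffOn ℝ 1 L W)
    {a b : ℝ} (hab : a < b) {S : Set ℝ} (hS : S.Finite) {z ζ : ℝ → F}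
    (hz : ContinuousOn z (Ioo a b \ S)) (hζ : Continuous ζ) {B : ℝ} (hB : ∀ t, ‖ζ t‖ ≤ B)
    {Q : Set F} (hQ : IsCompact Q) (hQW : Q ⊆ W) (hzQ : ∀ t ∈ Ioo a b \ S, z t ∈ Q) :
    HasDerivAt (fun r : ℝ ↦ ∫ t in a..b, (L (z t + r • ζ t) - L (z t)))
      (∫ t in a..b, fderiv ℝ L (z t) (ζ t)) 0 := by
  have : ProperSpace F := FiniteDimensional.proper ℝ F
  obtain ⟨δ, hδ, hδW⟩ := hQ.exists_cthickening_subset_open hW hQW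
  have hQ' : IsCompact (Metric.cthickening δ Q) := hQ.cthickening
  have hDL : ContinuousOn (fderiv ℝ L) W := hL.continuousOn_fderiv_of_isOpen hW le_rfl
  obtain ⟨C, hC⟩ := hQ'.exists_bound_of_continuousOn (hDL.mono hδW)
  have hB0 : 0 ≤ B := (norm_nonneg _).trans (hB 0)
  have hO : IsOpen (Ioo a b \ S) := isOpen_Ioo.sdiff hS.isClosed
  -- The radius ensures |r| B ≤ δ, so the varied jet stays in the compact thickening of Q; the +1
  -- covers B = 0.
  have hin : ∀ t ∈ Ioo a b \ S, ∀ r ∈ Metric.ball (0 : ℝ) (δ / (B + 1)),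
      z t + r • ζ t ∈ Metric.cthickening δ Q := by
    intro t ht r hr
    refine Metric.mem_cthickening_of_dist_le _ (z t) _ _ (hzQ t ht) ?_
    rw [dist_eq_norm, add_sub_cancel_left, norm_smul]
    rw [Metric.mem_ball, dist_zero_right, lt_div_iff₀ (by linarith)] at hr
    nlinarith [norm_nonneg r, hB t, norm_nonneg (ζ t)]
  have h0 : (0 : ℝ) ∈ Metric.ball (0 : ℝ) (δ / (B + 1)) := Metric.mem_ball_self (by positivity)
  have hrestr : volume.restrict (Ioc a b) = volume.restrict (Ioo a b \ S) := by
    refine Measure.restrict_congr_set ?_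
    exact Ioo_ae_eq_Ioc.symm.trans (sdiff_null_ae_eq_self (hS.measure_zero volume)).symm
  have hcomp : ∀ r ∈ Metric.ball (0 : ℝ) (δ / (B + 1)),
      ContinuousOn (fun t ↦ z t + r • ζ t) (Ioo a b \ S) := fun r _ ↦
    hz.add (hζ.continuousOn.const_smul r)
  have hLc : ∀ r ∈ Metric.ball (0 : ℝ) (δ / (B + 1)),
      ContinuousOn (fun t ↦ L (z t + r • ζ t) - L (z t)) (Ioo a b \ S) := fun r hr ↦
    (hL.continuousOn.comp (hcomp r hr) fun t ht ↦ hδW (hin t ht r hr)).sub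
      (hL.continuousOn.comp hz fun t ht ↦ hQW (hzQ t ht))
  simp only [intervalIntegral.integral_of_le hab.le, hrestr]
  have key := hasDerivAt_integral_of_dominated_loc_of_deriv_le
    (μ := volume.restrict (Ioo a b \ S)) (s := Metric.ball (0 : ℝ) (δ / (B + 1))) (x₀ := (0 : ℝ))
    (F := fun r t ↦ L (z t + r • ζ t) - L (z t))
    (F' := fun r t ↦ fderiv ℝ L (z t + r • ζ t) (ζ t)) (bound := fun _ ↦ C * B)
    (Metric.isOpen_ball.mem_nhds h0) ?_ ?_ ?_ ?_ ?_ ?_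
  · simpa using key.2
  · filter_upwards [Metric.isOpen_ball.mem_nhds h0] with r hr
    exact (hLc r hr).aestronglyMeasurable hO.measurableSet
  -- At r = 0 the integrand is identically zero, so its integrability is immediate. Subtracting L (z
  -- t) serves this purpose.
  · simp
  · have hc : ContinuousOn (fun t ↦ fderiv ℝ L (z t + (0 : ℝ) • ζ t) (ζ t)) (Ioo a b \ S) :=
      (hDL.comp (hcomp 0 h0) fun t ht ↦ hδW (hin t ht 0 h0)).clm_apply hζ.continuousOn
    exact hc.aestronglyMeasurable hO.measurableSet
  · refine (ae_restrict_iff' hO.measurableSet).2 (Filter.Eventually.of_forall fun t ht r hr ↦ ?_)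
    refine (ContinuousLinearMap.le_opNorm _ _).trans ?_
    exact mul_le_mul (hC _ (hin t ht r hr)) (hB t) (norm_nonneg _)
      ((norm_nonneg _).trans (hC _ (hin t ht r hr)))
  · refine integrableOn_const ?_
    exact ((measure_mono sdiff_subset).trans_lt measure_Ioo_lt_top).ne
  · refine (ae_restrict_iff' hO.measurableSet).2 (Filter.Eventually.of_forall fun t ht r hr ↦ ?_)
    have hd : HasFDerivAt L (fderiv ℝ L (z t + r • ζ t)) (z t + r • ζ t) :=
      ((hL.contDiffAt (hW.mem_nhds (hδW (hin t ht r hr)))).differentiableAt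
        (by simp)).hasFDerivAt
    have hlin : HasDerivAt (fun r : ℝ ↦ z t + r • ζ t) (ζ t) r := by
      simpa using ((hasDerivAt_id r).smul_const (ζ t)).const_add (z t)
    exact (hd.comp_hasDerivAt r hlin).sub_const _

variable {E : Type*} [NormedAddCommGroup E] [NormedSpace ℝ E]
  {M : Type*} [TopologicalSpace M] [ChartedSpace E M] [IsManifold 𝓘(ℝ, E) ∞ M]

/-- The part of the target of the chart at `p` that lies off the obstacle set. -/
def freeTarget (O : Set M) (p : M) : Set E :=
  (extChartAt 𝓘(ℝ, E) p).target ∩ (extChartAt 𝓘(ℝ, E) p).symm ⁻¹' Oᶜ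

theorem isOpen_freeTarget {O : Set M} (hO : IsClosed O) (p : M) :
    IsOpen (freeTarget (E := E) O p) :=
  (continuousOn_extChartAt_symm p).isOpen_inter_preimage (isOpen_target p) hO.isOpen_compl

theorem mem_freeTarget {O : Set M} {p q : M} (hq : q ∈ (extChartAt 𝓘(ℝ, E) p).source)
    (hqO : q ∉ O) : extChartAt 𝓘(ℝ, E) p q ∈ freeTarget O p :=
  ⟨(extChartAt 𝓘(ℝ, E) p).map_source hq, by
    rwa [mem_preimage, (extChartAt 𝓘(ℝ, E) p).left_inv hq]⟩

theorem contDiffOn_potential {O : Set M} {V : M → ℝ} (hV : ContMDiffOn 𝓘(ℝ, E) 𝓘(ℝ, ℝ) ∞ V Oᶜ)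
    (p : M) : ContDiffOn ℝ ∞ (V ∘ (extChartAt 𝓘(ℝ, E) p).symm) (freeTarget (E := E) O p) := by
  refine contMDiffOn_iff_contDiffOn.1 ?_
  exact hV.comp ((contMDiffOn_extChartAt_symm p).mono inter_subset_left) inter_subset_right

theorem IsLocalMetric.mono {g : E → E →L[ℝ] E →L[ℝ] ℝ} {U U' : Set E} (hg : IsLocalMetric g U)
    (hU' : IsOpen U') (h : U' ⊆ U) : IsLocalMetric g U' where
  isOpen := hU'
  contDiffOn := hg.contDiffOn.mono h
  symm y hy := hg.symm y (h hy)
  pos y hy := hg.pos y (h hy)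

namespace IsSmoothOffFinite

variable {T : ℝ} {x : ℝ → M} {S : Set ℝ}

theorem diff_eq (hx : IsSmoothOffFinite (E := E) T x S) : Icc 0 T \ S = Ioo 0 T \ S :=
  Subset.antisymm (fun t ht ↦ ⟨hx.mem_Ioo t ht, ht.2⟩)
    (sdiff_subset_sdiff_left Ioo_subset_Icc_self)

theorem isOpen_diff (hx : IsSmoothOffFinite (E := E) T x S) : IsOpen (Ioo 0 T \ S) :=
  isOpen_Ioo.sdiff hx.finite.isClosed

theorem contMDiffOn_diff (hx : IsSmoothOffFinite (E := E) T x S) :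
    ContMDiffOn 𝓘(ℝ, ℝ) 𝓘(ℝ, E) ∞ x (Ioo 0 T \ S) := fun t ht ↦
  (hx.contMDiffAt t (hx.diff_eq ▸ ht)).contMDiffWithinAt

theorem exists_isOpen_smooth (hx : IsSmoothOffFinite (E := E) T x S) {t : ℝ}
    (ht : t ∈ Ioo 0 T \ S) {p : M} (hp : x t ∈ (extChartAt 𝓘(ℝ, E) p).source) :
    ∃ N, IsOpen N ∧ t ∈ N ∧ N ⊆ Ioo 0 T \ S ∧
      MapsTo x N (extChartAt 𝓘(ℝ, E) p).source := by
  obtain ⟨N, hN, htN, hmaps⟩ :=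
    exists_isOpen_mapsTo hx.contMDiffOn_diff.continuousOn (isOpen_source p) ht hp
  exact ⟨_, hx.isOpen_diff.inter hN, ⟨ht, htN⟩, inter_subset_left, hmaps⟩

/-- Position and velocity are continuous at t₀ and the acceleration is locally bounded, so a product
of three closed balls contains the nearby jets, also when t₀ is a break point or an end point. -/
theorem exists_compact_jets (hx : IsSmoothOffFinite (E := E) T x S) [FiniteDimensional ℝ E]
    (hT : 0 < T) {t₀ : ℝ} (ht₀ : t₀ ∈ Icc 0 T) {p : M}
    (hp : x t₀ ∈ (extChartAt 𝓘(ℝ, E) p).source) {U : Set E} (hU : IsOpen U) {ξ : ℝ → E}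
    (hξ : ξ = fun r ↦ extChartAt 𝓘(ℝ, E) p (x r)) (hξU : ξ t₀ ∈ U) :
    ∃ Q : Set (E × E × E), IsCompact Q ∧ Q ⊆ U ×ˢ univ ∧ ∀ᶠ t in 𝓝 t₀, t ∈ Icc 0 T \ S →
      x t ∈ (extChartAt 𝓘(ℝ, E) p).source ∧ (ξ t, deriv ξ t, deriv (deriv ξ) t) ∈ Q := by
  have : ProperSpace E := FiniteDimensional.proper ℝ E
  obtain ⟨N, hN, htN, hmaps⟩ :=
    exists_isOpen_mapsTo hx.contMDiffOn_one.continuousOn (isOpen_source p) ht₀ hp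
  have hJ := uniqueDiffOn_Icc hT
  have h1 : ContDiffOn ℝ 1 ξ (Icc 0 T ∩ N) := by
    rw [hξ]
    exact contDiffOn_chart_comp (by simp) (hx.contMDiffOn_one.mono inter_subset_left) hmaps
  have h2 : ContinuousOn (derivWithin ξ (Icc 0 T ∩ N)) (Icc 0 T ∩ N) :=
    h1.continuousOn_derivWithin (hJ.inter hN) le_rfl
  obtain ⟨r, hr, hrU⟩ := Metric.nhds_basis_closedBall.mem_iff.1 (hU.mem_nhds hξU)
  obtain ⟨C, hC⟩ := hx.bounded p t₀ hp
  refine ⟨Metric.closedBall (ξ t₀) r ×ˢ (Metric.closedBall (derivWithin ξ (Icc 0 T ∩ N) t₀) 1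
    ×ˢ Metric.closedBall 0 C), (isCompact_closedBall _ _).prod ((isCompact_closedBall _ _).prod
    (isCompact_closedBall _ _)), prod_mono hrU (subset_univ _), ?_⟩
  have e1 := (h1.continuousOn t₀ ⟨ht₀, htN⟩).eventually_mem (Metric.closedBall_mem_nhds _ hr)
  have e2 := (h2 t₀ ⟨ht₀, htN⟩).eventually_mem (Metric.closedBall_mem_nhds _ one_pos)
  rw [nhdsWithin_inter_of_mem' (mem_nhdsWithin_of_mem_nhds (hN.mem_nhds htN)),
    eventually_nhdsWithin_iff] at e1 e2
  filter_upwards [e1, e2, hC, hN.mem_nhds htN] with t h1 h2 h3 h4 ht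
  refine ⟨hmaps ⟨ht.1, h4⟩, h1 ht.1, ?_, ?_⟩
  · have hI := hx.mem_Ioo t ht
    have := h2 ht.1
    rwa [derivWithin_of_mem_nhds (Filter.inter_mem (Icc_mem_nhds hI.1 hI.2) (hN.mem_nhds h4))]
      at this
  · rw [mem_closedBall_zero_iff, hξ]
    exact h3 ht

variable [FiniteDimensional ℝ E] [RiemannianBundle (fun p : M ↦ TangentSpace 𝓘(ℝ, E) p)]
  [IsContMDiffRiemannianBundle 𝓘(ℝ, E) ∞ E (fun p : M ↦ TangentSpace 𝓘(ℝ, E) p)]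
  {σ : ℝ} {O : Set M} {V : M → ℝ}

theorem continuousOn_jets {N : Set ℝ} (hN : IsOpen N) {ξ : ℝ → E} (hξ : ContDiffOn ℝ ∞ ξ N) :
    ContinuousOn (fun t ↦ (ξ t, deriv ξ t, deriv (deriv ξ) t)) N := by
  have h1 : ContDiffOn ℝ ∞ (deriv ξ) N := hξ.deriv_of_isOpen hN (by simp)
  have h2 : ContDiffOn ℝ ∞ (deriv (deriv ξ)) N := h1.deriv_of_isOpen hN (by simp)
  exact hξ.continuousOn.prodMk (h1.continuousOn.prodMk h2.continuousOn)

theorem isLocalMetric_freeTarget (hO : IsClosed O) (p : M) :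
    IsLocalMetric (chartMetric p) (freeTarget (E := E) O p) :=
  (isLocalMetric_chartMetric p).mono (isOpen_freeTarget hO p) inter_subset_left

/-- Needed to subtract two energies: the integral of a nonintegrable density would have the default
value 0. The density is continuous off S and bounded. -/
theorem intervalIntegrable_energyDensity (hx : IsSmoothOffFinite (E := E) T x S) (hT : 0 < T)
    (hO : IsClosed O) (hV : ContMDiffOn 𝓘(ℝ, E) 𝓘(ℝ, ℝ) ∞ V Oᶜ) (hxO : ∀ t ∈ Icc 0 T, x t ∉ O)
    (σ : ℝ) : IntervalIntegrable (energyDensity (E := E) T σ V x) volume 0 T := by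
  have hL : ∀ p : M, ContDiffOn ℝ ∞ (lagrangian (chartMetric p) σ
      (V ∘ (extChartAt 𝓘(ℝ, E) p).symm)) (freeTarget (E := E) O p ×ˢ univ) := fun p ↦
    (isLocalMetric_freeTarget hO p).contDiffOn_lagrangian σ (contDiffOn_potential hV p)
  have hcont : ContinuousOn (energyDensity (E := E) T σ V x) (Ioo 0 T \ S) := by
    intro t ht
    have hp := mem_extChartAt_source (I := 𝓘(ℝ, E)) (x t)
    obtain ⟨N, hN, htN, hNsub, hmaps⟩ := hx.exists_isOpen_smooth ht hp
    have hxN := hx.contMDiffOn_diff.mono hNsub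
    have hc := (hL (x t)).continuousOn.comp
      (continuousOn_jets hN (contDiffOn_chart_comp le_rfl hxN hmaps)) fun r hr ↦
      ⟨mem_freeTarget (hmaps hr) (hxO r (Ioo_subset_Icc_self (hNsub hr).1)), mem_univ _⟩
    refine ContinuousAt.continuousWithinAt ?_
    refine (hc.continuousAt (hN.mem_nhds htN)).congr_of_eventuallyEq ?_
    filter_upwards [hN.mem_nhds htN] with r hr
    exact energyDensity_eq hT σ V hN (hNsub.trans sdiff_subset) hxN hmaps rfl hr
  obtain ⟨C, hC⟩ : ∃ C, ∀ t ∈ Icc 0 T \ S, ‖energyDensity (E := E) T σ V x t‖ ≤ C := by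
    suffices h : ∃ C, ∀ t ∈ Icc 0 T, t ∈ Icc 0 T \ S →
        ‖energyDensity (E := E) T σ V x t‖ ≤ C by
      obtain ⟨C, hC⟩ := h
      exact ⟨C, fun t ht ↦ hC t ht.1 ht⟩
    -- Local bounds are glued by compactness, since having a bound passes to subsets and finite
    -- unions.
    refine (isCompact_Icc (a := (0 : ℝ)) (b := T)).induction_on
      (p := fun A ↦ ∃ C, ∀ t ∈ A, t ∈ Icc 0 T \ S → ‖energyDensity (E := E) T σ V x t‖ ≤ C)
      ?_ ?_ ?_ ?_
    · exact ⟨0, fun t ht ↦ absurd ht (notMem_empty t)⟩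
    · rintro A B hAB ⟨C, hC⟩
      exact ⟨C, fun t ht ↦ hC t (hAB ht)⟩
    · rintro A B ⟨C, hC⟩ ⟨D, hD⟩
      refine ⟨max C D, fun t ht htS ↦ ?_⟩
      rcases ht with ht | ht
      · exact (hC t ht htS).trans (le_max_left _ _)
      · exact (hD t ht htS).trans (le_max_right _ _)
    · intro t₀ ht₀
      have hp := mem_extChartAt_source (I := 𝓘(ℝ, E)) (x t₀)
      obtain ⟨Q, hQ, hQU, hev⟩ := hx.exists_compact_jets hT ht₀ hp
        (isOpen_freeTarget hO (x t₀)) rfl (mem_freeTarget hp (hxO t₀ ht₀))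
      obtain ⟨C, hC⟩ := hQ.exists_bound_of_continuousOn ((hL (x t₀)).continuousOn.mono hQU)
      refine ⟨_, mem_nhdsWithin_of_mem_nhds hev, C, fun t ht htS ↦ ?_⟩
      obtain ⟨hts, htQ⟩ := ht htS
      rw [hx.diff_eq] at htS
      obtain ⟨N, hN, htN, hNsub, hmaps⟩ := hx.exists_isOpen_smooth htS hts
      rw [energyDensity_eq hT σ V hN (hNsub.trans sdiff_subset) (hx.contMDiffOn_diff.mono hNsub)
        hmaps rfl htN]
      exact hC _ htQ
  exact intervalIntegrable_of_continuousOn_of_bound hT hx.finite hcont fun t ht ↦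
    hC t (hx.diff_eq ▸ ht)

end IsSmoothOffFinite

end ObstacleAvoidance
end

/-! ### Variations of a curve within a chart. -/

noncomputable section

set_option maxSynthPendingDepth 3

namespace ObstacleAvoidance

attribute [local instance] isManifold_one

open MeasureTheory

variable {E : Type*} [NormedAddCommGroup E] [NormedSpace ℝ E]
  {M : Type*} [TopologicalSpace M] [ChartedSpace E M] [IsManifold 𝓘(ℝ, E) ∞ M]

open Classical in
/-- The variation of a curve by `η` in the chart at `p`, on the time interval `(a, b)`. -/
def vary (p : M) (a b : ℝ) (x : ℝ → M) (η : ℝ → E) (t : ℝ) : M :=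
  if t ∈ Ioo a b then (extChartAt 𝓘(ℝ, E) p).symm (extChartAt 𝓘(ℝ, E) p (x t) + η t) else x t

section Vary

variable {T : ℝ} {p : M} {a b : ℝ} {x : ℝ → M} {η : ℝ → E}

theorem vary_of_mem {t : ℝ} (ht : t ∈ Ioo a b) : vary p a b x η t =
    (extChartAt 𝓘(ℝ, E) p).symm (extChartAt 𝓘(ℝ, E) p (x t) + η t) := if_pos ht

theorem vary_of_eq_zero (hsrc : MapsTo x (Ioo a b) (extChartAt 𝓘(ℝ, E) p).source) {t : ℝ}
    (ht : η t = 0) : vary p a b x η t = x t := by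
  by_cases h : t ∈ Ioo a b
  · rw [vary_of_mem h, ht, add_zero, (extChartAt 𝓘(ℝ, E) p).left_inv (hsrc h)]
  · exact if_neg h

theorem vary_eventuallyEq (hsrc : MapsTo x (Ioo a b) (extChartAt 𝓘(ℝ, E) p).source) {t : ℝ}
    (ht : t ∉ tsupport η) : vary p a b x η =ᶠ[𝓝 t] x := by
  filter_upwards [(isClosed_tsupport η).isOpen_compl.mem_nhds ht] with r hr
  exact vary_of_eq_zero hsrc (image_eq_zero_of_notMem_tsupport hr)

/-- The interval (a, b) and the complement of the support of η form an open cover of the line. On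
the first the variation is a composite of smooth maps with x, on the second it is x. -/
theorem contMDiffOn_vary (hsrc : MapsTo x (Ioo a b) (extChartAt 𝓘(ℝ, E) p).source)
    (hη : ContDiff ℝ ∞ η) (hsupp : tsupport η ⊆ Ioo a b)
    (hU : ∀ t ∈ Ioo a b, extChartAt 𝓘(ℝ, E) p (x t) + η t ∈ (extChartAt 𝓘(ℝ, E) p).target)
    {n : WithTop ℕ∞} (hn : n ≤ ∞) {s : Set ℝ} (hx : ContMDiffOn 𝓘(ℝ, ℝ) 𝓘(ℝ, E) n x s) :
    ContMDiffOn 𝓘(ℝ, ℝ) 𝓘(ℝ, E) n (vary p a b x η) s := by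
  intro t ht
  by_cases h : t ∈ Ioo a b
  · have h1 : ContMDiffWithinAt 𝓘(ℝ, ℝ) 𝓘(ℝ, E) n
        (fun r ↦ extChartAt 𝓘(ℝ, E) p (x r) + η r) s t :=
      ContDiffWithinAt.contMDiffWithinAt (ContDiffWithinAt.add
        (contMDiffWithinAt_iff_contDiffWithinAt.1 (((contMDiffAt_chart (hsrc h)).of_le
          hn).comp_contMDiffWithinAt t (hx t ht))) (hη.of_le hn).contDiffWithinAt)
    have h2 := ((contMDiffAt_symm (hU t h)).of_le hn).comp_contMDiffWithinAt
      (f := fun r ↦ extChartAt 𝓘(ℝ, E) p (x r) + η r) t h1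
    refine h2.congr_of_eventuallyEq ?_ (vary_of_mem h)
    filter_upwards [mem_nhdsWithin_of_mem_nhds (isOpen_Ioo.mem_nhds h)] with r hr
    exact vary_of_mem hr
  · have h' := vary_eventuallyEq (p := p) hsrc fun hc ↦ h (hsupp hc)
    exact (hx t ht).congr_of_eventuallyEq (h'.filter_mono nhdsWithin_le_nhds) h'.self_of_nhds

theorem velocityLift_congr {y : ℝ → M} {t : ℝ} (h : x =ᶠ[𝓝 t] y) :
    velocityLift (E := E) T x t = velocityLift T y t := by
  have h1 : x t = y t := h.self_of_nhds
  have h2 := (h.filter_mono (nhdsWithin_le_nhds (s := Icc 0 T))).mfderivWithin_eq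
    (I := 𝓘(ℝ, ℝ)) (I' := 𝓘(ℝ, E)) h1
  exact TotalSpace.ext h1 (heq_of_eq (DFunLike.congr_fun h2 (1 : ℝ)))

/-- A continuous map applied to a vector that is explicit in η and η': this form makes continuity in
the variation parameter visible. -/
theorem velocityLift_vary (hsrc : MapsTo x (Ioo a b) (extChartAt 𝓘(ℝ, E) p).source)
    (hη : ContDiff ℝ ∞ η)
    (hU : ∀ t ∈ Ioo a b, extChartAt 𝓘(ℝ, E) p (x t) + η t ∈ (extChartAt 𝓘(ℝ, E) p).target)
    (hab : Ioo a b ⊆ Ioo 0 T) (hx : ContMDiffOn 𝓘(ℝ, ℝ) 𝓘(ℝ, E) 1 x (Icc 0 T)) {t : ℝ}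
    (ht : t ∈ Ioo a b) :
    velocityLift (E := E) T (vary p a b x η) t =
      tangentMapWithin 𝓘(ℝ, E) 𝓘(ℝ, E) (extChartAt 𝓘(ℝ, E) p).symm (extChartAt 𝓘(ℝ, E) p).target
        ⟨extChartAt 𝓘(ℝ, E) p (x t) + η t,
          deriv (fun r ↦ extChartAt 𝓘(ℝ, E) p (x r)) t + deriv η t⟩ := by
  have hev : vary p a b x η =ᶠ[𝓝 t]
      fun r ↦ (extChartAt 𝓘(ℝ, E) p).symm (extChartAt 𝓘(ℝ, E) p (x r) + η r) := by
    filter_upwards [isOpen_Ioo.mem_nhds ht] with r hr using vary_of_mem hr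
  have hI : Icc 0 T ∈ 𝓝 t := Icc_mem_nhds (hab ht).1 (hab ht).2
  have hxt : MDifferentiableAt 𝓘(ℝ, ℝ) 𝓘(ℝ, E) x t :=
    (hx.contMDiffAt hI).mdifferentiableAt (by simp)
  have hd1 : DifferentiableAt ℝ (fun r ↦ extChartAt 𝓘(ℝ, E) p (x r)) t :=
    ((mdifferentiableAt_chart (hsrc ht)).comp t hxt).differentiableAt
  have hd2 : DifferentiableAt ℝ η t := hη.differentiable (by simp) t
  rw [velocityLift_congr hev, velocityLift, velocity, mfderivWithin_of_mem_nhds hI]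
  simp only [tangentMapWithin]
  rw [mfderivWithin_of_isOpen (isOpen_target p) (hU t ht)]
  have h := mfderiv_comp (I := 𝓘(ℝ, ℝ)) t (mdifferentiableAt_symm (hU t ht))
    (hd1.add hd2).mdifferentiableAt
  have h' := DFunLike.congr_fun h (1 : ℝ)
  have hd : mfderiv 𝓘(ℝ, ℝ) 𝓘(ℝ, E) ((fun r ↦ extChartAt 𝓘(ℝ, E) p (x r)) + η) t (1 : ℝ) =
      deriv (fun r ↦ extChartAt 𝓘(ℝ, E) p (x r)) t + deriv η t := by
    rw [mfderiv_eq_fderiv]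
    exact (hd1.hasDerivAt.add hd2.hasDerivAt).deriv
  exact TotalSpace.ext rfl (heq_of_eq (h'.trans (congrArg (mfderiv 𝓘(ℝ, E) 𝓘(ℝ, E)
    (extChartAt 𝓘(ℝ, E) p).symm (extChartAt 𝓘(ℝ, E) p (x t) + η t)) hd)))

end Vary

namespace AdmissibleCurve

variable {T : ℝ} {hT : 0 < T} {P₀ P₁ : TangentBundle 𝓘(ℝ, E) M} {O : Set M}

theorem ext_curve {x y : AdmissibleCurve hT P₀ P₁ O} (h : x.curve = y.curve) : x = y := by
  cases x; cases y; cases h; rfl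

/-- The variation of an admissible curve. -/
def varied (x : AdmissibleCurve hT P₀ P₁ O) {p : M} {a b : ℝ} (hab : Ioo a b ⊆ Ioo 0 T)
    (hsrc : MapsTo x.curve (Ioo a b) (extChartAt 𝓘(ℝ, E) p).source) {η : ℝ → E}
    (hη : ContDiff ℝ ∞ η) (hsupp : tsupport η ⊆ Ioo a b)
    (hU : ∀ t ∈ Ioo a b, extChartAt 𝓘(ℝ, E) p (x.curve t) + η t ∈ freeTarget O p) :
    AdmissibleCurve hT P₀ P₁ O where
  curve := vary p a b x.curve η
  regular := by
    obtain ⟨h1, l, s, hs, h0, hl, hsm⟩ := x.regular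
    exact ⟨contMDiffOn_vary hsrc hη hsupp (fun t ht ↦ (hU t ht).1) (by simp) h1, l, s, hs, h0, hl,
      fun i ↦ contMDiffOn_vary hsrc hη hsupp (fun t ht ↦ (hU t ht).1) le_rfl (hsm i)⟩
  start := (velocityLift_congr (vary_eventuallyEq hsrc fun h ↦
    lt_irrefl _ (hab (hsupp h)).1)).trans x.start
  finish := (velocityLift_congr (vary_eventuallyEq hsrc fun h ↦
    lt_irrefl _ (hab (hsupp h)).2)).trans x.finish
  avoids t ht := by
    by_cases h : t ∈ Ioo a b
    · rw [vary_of_mem h]; exact (hU t h).2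
    · rw [vary_of_eq_zero hsrc (image_eq_zero_of_notMem_tsupport fun hc ↦ h (hsupp hc))]
      exact x.avoids t ht

theorem tsupport_const_smul_subset {η : ℝ → E} (r : ℝ) :
    tsupport (fun t ↦ r • η t) ⊆ tsupport η :=
  closure_mono (Function.support_const_smul_subset r η)

/-- A linear variation depends continuously on its parameter, in the `C¹` topology. -/
theorem continuous_varied (x : AdmissibleCurve hT P₀ P₁ O) {p : M} {a b : ℝ}
    (hab : Ioo a b ⊆ Ioo 0 T)
    (hsrc : MapsTo x.curve (Ioo a b) (extChartAt 𝓘(ℝ, E) p).source) {η : ℝ → E}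
    (hη : ContDiff ℝ ∞ η) (hsupp : tsupport η ⊆ Ioo a b) {R : Set ℝ}
    (hU : ∀ r ∈ R, ∀ t ∈ Ioo a b, extChartAt 𝓘(ℝ, E) p (x.curve t) + r • η t ∈ freeTarget O p) :
    Continuous fun r : R ↦ x.varied hab hsrc (hη.const_smul r.1)
      ((tsupport_const_smul_subset r.1).trans hsupp) (hU r.1 r.2) := by
  -- For the compact-open topology, joint continuity of the lift in (r, t) suffices.
  refine continuous_induced_rng.2 (ContinuousMap.continuous_of_continuous_uncurry _ ?_)
  rw [continuous_iff_continuousAt]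
  rintro ⟨r₀, t₀⟩
  show ContinuousAt (fun q : R × Icc (0 : ℝ) T ↦
    velocityLift (E := E) T (vary p a b x.curve fun t ↦ q.1.1 • η t) q.2.1) (r₀, t₀)
  by_cases h : t₀.1 ∈ Ioo a b
  · have hnear : ∀ᶠ q : R × Icc (0 : ℝ) T in 𝓝 (r₀, t₀), q.2.1 ∈ Ioo a b :=
      (continuous_subtype_val.comp continuous_snd).continuousAt.eventually (isOpen_Ioo.mem_nhds h)
    have hev : (fun q : R × Icc (0 : ℝ) T ↦
        velocityLift (E := E) T (vary p a b x.curve fun t ↦ q.1.1 • η t) q.2.1) =ᶠ[𝓝 (r₀, t₀)]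
        fun q ↦ tangentMapWithin 𝓘(ℝ, E) 𝓘(ℝ, E) (extChartAt 𝓘(ℝ, E) p).symm
          (extChartAt 𝓘(ℝ, E) p).target
          ((tangentBundleModelSpaceHomeomorph 𝓘(ℝ, E)).symm
            (extChartAt 𝓘(ℝ, E) p (x.curve q.2.1) + q.1.1 • η q.2.1,
            deriv (fun r ↦ extChartAt 𝓘(ℝ, E) p (x.curve r)) q.2.1 + q.1.1 • deriv η q.2.1)) := by
      filter_upwards [hnear] with q hq
      rw [velocityLift_vary hsrc (hη.const_smul q.1.1) (fun t ht ↦ (hU q.1.1 q.1.2 t ht).1) hab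
        x.regular.1 hq]
      rw [deriv_fun_const_smul _ (hη.differentiable (by simp) _)]
      rfl
    refine ContinuousAt.congr ?_ hev.symm
    have hξ : ContDiffOn ℝ 1 (fun r ↦ extChartAt 𝓘(ℝ, E) p (x.curve r)) (Ioo a b) :=
      contDiffOn_chart_comp (by simp)
        (x.regular.1.mono (hab.trans Ioo_subset_Icc_self)) hsrc
    have hξ' := hξ.continuousOn_deriv_of_isOpen isOpen_Ioo le_rfl
    have hc2 : ContinuousAt (fun q : R × Icc (0 : ℝ) T ↦ q.2.1) (r₀, t₀) :=
      (continuous_subtype_val.comp continuous_snd).continuousAt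
    have hc1 : ContinuousAt (fun q : R × Icc (0 : ℝ) T ↦ q.1.1) (r₀, t₀) :=
      (continuous_subtype_val.comp continuous_fst).continuousAt
    have ht0 := isOpen_Ioo.mem_nhds h
    have e1 : ContinuousAt (fun q : R × Icc (0 : ℝ) T ↦
        extChartAt 𝓘(ℝ, E) p (x.curve q.2.1) + q.1.1 • η q.2.1) (r₀, t₀) :=
      (ContinuousAt.comp (f := fun q : R × Icc (0 : ℝ) T ↦ q.2.1)
        (g := fun r ↦ extChartAt 𝓘(ℝ, E) p (x.curve r)) (hξ.continuousOn.continuousAt ht0) hc2).add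
        (hc1.smul (hη.continuous.continuousAt.comp hc2))
    have e2 : ContinuousAt (fun q : R × Icc (0 : ℝ) T ↦
        deriv (fun r ↦ extChartAt 𝓘(ℝ, E) p (x.curve r)) q.2.1 + q.1.1 • deriv η q.2.1)
        (r₀, t₀) :=
      (ContinuousAt.comp (f := fun q : R × Icc (0 : ℝ) T ↦ q.2.1) (hξ'.continuousAt ht0) hc2).add
        (hc1.smul ((hη.continuous_deriv (by simp)).continuousAt.comp hc2))
    have e3 := (tangentBundleModelSpaceHomeomorph 𝓘(ℝ, E)).symm.continuous.continuousAt.comp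
      (e1.prodMk e2)
    refine ContinuousAt.comp (g := tangentMapWithin 𝓘(ℝ, E) 𝓘(ℝ, E)
      (extChartAt 𝓘(ℝ, E) p).symm (extChartAt 𝓘(ℝ, E) p).target)
      (f := fun q : R × Icc (0 : ℝ) T ↦ (tangentBundleModelSpaceHomeomorph 𝓘(ℝ, E)).symm
        (extChartAt 𝓘(ℝ, E) p (x.curve q.2.1) + q.1.1 • η q.2.1,
        deriv (fun r ↦ extChartAt 𝓘(ℝ, E) p (x.curve r)) q.2.1 + q.1.1 • deriv η q.2.1)) ?_ e3
    have h4 := (contMDiffOn_extChartAt_symm (I := 𝓘(ℝ, E)) (n := ∞) p).continuousOn_tangentMapWithin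
      (by simp) (isOpen_target p).uniqueMDiffOn
    refine h4.continuousAt ?_
    refine (FiberBundle.continuous_proj E (TangentSpace 𝓘(ℝ, E))).continuousAt.preimage_mem_nhds ?_
    exact (isOpen_target p).mem_nhds (hU r₀.1 r₀.2 _ h).1
  · have hts : t₀.1 ∈ (tsupport η)ᶜ := fun hc ↦ h (hsupp hc)
    have hopen : IsOpen (tsupport η)ᶜ := (isClosed_tsupport η).isOpen_compl
    have hnear : ∀ᶠ q : R × Icc (0 : ℝ) T in 𝓝 (r₀, t₀), q.2.1 ∈ (tsupport η)ᶜ :=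
      (continuous_subtype_val.comp continuous_snd).continuousAt.eventually (hopen.mem_nhds hts)
    have hev : (fun q : R × Icc (0 : ℝ) T ↦
        velocityLift (E := E) T (vary p a b x.curve fun t ↦ q.1.1 • η t) q.2.1) =ᶠ[𝓝 (r₀, t₀)]
        fun q ↦ x.lift q.2 := by
      filter_upwards [hnear] with q hq
      exact velocityLift_congr (vary_eventuallyEq hsrc fun hc ↦
        hq (tsupport_const_smul_subset _ hc))
    exact ContinuousAt.congr (x.lift.continuous.comp continuous_snd).continuousAt hev.symm

end AdmissibleCurve

end ObstacleAvoidance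
end

/-! ### First variation of the energy, and the Euler-Lagrange equation of a minimizer. -/

noncomputable section

set_option maxSynthPendingDepth 3

namespace ObstacleAvoidance

attribute [local instance] isManifold_one

open MeasureTheory

variable {E : Type*} [NormedAddCommGroup E] [NormedSpace ℝ E] [FiniteDimensional ℝ E]
  {M : Type*} [TopologicalSpace M] [ChartedSpace E M] [IsManifold 𝓘(ℝ, E) ∞ M]
  [RiemannianBundle (fun p : M ↦ TangentSpace 𝓘(ℝ, E) p)]
  [IsContMDiffRiemannianBundle 𝓘(ℝ, E) ∞ E (fun p : M ↦ TangentSpace 𝓘(ℝ, E) p)]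
  {T σ : ℝ} {V : M → ℝ} {O : Set M}

/-- In the chart at x t both densities are the same function of the 2-jet at t. Thus a variation
changes the energy only where it moves the curve. -/
theorem energyDensity_congr (hT : 0 < T) {x y : ℝ → M} {S : Set ℝ}
    (hx : IsSmoothOffFinite (E := E) T x S) {t : ℝ} (ht : t ∈ Ioo 0 T \ S) (h : x =ᶠ[𝓝 t] y) :
    energyDensity (E := E) T σ V x t = energyDensity (E := E) T σ V y t := by
  obtain ⟨N₁, hN₁, htN₁, hsub, hmaps⟩ :=
    hx.exists_isOpen_smooth ht (mem_extChartAt_source (I := 𝓘(ℝ, E)) (x t))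
  obtain ⟨N₂, hN₂, hN₂o, htN₂⟩ := mem_nhds_iff.1 h
  have hN := hN₁.inter hN₂o
  have htN : t ∈ N₁ ∩ N₂ := ⟨htN₁, htN₂⟩
  have hxy : ∀ r ∈ N₁ ∩ N₂, y r = x r := fun r hr ↦ (hN₂ hr.2).symm
  have hxs := hx.contMDiffOn_diff.mono (inter_subset_left.trans hsub : N₁ ∩ N₂ ⊆ _)
  have hNT : N₁ ∩ N₂ ⊆ Ioo 0 T := inter_subset_left.trans (hsub.trans sdiff_subset)
  have hm : MapsTo x (N₁ ∩ N₂) (extChartAt 𝓘(ℝ, E) (x t)).source := hmaps.mono_left inter_subset_left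
  rw [energyDensity_eq hT σ V hN hNT hxs hm rfl htN,
    energyDensity_eq hT σ V hN hNT (hxs.congr hxy) (p := x t)
      (fun r hr ↦ by rw [hxy r hr]; exact hm hr) rfl htN]
  have h1 : (fun r ↦ extChartAt 𝓘(ℝ, E) (x t) (x r)) =ᶠ[𝓝 t]
      fun r ↦ extChartAt 𝓘(ℝ, E) (x t) (y r) := h.fun_comp _
  rw [h1.deriv.deriv_eq, h1.deriv_eq]
  simp only [h.self_of_nhds]

section Weak

variable {hT : 0 < T} {P₀ P₁ : TangentBundle 𝓘(ℝ, E) M}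

/-- The image of the support of η is compact in U, hence has a δ-thickening in U; off the support
nothing moves. -/
theorem exists_radius {U : Set E} (hU : IsOpen U) {a b : ℝ} {ξ η : ℝ → E}
    (hξ : ContinuousOn ξ (Ioo a b)) (hξU : MapsTo ξ (Ioo a b) U) (hη : Continuous η)
    (hc : HasCompactSupport η) (hsupp : tsupport η ⊆ Ioo a b) :
    ∃ ε : ℝ, 0 < ε ∧ ∀ r ∈ Ioo (-ε) ε, ∀ t ∈ Ioo a b, ξ t + r • η t ∈ U := by
  have hK : IsCompact (ξ '' tsupport η) := IsCompact.image_of_continuousOn hc (hξ.mono hsupp)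
  obtain ⟨δ, hδ, hδU⟩ := hK.exists_cthickening_subset_open hU
    (image_subset_iff.2 fun t ht ↦ hξU (hsupp ht))
  obtain ⟨B, hB⟩ := hc.exists_bound_of_continuous hη
  have hB0 : 0 ≤ B := (norm_nonneg _).trans (hB 0)
  refine ⟨δ / (B + 1), by positivity, fun r hr t ht ↦ ?_⟩
  by_cases h : t ∈ tsupport η
  · refine hδU (Metric.mem_cthickening_of_dist_le _ (ξ t) _ _ (mem_image_of_mem _ h) ?_)
    rw [dist_eq_norm, add_sub_cancel_left, norm_smul, Real.norm_eq_abs]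
    have h1 := abs_lt.2 hr
    rw [lt_div_iff₀ (by linarith)] at h1
    nlinarith [abs_nonneg r, hB t, norm_nonneg (η t)]
  · rw [image_eq_zero_of_notMem_tsupport h, smul_zero, add_zero]
    exact hξU ht

/-- The energy of a varied curve, read in a chart. -/
theorem energy_vary (hT : 0 < T) {x : ℝ → M} {S : Set ℝ}
    (hx : IsSmoothOffFinite (E := E) T x S) {p : M} {a b : ℝ} (hlt : a < b)
    (hab : Ioo a b ⊆ Ioo 0 T) (hsrc : MapsTo x (Ioo a b) (extChartAt 𝓘(ℝ, E) p).source) {η : ℝ → E}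
    (hη : ContDiff ℝ ∞ η) (hsupp : tsupport η ⊆ Ioo a b)
    (hU : ∀ t ∈ Ioo a b, extChartAt 𝓘(ℝ, E) p (x t) + η t ∈ (extChartAt 𝓘(ℝ, E) p).target)
    (hi : IntervalIntegrable (energyDensity (E := E) T σ V x) volume 0 T)
    (hi' : IntervalIntegrable (energyDensity (E := E) T σ V (vary p a b x η)) volume 0 T)
    {ξ : ℝ → E} (hξ : ξ = fun r ↦ extChartAt 𝓘(ℝ, E) p (x r)) :
    (∫ t in (0 : ℝ)..T, energyDensity (E := E) T σ V (vary p a b x η) t)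
      - ∫ t in (0 : ℝ)..T, energyDensity (E := E) T σ V x t =
    ∫ t in a..b, (lagrangian (chartMetric p) σ (V ∘ (extChartAt 𝓘(ℝ, E) p).symm)
        ((ξ t, deriv ξ t, deriv (deriv ξ) t) + (η t, deriv η t, deriv (deriv η) t))
      - lagrangian (chartMetric p) σ (V ∘ (extChartAt 𝓘(ℝ, E) p).symm)
        (ξ t, deriv ξ t, deriv (deriv ξ) t)) := by
  have hcl : Icc a b ⊆ Icc 0 T := by
    rw [← closure_Ioo hlt.ne, ← closure_Ioo hT.ne]
    exact closure_mono hab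
  have ha := hcl (left_mem_Icc.2 hlt.le)
  have hb := hcl (right_mem_Icc.2 hlt.le)
  rw [← intervalIntegral.integral_sub hi' hi]
  set f := fun t ↦ energyDensity (E := E) T σ V (vary p a b x η) t
    - energyDensity (E := E) T σ V x t with hf
  have hfi : IntervalIntegrable f volume 0 T := hi'.sub hi
  have hsubs : ∀ c ∈ Icc 0 T, ∀ d ∈ Icc 0 T, IntervalIntegrable f volume c d := fun c hc d hd ↦
    hfi.mono_set (uIcc_subset_uIcc (by rwa [uIcc_of_le hT.le]) (by rwa [uIcc_of_le hT.le]))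
  have h0 : (0 : ℝ) ∈ Icc 0 T := left_mem_Icc.2 hT.le
  have h1 : T ∈ Icc 0 T := right_mem_Icc.2 hT.le
  -- Besides S, the points T and b are discarded because interval integrals run over half-open
  -- intervals that keep their right end.
  have hae : ∀ᵐ t : ℝ, t ∉ S ∪ {T, b} :=
    measure_eq_zero_iff_ae_notMem.1
      ((hx.finite.union ((finite_singleton b).insert T)).measure_zero volume)
  have hout : ∀ t ∈ Ioo 0 T \ S, t ∉ Ioo a b → f t = 0 := by
    intro t ht hn
    have := energyDensity_congr (σ := σ) (V := V) hT hx ht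
      (vary_eventuallyEq (p := p) hsrc fun h ↦ hn (hsupp h)).symm
    simp only [hf, this, sub_self]
  rw [← intervalIntegral.integral_add_adjacent_intervals (hsubs 0 h0 a ha) (hsubs a ha T h1),
    ← intervalIntegral.integral_add_adjacent_intervals (hsubs a ha b hb) (hsubs b hb T h1)]
  have e1 : ∫ t in (0 : ℝ)..a, f t = 0 := by
    rw [intervalIntegral.integral_congr_ae (g := fun _ ↦ 0)]
    · simp
    · filter_upwards [hae] with t ht ht'
      rw [uIoc_of_le ha.1] at ht'
      simp only [mem_union, mem_insert_iff, mem_singleton_iff, not_or] at ht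
      exact hout t ⟨⟨ht'.1, (ht'.2.trans ha.2).lt_of_ne ht.2.1⟩, ht.1⟩ fun h ↦
        not_lt.2 ht'.2 h.1
  have e2 : ∫ t in b..T, f t = 0 := by
    rw [intervalIntegral.integral_congr_ae (g := fun _ ↦ 0)]
    · simp
    · filter_upwards [hae] with t ht ht'
      rw [uIoc_of_le hb.2] at ht'
      simp only [mem_union, mem_insert_iff, mem_singleton_iff, not_or] at ht
      exact hout t ⟨⟨hb.1.trans_lt ht'.1, ht'.2.lt_of_ne ht.2.1⟩, ht.1⟩ fun h ↦
        not_lt.2 ht'.1.le h.2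
  rw [e1, e2, zero_add, add_zero]
  refine intervalIntegral.integral_congr_ae ?_
  filter_upwards [hae] with t ht ht'
  rw [uIoc_of_le hlt.le] at ht'
  simp only [mem_union, mem_insert_iff, mem_singleton_iff, not_or] at ht
  have htI : t ∈ Ioo a b := ⟨ht'.1, ht'.2.lt_of_ne ht.2.2⟩
  set N := Ioo a b \ S with hN_def
  have htN : t ∈ N := ⟨htI, ht.1⟩
  have hN : IsOpen N := isOpen_Ioo.sdiff hx.finite.isClosed
  have hNT : N ⊆ Ioo 0 T := sdiff_subset.trans hab
  have hxN := hx.contMDiffOn_diff.mono (sdiff_subset_sdiff_left hab : N ⊆ _)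
  have hm : MapsTo x N (extChartAt 𝓘(ℝ, E) p).source := hsrc.mono_left sdiff_subset
  have hm' : MapsTo (vary p a b x η) N (extChartAt 𝓘(ℝ, E) p).source := fun r hr ↦ by
    rw [vary_of_mem hr.1]; exact (extChartAt 𝓘(ℝ, E) p).map_target (hU r hr.1)
  simp only [hf]
  rw [energyDensity_eq hT σ V hN hNT hxN hm hξ htN, energyDensity_eq hT σ V hN hNT
    (contMDiffOn_vary hsrc hη hsupp hU le_rfl hxN) hm' rfl htN]
  have hsum : ∀ r ∈ N, extChartAt 𝓘(ℝ, E) p (vary p a b x η r) = ξ r + η r := fun r hr ↦ by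
    rw [vary_of_mem hr.1, (extChartAt 𝓘(ℝ, E) p).right_inv (hU r hr.1), hξ]
  have hξN : ContDiffOn ℝ ∞ ξ N := by rw [hξ]; exact contDiffOn_chart_comp le_rfl hxN hm
  have hξN' : ContDiffOn ℝ ∞ (deriv ξ) N := hξN.deriv_of_isOpen hN (by simp)
  have hd1 : ∀ r ∈ N, deriv (fun r ↦ extChartAt 𝓘(ℝ, E) p (vary p a b x η r)) r =
      deriv ξ r + deriv η r := by
    intro r hr
    have : (fun r ↦ extChartAt 𝓘(ℝ, E) p (vary p a b x η r)) =ᶠ[𝓝 r] fun r ↦ ξ r + η r := by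
      filter_upwards [hN.mem_nhds hr] with q hq using hsum q hq
    rw [this.deriv_eq, deriv_fun_add
      ((hξN.contDiffAt (hN.mem_nhds hr)).differentiableAt (by simp))
      (hη.differentiable (by simp) r)]
  have hd2 : deriv (deriv (fun r ↦ extChartAt 𝓘(ℝ, E) p (vary p a b x η r))) t =
      deriv (deriv ξ) t + deriv (deriv η) t := by
    have : deriv (fun r ↦ extChartAt 𝓘(ℝ, E) p (vary p a b x η r)) =ᶠ[𝓝 t]
        fun r ↦ deriv ξ r + deriv η r := by
      filter_upwards [hN.mem_nhds htN] with q hq using hd1 q hq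
    rw [this.deriv_eq, deriv_fun_add
      ((hξN'.contDiffAt (hN.mem_nhds htN)).differentiableAt (by simp))
      ((contDiff_infty_iff_deriv.1 hη).2.differentiable (by simp) t)]
  rw [hsum t htN, hd1 t htN, hd2]
  rfl

/-- The weak form of the Euler-Lagrange equation for a local minimizer. -/
theorem integral_fderiv_lagrangian_eq_zero (hO : IsClosed O)
    (hV : ContMDiffOn 𝓘(ℝ, E) 𝓘(ℝ, ℝ) ∞ V Oᶜ) {x : AdmissibleCurve hT P₀ P₁ O}
    (hx : IsLocalMin (AdmissibleCurve.energy σ V) x) {S : Set ℝ}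
    (hS : IsSmoothOffFinite (E := E) T x.curve S) {p : M} {a b : ℝ} (hlt : a < b)
    (hab : Ioo a b ⊆ Ioo 0 T) (hsrc : MapsTo x.curve (Ioo a b) (extChartAt 𝓘(ℝ, E) p).source)
    {ξ : ℝ → E} (hξ : ξ = fun r ↦ extChartAt 𝓘(ℝ, E) p (x.curve r))
    {Q : Set (E × E × E)} (hQ : IsCompact Q) (hQU : Q ⊆ freeTarget (E := E) O p ×ˢ univ)
    (hzQ : ∀ t ∈ Ioo a b \ S, (ξ t, deriv ξ t, deriv (deriv ξ) t) ∈ Q)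
    {φ : ℝ → ℝ} (hφ : IsTestFunction a b φ) (e : E) :
    ∫ t in a..b, fderiv ℝ (lagrangian (chartMetric p) σ (V ∘ (extChartAt 𝓘(ℝ, E) p).symm))
      (ξ t, deriv ξ t, deriv (deriv ξ) t) (φ t • e, deriv φ t • e, deriv (deriv φ) t • e) = 0 := by
  set L := lagrangian (chartMetric p) σ (V ∘ (extChartAt 𝓘(ℝ, E) p).symm) with hLdef
  have hL : ContDiffOn ℝ ∞ L (freeTarget (E := E) O p ×ˢ univ) :=
    (IsSmoothOffFinite.isLocalMetric_freeTarget hO p).contDiffOn_lagrangian σ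
      (contDiffOn_potential hV p)
  have hW : IsOpen (freeTarget (E := E) O p ×ˢ (univ : Set (E × E))) :=
    (isOpen_freeTarget hO p).prod isOpen_univ
  have hxO : ∀ t ∈ Icc 0 T, x.curve t ∉ O := x.avoids
  set η : ℝ → E := fun t ↦ φ t • e with hη_def
  have hη : ContDiff ℝ ∞ η := hφ.contDiff.smul contDiff_const
  have hηt : tsupport η ⊆ tsupport φ := closure_mono (Function.support_smul_subset_left φ _)
  have hsupp : tsupport η ⊆ Ioo a b := hηt.trans hφ.tsupport_subset
  have hηc : HasCompactSupport η := hφ.hasCompactSupport.smul_right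
  have hη1 : deriv η = fun t ↦ deriv φ t • e := funext fun t ↦
    ((hφ.hasDerivAt t).smul_const e).deriv
  have hη2 : deriv (deriv η) = fun t ↦ deriv (deriv φ) t • e := by
    rw [hη1]; exact funext fun t ↦ ((hφ.derivative.hasDerivAt t).smul_const e).deriv
  have hξ1 : ContDiffOn ℝ 1 ξ (Ioo a b) := by
    rw [hξ]
    exact contDiffOn_chart_comp (by simp) (x.regular.1.mono (hab.trans Ioo_subset_Icc_self)) hsrc
  have hξU : MapsTo ξ (Ioo a b) (freeTarget (E := E) O p) := fun t ht ↦ by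
    rw [hξ]; exact mem_freeTarget (hsrc ht) (hxO t (Ioo_subset_Icc_self (hab ht)))
  obtain ⟨ε, hε, hεU⟩ := exists_radius (isOpen_freeTarget hO p) hξ1.continuousOn hξU hη.continuous
    hηc hsupp
  rw [hξ] at hεU
  set X : Ioo (-ε) ε → AdmissibleCurve hT P₀ P₁ O := fun r ↦ x.varied hab hsrc
    (hη.const_smul r.1) ((AdmissibleCurve.tsupport_const_smul_subset r.1).trans hsupp)
    (hεU r.1 r.2) with hX
  have hXc : Continuous X := x.continuous_varied hab hsrc hη hsupp hεU
  have h0 : (0 : ℝ) ∈ Ioo (-ε) ε := ⟨by linarith, hε⟩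
  have hX0 : X ⟨0, h0⟩ = x := AdmissibleCurve.ext_curve (funext fun t ↦
    vary_of_eq_zero (η := (0 : ℝ) • η) hsrc (by simp))
  set z : ℝ → E × E × E := fun t ↦ (ξ t, deriv ξ t, deriv (deriv ξ) t) with hz
  set ζ : ℝ → E × E × E := fun t ↦ (η t, deriv η t, deriv (deriv η) t) with hζ_def
  have hζ : Continuous ζ := by
    rw [hζ_def, hη2, hη1]
    exact hη.continuous.prodMk ((hφ.derivative.continuous.smul continuous_const).prodMk
      (hφ.derivative.derivative.continuous.smul continuous_const))
  have hζc : HasCompactSupport ζ := by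
    refine HasCompactSupport.intro hηc fun t ht ↦ ?_
    have h1 : η =ᶠ[𝓝 t] fun _ ↦ 0 := by
      filter_upwards [(isClosed_tsupport η).isOpen_compl.mem_nhds ht] with r hr using
        image_eq_zero_of_notMem_tsupport hr
    simp only [hζ_def, h1.deriv.deriv_eq, h1.deriv_eq, h1.self_of_nhds]
    simp
  obtain ⟨B, hB⟩ := hζc.exists_bound_of_continuous hζ
  have hNopen : IsOpen (Ioo a b \ S) := isOpen_Ioo.sdiff hS.finite.isClosed
  have hzc : ContinuousOn z (Ioo a b \ S) := by
    refine IsSmoothOffFinite.continuousOn_jets hNopen ?_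
    rw [hξ]
    exact contDiffOn_chart_comp le_rfl
      (hS.contMDiffOn_diff.mono (sdiff_subset_sdiff_left hab)) (hsrc.mono_left sdiff_subset)
  have hder := hasDerivAt_integral_variation hW (hL.of_le (by simp)) hlt hS.finite hzc hζ hB hQ hQU
    hzQ
  have hint : ∀ y : AdmissibleCurve hT P₀ P₁ O,
      IntervalIntegrable (energyDensity (E := E) T σ V y.curve) volume 0 T := by
    intro y
    obtain ⟨h1, l, s, hs, hs0, hsl, hsm⟩ := y.regular
    exact (isSmoothOffFinite_range hs hs0 hsl h1 hsm).intervalIntegrable_energyDensity hT hO hV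
      y.avoids σ
  have hdiff : ∀ r : Ioo (-ε) ε, AdmissibleCurve.energy σ V (X r) =
      AdmissibleCurve.energy σ V x + ∫ t in a..b, (L (z t + r.1 • ζ t) - L (z t)) := by
    intro r
    have h1 := energy_vary (σ := σ) (V := V) hT hS hlt hab hsrc (hη.const_smul r.1)
      ((AdmissibleCurve.tsupport_const_smul_subset r.1).trans hsupp)
      (fun t ht ↦ (hεU r.1 r.2 t ht).1) (hint x) (hint (X r)) hξ
    have h2 : ∀ t, ((r.1 • η) t, deriv (r.1 • η) t, deriv (deriv (r.1 • η)) t) = r.1 • ζ t := by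
      intro t
      have e1 : deriv (r.1 • η) = r.1 • deriv η := funext fun t ↦
        deriv_const_smul _ (hη.differentiable (by simp) t)
      have e2 : deriv (r.1 • deriv η) t = r.1 • deriv (deriv η) t :=
        deriv_const_smul _ ((contDiff_infty_iff_deriv.1 hη).2.differentiable (by simp) t)
      rw [e1, e2]; rfl
    have h3 : AdmissibleCurve.energy σ V (X r) - AdmissibleCurve.energy σ V x =
        ∫ t in a..b, (L (z t + r.1 • ζ t) - L (z t)) := by
      refine h1.trans ?_
      congr 1
      funext t
      exact congrArg (fun w ↦ L (z t + w) - L (z t)) (h2 t)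
    linarith
  -- Continuity of X into the C¹ topology pulls local minimality back to the parameter r.
  have hmin : IsLocalMin (fun r : ℝ ↦ ∫ t in a..b, (L (z t + r • ζ t) - L (z t))) 0 := by
    have h1 : IsLocalMin (AdmissibleCurve.energy σ V) (X ⟨0, h0⟩) := by rwa [hX0]
    have h2 := h1.comp_continuous (b := (⟨0, h0⟩ : Ioo (-ε) ε)) hXc.continuousAt
    rw [IsLocalMin, IsMinFilter, nhds_subtype_eq_comap, Filter.eventually_comap] at h2
    filter_upwards [h2, isOpen_Ioo.mem_nhds h0] with r hr hrI
    have h3 := hr ⟨r, hrI⟩ rfl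
    simp only [Function.comp_apply, hdiff] at h3
    linarith
  have := hmin.hasDerivAt_eq_zero hder
  rw [← this]
  congr 1
  funext t
  simp only [hζ_def, hη2]
  simp only [hη1]
  rfl

/-- Near an interior time, a local minimizer is smooth and solves the Euler-Lagrange equation, in
the form given by any chart. -/
theorem exists_smooth_extremal (hO : IsClosed O)
    (hV : ContMDiffOn 𝓘(ℝ, E) 𝓘(ℝ, ℝ) ∞ V Oᶜ) {x : AdmissibleCurve hT P₀ P₁ O}
    (hx : IsLocalMin (AdmissibleCurve.energy σ V) x) {t₁ : ℝ} (ht₁ : t₁ ∈ Ioo 0 T) {p : M}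
    (hp : x.curve t₁ ∈ (extChartAt 𝓘(ℝ, E) p).source)
    {ξ : ℝ → E} (hξ : ξ = fun r ↦ extChartAt 𝓘(ℝ, E) p (x.curve r)) :
    ContMDiffAt 𝓘(ℝ, ℝ) 𝓘(ℝ, E) ∞ x.curve t₁ ∧
    covAlong (chartMetric p) ξ (covAlong (chartMetric p) ξ
        (covAlong (chartMetric p) ξ (deriv ξ))) t₁
      + localCurvature (chartMetric p) (ξ t₁) (covAlong (chartMetric p) ξ (deriv ξ) t₁) (deriv ξ t₁)
          (deriv ξ t₁)
      - σ • covAlong (chartMetric p) ξ (deriv ξ) t₁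
      + (1 / 2 : ℝ) • (chartMetric p (ξ t₁)).inverse
          (fderiv ℝ (V ∘ (extChartAt 𝓘(ℝ, E) p).symm) (ξ t₁)) = 0 := by
  obtain ⟨S, hS⟩ : ∃ S, IsSmoothOffFinite (E := E) T x.curve S := by
    obtain ⟨h1, l, s, hs, hs0, hsl, hsm⟩ := x.regular
    exact ⟨_, isSmoothOffFinite_range hs hs0 hsl h1 hsm⟩
  have ht₁' := Ioo_subset_Icc_self ht₁
  have hfree := isOpen_freeTarget (E := E) hO p
  have hg := IsSmoothOffFinite.isLocalMetric_freeTarget (E := E) hO p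
  have hVp := contDiffOn_potential hV p
  obtain ⟨Q, hQ, hQU, hev⟩ := hS.exists_compact_jets hT ht₁' hp hfree hξ
    (by rw [hξ]; exact mem_freeTarget hp (x.avoids t₁ ht₁'))
  have hcont : ContinuousAt x.curve t₁ :=
    x.regular.1.continuousOn.continuousAt (Icc_mem_nhds ht₁.1 ht₁.2)
  obtain ⟨a, b, htab, hsub⟩ := mem_nhds_iff_exists_Ioo_subset.1
    (Filter.inter_mem hev (Filter.inter_mem (isOpen_Ioo.mem_nhds ht₁)
      (hcont.preimage_mem_nhds ((isOpen_source p).mem_nhds hp))))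
  have hlt : a < b := htab.1.trans htab.2
  have hab : Ioo a b ⊆ Ioo 0 T := fun t ht ↦ (hsub ht).2.1
  have hsrc : MapsTo x.curve (Ioo a b) (extChartAt 𝓘(ℝ, E) p).source := fun t ht ↦ (hsub ht).2.2
  have hzQ : ∀ t ∈ Ioo a b \ S, (ξ t, deriv ξ t, deriv (deriv ξ) t) ∈ Q := fun t ht ↦
    ((hsub ht.1).1 ⟨Ioo_subset_Icc_self (hab ht.1), ht.2⟩).2
  have hξ1 : ContDiffOn ℝ 1 ξ (Ioo a b) := by
    rw [hξ]
    exact contDiffOn_chart_comp (by simp) (x.regular.1.mono (hab.trans Ioo_subset_Icc_self)) hsrc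
  have hξU : MapsTo ξ (Ioo a b) (freeTarget (E := E) O p) := fun t ht ↦ by
    rw [hξ]; exact mem_freeTarget (hsrc ht) (x.avoids t (Ioo_subset_Icc_self (hab ht)))
  have hNopen : IsOpen (Ioo a b \ S) := isOpen_Ioo.sdiff hS.finite.isClosed
  have hξS : ContDiffOn ℝ ∞ ξ (Ioo a b \ S) := by
    rw [hξ]
    exact contDiffOn_chart_comp le_rfl
      (hS.contMDiffOn_diff.mono (sdiff_subset_sdiff_left hab)) (hsrc.mono_left sdiff_subset)
  have hξS' : ContDiffOn ℝ ∞ (deriv ξ) (Ioo a b \ S) := hξS.deriv_of_isOpen hNopen (by simp)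
  -- The inverse Legendre transform: the momentum θ = g(a + Γ(u, u), ·) is solved for a.
  have hK : ContDiffOn ℝ ∞ (fun w : E × E × (E →L[ℝ] ℝ) ↦
      (chartMetric p w.1).inverse w.2.2 - christoffelCLM (chartMetric p) w.1 w.2.1 w.2.1)
      (freeTarget (E := E) O p ×ˢ univ) := by
    have hm : MapsTo (Prod.fst : E × E × (E →L[ℝ] ℝ) → E) (freeTarget (E := E) O p ×ˢ univ)
      (freeTarget (E := E) O p) := fun w hw ↦ hw.1
    have h1 := hg.contDiffOn_inverse.comp (contDiff_fst (𝕜 := ℝ) (n := ∞)).contDiffOn hm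
    have h2 := hg.contDiffOn_christoffel.comp (contDiff_fst (𝕜 := ℝ) (n := ∞)).contDiffOn hm
    have hu : ContDiffOn ℝ ∞ (fun w : E × E × (E →L[ℝ] ℝ) ↦ w.2.1) (freeTarget (E := E) O p ×ˢ univ) :=
      (contDiff_fst.comp contDiff_snd).contDiffOn
    have hθ : ContDiffOn ℝ ∞ (fun w : E × E × (E →L[ℝ] ℝ) ↦ w.2.2) (freeTarget (E := E) O p ×ˢ univ) :=
      (contDiff_snd.comp contDiff_snd).contDiffOn
    exact (h1.clm_apply hθ).sub ((h2.clm_apply hu).clm_apply hu)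
  have hKL : ∀ y ∈ freeTarget (E := E) O p, ∀ u c : E, (chartMetric p y).inverse
      (fderiv ℝ (lagrangian (chartMetric p) σ (V ∘ (extChartAt 𝓘(ℝ, E) p).symm)) (y, u, c) ∘L
        (ContinuousLinearMap.inr ℝ E (E × E) ∘L ContinuousLinearMap.inr ℝ E E))
      - christoffelCLM (chartMetric p) y u u = c := by
    intro y hy u c
    have h1 : fderiv ℝ (lagrangian (chartMetric p) σ (V ∘ (extChartAt 𝓘(ℝ, E) p).symm)) (y, u, c) ∘L
        (ContinuousLinearMap.inr ℝ E (E × E) ∘L ContinuousLinearMap.inr ℝ E E) =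
        chartMetric p y (c + christoffelCLM (chartMetric p) y u u) := by
      ext h
      have := hg.fderiv_lagrangian σ hy ((hVp.contDiffAt (hfree.mem_nhds hy)).differentiableAt
        (by simp)) (a := c) (u := u) rfl 0 0 h
      simpa using this
    rw [h1, hg.inverse_apply hy]
    abel
  obtain ⟨hsm, hEL⟩ := weak_extremal_regularity hfree (hg.contDiffOn_lagrangian σ hVp) hK hKL hlt
    hS.finite (ξ := ξ) (u := deriv ξ) (α := deriv (deriv ξ))
    (fun t ht ↦ ((hξ1.contDiffAt (isOpen_Ioo.mem_nhds ht)).differentiableAt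
      (by simp)).hasDerivAt) (hξ1.continuousOn_deriv_of_isOpen isOpen_Ioo le_rfl)
    (fun t ht ↦ ((hξS'.contDiffAt (hNopen.mem_nhds ht)).differentiableAt (by simp)).hasDerivAt)
    (hξS'.continuousOn_deriv_of_isOpen hNopen (by simp)) hξU hQ hQU hzQ
    (fun φ hφ e ↦ integral_fderiv_lagrangian_eq_zero hO hV hx hS hlt hab hsrc hξ hQ hQU hzQ hφ e)
  refine ⟨?_, hg.euler_lagrange hVp isOpen_Ioo hsm hξU rfl htab (hEL t₁ htab)⟩
  have h1 : ContMDiffAt 𝓘(ℝ, ℝ) 𝓘(ℝ, E) ∞ ξ t₁ :=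
    (hsm.contDiffAt (isOpen_Ioo.mem_nhds htab)).contMDiffAt
  have h2 := (contMDiffAt_symm (hξU htab).1).comp t₁ h1
  refine h2.congr_of_eventuallyEq ?_
  filter_upwards [isOpen_Ioo.mem_nhds htab] with t ht
  rw [hξ]
  exact ((extChartAt 𝓘(ℝ, E) p).left_inv (hsrc ht)).symm

/-- A local minimizer of the energy is smooth. -/
theorem AdmissibleCurve.contMDiffOn_of_isLocalMin (hO : IsClosed O)
    (hV : ContMDiffOn 𝓘(ℝ, E) 𝓘(ℝ, ℝ) ∞ V Oᶜ) {x : AdmissibleCurve hT P₀ P₁ O}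
    (hx : IsLocalMin (AdmissibleCurve.energy σ V) x) :
    ContMDiffOn 𝓘(ℝ, ℝ) 𝓘(ℝ, E) ∞ x.curve (Icc 0 T) := by
  intro t ht
  rcases ht.1.eq_or_lt with h | h
  · exact h ▸ (x.regular.contMDiffWithinAt_endpoints hT).1
  rcases ht.2.eq_or_lt with h' | h'
  · exact h' ▸ (x.regular.contMDiffWithinAt_endpoints hT).2
  exact (exists_smooth_extremal hO hV hx ⟨h, h'⟩
    (mem_extChartAt_source (I := 𝓘(ℝ, E)) (x.curve t)) rfl).1.contMDiffWithinAt

/-- A local minimizer of the energy satisfies the Euler-Lagrange equation on the whole interval. -/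
theorem AdmissibleCurve.eulerLagrange_of_isLocalMin (hO : IsClosed O)
    (hV : ContMDiffOn 𝓘(ℝ, E) 𝓘(ℝ, ℝ) ∞ V Oᶜ) {x : AdmissibleCurve hT P₀ P₁ O}
    (hx : IsLocalMin (AdmissibleCurve.energy σ V) x) {t₀ : ℝ} (ht₀ : t₀ ∈ Icc 0 T) :
    curveDeriv (E := E) T x.curve 3 t₀
      + curvature (x.curve t₀) (curveDeriv (E := E) T x.curve 1 t₀)
          (velocity (E := E) T x.curve t₀) (velocity (E := E) T x.curve t₀)
      - σ • curveDeriv (E := E) T x.curve 1 t₀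
      + (1 / 2 : ℝ) • grad V (x.curve t₀) = 0 := by
  have hsm := contMDiffOn_of_isLocalMin hO hV hx
  set p := x.curve t₀ with hp_def
  have hp : p ∈ (extChartAt 𝓘(ℝ, E) p).source := mem_extChartAt_source p
  obtain ⟨N, hN, htN, hmaps⟩ :=
    exists_isOpen_mapsTo hsm.continuousOn (isOpen_source p) ht₀ hp
  have hsmN := hsm.mono (inter_subset_left : Icc 0 T ∩ N ⊆ Icc 0 T)
  set ξ : ℝ → E := fun r ↦ extChartAt 𝓘(ℝ, E) p (x.curve r) with hξ
  set c : ℕ → ℝ → E := fun k ↦ coordField p x.curve (curveDeriv T x.curve k) with hc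
  have hck : ∀ k, ContDiffOn ℝ ∞ (c k) (Icc 0 T ∩ N) := fun k ↦
    (coordField_curveDeriv hT hN hsmN hmaps k).1
  have hξs : ContDiffOn ℝ ∞ ξ (Icc 0 T ∩ N) := contDiffOn_chart_comp le_rfl hsmN hmaps
  have hg := IsSmoothOffFinite.isLocalMetric_freeTarget (E := E) hO p
  have hVp := contDiffOn_potential hV p
  have hξU : MapsTo ξ (Icc 0 T ∩ N) (freeTarget (E := E) O p) := fun t ht ↦
    mem_freeTarget (hmaps ht) (x.avoids t ht.1)
  -- The left-hand side in the fixed chart at x t₀. Unlike the expressions in varying tangent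
  -- spaces, it is an E-valued function whose continuity up to the ends of [0, T] makes sense.
  set Ψ : ℝ → E := fun t ↦ c 3 t
    + localCurvature (chartMetric p) (ξ t) (c 1 t) (c 0 t) (c 0 t) - σ • c 1 t
    + (1 / 2 : ℝ) • (chartMetric p (ξ t)).inverse
      (fderiv ℝ (V ∘ (extChartAt 𝓘(ℝ, E) p).symm) (ξ t)) with hΨ
  have hΨc : ContinuousOn Ψ (Icc 0 T ∩ N) := by
    have hΓ := hg.contDiffOn_christoffel
    have hΓc := hΓ.continuousOn.comp hξs.continuousOn hξU
    have hDΓ : ContinuousOn (fderiv ℝ (christoffelCLM (chartMetric p))) (freeTarget (E := E) O p) :=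
      hΓ.continuousOn_fderiv_of_isOpen hg.isOpen (by simp)
    have hDΓc := hDΓ.comp hξs.continuousOn hξU
    have h0 := (hck 0).continuousOn
    have h1 := (hck 1).continuousOn
    have hDV := (hVp.continuousOn_fderiv_of_isOpen hg.isOpen (by simp)).comp hξs.continuousOn hξU
    have hinv := hg.contDiffOn_inverse.continuousOn.comp hξs.continuousOn hξU
    refine (((hck 3).continuousOn.add ?_).sub (h1.const_smul σ)).add
      ((hinv.clm_apply hDV).const_smul _)
    exact (((((hDΓc.clm_apply h1).clm_apply h0).clm_apply h0).sub
      (((hDΓc.clm_apply h0).clm_apply h1).clm_apply h0)).add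
      ((hΓc.clm_apply h1).clm_apply ((hΓc.clm_apply h0).clm_apply h0))).sub
      ((hΓc.clm_apply h0).clm_apply ((hΓc.clm_apply h1).clm_apply h0))
  have hΨ0 : ∀ t ∈ N ∩ Ioo 0 T, Ψ t = 0 := by
    have hN' : IsOpen (N ∩ Ioo 0 T) := hN.inter isOpen_Ioo
    have hsub : N ∩ Ioo 0 T ⊆ Icc 0 T ∩ N := fun t ht ↦ ⟨Ioo_subset_Icc_self ht.2, ht.1⟩
    obtain ⟨e0, ek⟩ := coordField_curveDeriv_of_isOpen hT hN' inter_subset_right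
      (hsmN.mono hsub) (hmaps.mono_left hsub) hξ
    have hev : ∀ {w w' : ℝ → E}, (∀ t ∈ N ∩ Ioo 0 T, w t = w' t) →
        ∀ t ∈ N ∩ Ioo 0 T, w =ᶠ[𝓝 t] w' := fun h t ht ↦ by
      filter_upwards [hN'.mem_nhds ht] with r hr using h r hr
    have e1 : ∀ t ∈ N ∩ Ioo 0 T, c 1 t = covAlong (chartMetric p) ξ (deriv ξ) t := fun t ht ↦
      (ek 0 t ht).trans (covAlong_congr (hev e0 t ht))
    have e2 : ∀ t ∈ N ∩ Ioo 0 T, c 2 t = covAlong (chartMetric p) ξ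
        (covAlong (chartMetric p) ξ (deriv ξ)) t := fun t ht ↦
      (ek 1 t ht).trans (covAlong_congr (hev e1 t ht))
    have e3 : ∀ t ∈ N ∩ Ioo 0 T, c 3 t = covAlong (chartMetric p) ξ (covAlong (chartMetric p) ξ
        (covAlong (chartMetric p) ξ (deriv ξ))) t := fun t ht ↦
      (ek 2 t ht).trans (covAlong_congr (hev e2 t ht))
    have e0' : ∀ t ∈ N ∩ Ioo 0 T, c 0 t = deriv ξ t := e0
    intro t ht
    have := (exists_smooth_extremal hO hV hx ht.2 (hmaps (hsub ht)) hξ).2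
    rw [← e3 t ht, ← e1 t ht, ← e0' t ht] at this
    exact this
  -- Even an end point is a limit of interior times, where Ψ vanishes.
  have hcl : t₀ ∈ closure (N ∩ Ioo 0 T) :=
    hN.inter_closure ⟨htN, by rwa [closure_Ioo hT.ne]⟩
  have hne := mem_closure_iff_nhdsWithin_neBot.1 hcl
  have hsub : N ∩ Ioo 0 T ⊆ Icc 0 T ∩ N := fun t ht ↦ ⟨Ioo_subset_Icc_self ht.2, ht.1⟩
  have hlim := (hΨc t₀ ⟨ht₀, htN⟩).mono hsub
  have hΨt : Ψ t₀ = 0 := by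
    refine tendsto_nhds_unique hlim (tendsto_const_nhds.congr' ?_)
    filter_upwards [self_mem_nhdsWithin] with t ht using (hΨ0 t ht).symm
  have hVd : MDifferentiableAt 𝓘(ℝ, E) 𝓘(ℝ, ℝ) V p :=
    (hV.contMDiffAt (hO.isOpen_compl.mem_nhds (x.avoids t₀ ht₀))).mdifferentiableAt (by simp)
  refine (isInvertible_chartCoord hp).injective ?_
  rw [map_add, map_sub, map_add, map_smul, map_smul, map_zero, curvature_eq, chartCoord_grad hp hVd]
  exact hΨt

end Weak

end ObstacleAvoidance
end

theorem theorem3p3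
    {E : Type*} [NormedAddCommGroup E] [NormedSpace ℝ E] [FiniteDimensional ℝ E]
    {M : Type*} [TopologicalSpace M] [T2Space M] [ChartedSpace E M] [IsManifold 𝓘(ℝ, E) ∞ M]
    [RiemannianBundle (fun p : M ↦ TangentSpace 𝓘(ℝ, E) p)]
    [IsContMDiffRiemannianBundle 𝓘(ℝ, E) ∞ E (fun p : M ↦ TangentSpace 𝓘(ℝ, E) p)]
    {T σ : ℝ} (hT : 0 < T) (hσ : 0 < σ)
    (O : Set M) (hO : IsClosed O)
    (V : M → ℝ) (hV : ContMDiffOn 𝓘(ℝ, E) 𝓘(ℝ, ℝ) ∞ V Oᶜ)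
    (P₀ P₁ : TangentBundle 𝓘(ℝ, E) M)
    (x : AdmissibleCurve hT P₀ P₁ O)
    (hx : IsLocalMin (AdmissibleCurve.energy σ V) x) :
    ContMDiffOn 𝓘(ℝ, ℝ) 𝓘(ℝ, E) ∞ x.curve (Icc 0 T) ∧
    ∀ t ∈ Icc 0 T,
      curveDeriv (E := E) T x.curve 3 t
        + curvature (x.curve t) (curveDeriv (E := E) T x.curve 1 t) (velocity (E := E) T x.curve t)
            (velocity (E := E) T x.curve t)
        - σ • curveDeriv (E := E) T x.curve 1 t
        + (1 / 2 : ℝ) • grad V (x.curve t) = 0 :=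
  ⟨AdmissibleCurve.contMDiffOn_of_isLocalMin hO hV hx, fun _ ht ↦
    AdmissibleCurve.eulerLagrange_of_isLocalMin hO hV hx ht⟩
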